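/- **Theorem (Cloud decomposition).** Let $N\in\mathbb N=\{1,2,\dots\}$, $[N]=\{1,\dots,N\}$, and let $m_i\in(0,\infty)$, $a_i,b_i\in[0,\infty)$ for $i\in[N]$. Let $X=(X(t))_{t\ge 0}$, $X(t)=(X_1(t),\dots,X_N(t))$, be the continuous-time Markov chain on $\{x\in\mathbb Z^N: x_1\le\cdots\le x_N\}$, started from a deterministic (arbitrary) state $X(0)$ of this space, in which, from state $x$, the $i$-th coordinate jumps to $x_i-1$ at rate $A_i(x)$ and to $x_i+1$ at rate $B_i(x)$, where $$A_i(x)=\mathbf 1\{x_{i-1}<x_i\}\sum_{j=i}^N\frac{m_ja_j}{m_i}\mathbf 1\{x_j=x_i\},\qquad B_i(x)=\mathbf 1\{x_{i+1}>x_i\}\sum_{j=1}^i\frac{m_jb_j}{m_i}\mathbf 1\{x_j=x_i\},$$ with $x_0=-\infty$, $x_{N+1}=+\infty$. For $0\le k\le N$ put $M_k=\sum_{i=1}^k m_i$ and $U_k=-\sum_{i=1}^k m_i(b_i-a_i)$. Let $\overline u:[0,M_N]\to\mathbb R$ be the least continuous concave function with $U_k\le\overline u(M_k)$ for all $0\le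 k\le N$ (the least concave majorant), and let $V=\{k\in\{0,\dots,N\}:U_k=\overline u(M_k)\}=\{k_0<k_1<\cdots<k_\nu\}$ be its set of boundary indices. For $j\in[\nu]$ put $$\mathfrak C_j=\{i\in[N]:k_{j-1}<i\le k_j\},\qquad v_j=\frac{U_{k_j}-U_{k_{j-1}}}{M_{k_j}-M_{k_{j-1}}},\qquad \Delta_j(t)=\max_{i\in\mathfrak C_j}X_i(t)-\min_{i\in\mathfrak C_j}X_i(t),$$ and, for $j\in[\nu-1]$, $L_j(t)=\min_{i\in\mathfrak C_{j+1}}X_i(t)-\max_{i\in\mathfrak C_j}X_i(t)$. Assume the non-degeneracy condition $$\sum_{i\in\mathfrak C_j}(a_i+b_i)>0\quad\text{for every } j\in[\nu].$$ Then $\mathfrak C_1,\dots,\mathfrak C_\nu$ is an ordered partition of $[N]$ into non-empty sets, $v_1\ge v_2\ge\cdots\ge v_\nu$, and there are constants $C\ge0$, $\delta>0$ and $\varepsilon\in(0,1/2)$, depending only on $N$ and the $a_i,b_i,m_i$ (and not on $X(0)$), such that the following hold. (a) For every $j\in[\nu]$ and $i\in\mathfrak C_j$: $\lim_{t\to\infty}t^{-1}X_i(t)=-v_j$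 a.s. (b) For every $j\in[\nu]$, $$\sup_{t\ge0}\mathbb P[\Delta_j(t)\ge s]\le C\bigl[1+e^{C\Delta_j(0)}\bigr]e^{-\delta s}\quad\text{for all } s\ge0,$$ and $\limsup_{t\to\infty}\Delta_j(t)/\log t<\infty$ a.s. (c) Let $j\in[\nu-1]$. If $v_j>v_{j+1}$, then $\lim_{t\to\infty}t^{-1}L_j(t)=|v_{j+1}-v_j|>0$ a.s. If $v_j=v_{j+1}$, then $$\lim_{t\to\infty}\frac1{t^{1-\varepsilon}}\int_0^t\mathbf 1\{L_j(s)\le t^\varepsilon\}\,ds=0\ \text{ a.s.},\qquad\text{while}\qquad\liminf_{t\to\infty}L_j(t)=0\ \text{ a.s.}$$ -/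

import Mathlib

open MeasureTheory Filter Topology
open scoped ENNReal

noncomputable section

namespace Elastic

/-! Particles carry labels in `Fin N`; the particle with label `i : Fin N` is the `(i + 1)`-st
from the left. -/

/-- The configuration space: `x₁ ≤ ⋯ ≤ x_N`. -/
def configSpace (N : ℕ) : Set (Fin N → ℤ) := {x | Monotone x}

/-- Rate of a jump of particle `i` to the left. The condition on the left neighbour is void
for the leftmost particle (convention `x₀ = -∞`). -/
def leftRate {N : ℕ} (m a : Fin N → ℝ) (i : Fin N) (x : Fin N → ℤ) : ℝ :=
  if ∀ k : Fin N, (k : ℕ) + 1 = i → x k < x i then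
    ∑ j : Fin N, if i ≤ j ∧ x j = x i then m j * a j / m i else 0
  else 0

/-- Rate of a jump of particle `i` to the right. The condition on the right neighbour is void
for the rightmost particle (convention `x_{N+1} = +∞`). -/
def rightRate {N : ℕ} (m b : Fin N → ℝ) (i : Fin N) (x : Fin N → ℤ) : ℝ :=
  if ∀ k : Fin N, (i : ℕ) + 1 = k → x i < x k then
    ∑ j : Fin N, if j ≤ i ∧ x j = x i then m j * b j / m i else 0
  else 0

/-- The rate of the transition from `x` to `y`. -/
def transRate {N : ℕ} (m a b : Fin N → ℝ) (x y : Fin N → ℤ) : ℝ :=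
  ∑ i : Fin N, ((if y = x - Pi.single i 1 then leftRate m a i x else 0) +
    (if y = x + Pi.single i 1 then rightRate m b i x else 0))

/-- The total jump rate at `x`. -/
def totalRate {N : ℕ} (m a b : Fin N → ℝ) (x : Fin N → ℤ) : ℝ :=
  ∑ i : Fin N, (leftRate m a i x + rightRate m b i x)

/-- Transition probabilities of the embedded jump chain (an absorbing state stays put). -/
def jumpProb {N : ℕ} (m a b : Fin N → ℝ) (x y : Fin N → ℤ) : ℝ :=
  if totalRate m a b x = 0 then (if y = x then 1 else 0)
  else transRate m a b x y / totalRate m a b x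

/-- The σ-algebra generated by the states `Y 0, …, Y n` of the jump chain and by the holding
times `S 0, …, S (n - 1)`. -/
@[reducible] def jumpHistory {Ω : Type*} {N : ℕ} (Y : ℕ → Ω → Fin N → ℤ) (S : ℕ → Ω → ℝ≥0∞) (n : ℕ) :
    MeasurableSpace Ω :=
  (⨆ k ≤ n, MeasurableSpace.comap (Y k) inferInstance) ⊔
    (⨆ k < n, MeasurableSpace.comap (S k) inferInstance)

/-- `X` (of which only the times `t ≥ 0` matter) is the continuous-time Markov chain started
from `x₀` in which particle `i` jumps by `-1` at rate `leftRate m a i` and by `+1` at rate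
`rightRate m b i`, described by its jump chain `Y` and its holding times `S`: given the history
up to the `n`-th jump and `Y n = x`, the next state and the holding time at `x` are independent,
the former with law `jumpProb m a b x`, the latter exponential with parameter
`totalRate m a b x` (infinite if that rate is `0`). -/
def IsElasticSystem {Ω : Type*} [MeasurableSpace Ω] (P : Measure Ω) {N : ℕ}
    (m a b : Fin N → ℝ) (x₀ : Fin N → ℤ) (X : ℝ → Ω → Fin N → ℤ) : Prop :=
  (∀ t, 0 ≤ t → Measurable (X t)) ∧
  ∃ (Y : ℕ → Ω → Fin N → ℤ) (S : ℕ → Ω → ℝ≥0∞),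
    (∀ n, Measurable (Y n)) ∧ (∀ n, Measurable (S n)) ∧
    (∀ᵐ ω ∂P, Y 0 ω = x₀) ∧
    (∀ (n : ℕ) (A : Set Ω), MeasurableSet[jumpHistory Y S n] A →
      ∀ (x y : Fin N → ℤ) (s : ℝ), 0 ≤ s →
        P (A ∩ {ω | Y n ω = x ∧ Y (n + 1) ω = y ∧ ENNReal.ofReal s < S n ω}) =
          P (A ∩ {ω | Y n ω = x}) *
            ENNReal.ofReal (jumpProb m a b x y * Real.exp (-(totalRate m a b x * s)))) ∧
    (∀ᵐ ω ∂P, ∀ (t : ℝ) (n : ℕ), 0 ≤ t →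
      ∑ k ∈ Finset.range n, S k ω ≤ ENNReal.ofReal t →
      ENNReal.ofReal t < ∑ k ∈ Finset.range (n + 1), S k ω → X t ω = Y n ω)

/-- `M_k`, the total mass of the first `k` particles. -/
def massSum {N : ℕ} (m : Fin N → ℝ) (k : ℕ) : ℝ :=
  ∑ i : Fin N, if (i : ℕ) < k then m i else 0

/-- `U_k`, minus the total intrinsic momentum of the first `k` particles; the intrinsic velocity
of particle `i` is `b i - a i`. -/
def potSum {N : ℕ} (m a b : Fin N → ℝ) (k : ℕ) : ℝ :=
  -∑ i : Fin N, if (i : ℕ) < k then m i * (b i - a i) else 0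

/-- `f` is a concave majorant on `[0, M_N]` of the points `(M_k, U_k)`, `0 ≤ k ≤ N`. -/
def IsConcaveMajorant {N : ℕ} (m a b : Fin N → ℝ) (f : ℝ → ℝ) : Prop :=
  ContinuousOn f (Set.Icc 0 (massSum m N)) ∧
  ConcaveOn ℝ (Set.Icc 0 (massSum m N)) f ∧
  ∀ k : ℕ, k ≤ N → potSum m a b k ≤ f (massSum m k)

/-- The least concave majorant, as the pointwise infimum of all concave majorants. -/
def leastConcaveMajorant {N : ℕ} (m a b : Fin N → ℝ) (x : ℝ) : ℝ :=
  sInf {y | ∃ f : ℝ → ℝ, IsConcaveMajorant m a b f ∧ f x = y}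

/-- The set `V` of boundary indices. -/
def boundaryIndices {N : ℕ} (m a b : Fin N → ℝ) : Set ℕ :=
  {k | k ≤ N ∧ potSum m a b k = leastConcaveMajorant m a b (massSum m k)}

/-- For boundary indices `κ 0 < ⋯ < κ ν`, the `j`-th cloud consists of the particles whose
1-based label `i + 1` satisfies `κ_{j-1} < i + 1 ≤ κ_j`. -/
def cloud (N : ℕ) {ν : ℕ} (κ : Fin (ν + 1) → ℕ) (j : Fin ν) : Finset (Fin N) :=
  Finset.univ.filter fun i => κ j.castSucc < (i : ℕ) + 1 ∧ (i : ℕ) + 1 ≤ κ j.succ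

/-- The slope of the `j`-th boundary segment. -/
def slope {N : ℕ} (m a b : Fin N → ℝ) {ν : ℕ} (κ : Fin (ν + 1) → ℕ) (j : Fin ν) : ℝ :=
  (potSum m a b (κ j.succ) - potSum m a b (κ j.castSucc)) /
    (massSum m (κ j.succ) - massSum m (κ j.castSucc))

/-- Ordered partition of the set of labels into non-empty clouds. -/
def IsCloudDecomposition {N ν : ℕ} (C : Fin ν → Finset (Fin N)) : Prop :=
  (∀ j, (C j).Nonempty) ∧ (∀ i, ∃ j, i ∈ C j) ∧
  ∀ j j', j < j' → ∀ i ∈ C j, ∀ i' ∈ C j', i < i'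

/-- The span `Δ_C` of the particles labelled by a (non-empty) set `C` in configuration `x`. -/
def spread {N : ℕ} (C : Finset (Fin N)) (x : Fin N → ℤ) : ℤ :=
  sSup (x '' (C : Set (Fin N))) - sInf (x '' (C : Set (Fin N)))

/-- The distance from the rightmost particle of `C` to the leftmost particle of `C'`. -/
def gap {N : ℕ} (C C' : Finset (Fin N)) (x : Fin N → ℤ) : ℤ :=
  sInf (x '' (C' : Set (Fin N))) - sSup (x '' (C : Set (Fin N)))

end Elastic

end

noncomputable section

namespace Elastic

/-! ### The least concave majorant and its boundary indices. -/

section Majorant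

variable {N : ℕ} {m a b : Fin N → ℝ}

/-! Momentum is never lost in a stack of particles sharing a site: the leftward momentum of `j` acts
on the lowest label of its stack and the rightward momentum on the highest (`sum_rates_eq`). The
generator is therefore a sum over particles with redirected jumps, and drifts can be estimated
particle by particle. Let `w i` be minus the slope of the boundary segment of the cloud of `i`. The
concave majorant enters mainly through `exists_isStableBlock`: inside a cloud the proper initial
sums of `m i * (b i - a i - w i)` are at least some `ρ > 0`, while the full sum vanishes. By Abel
summation, pairing these weights with an ordered configuration gives at most `-ρ` times the span of
the cloud: relative to the cloud, its left end is driven to the right and its right end to the left.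

Speeds. In the second moment of the `x i - w i * t`, redirection only helps because `w` is
non-decreasing (`gen_sqMoment_le`), and Abel summation makes the linear part of the drift
non-positive. Its mean thus grows at most linearly (`sqMoment_step_le`), and a law of large numbers
along squares (`ae_tendsto_div_of_sq_le`) yields the speeds and the linear separation of clouds of
different speed.

Stability. The variance of a cloud about its centre of mass has drift at most `-2ρ` times the span
plus a constant, since collisions with other clouds only compress it. A small exponential of its
square root is a Lyapunov function `V` with generator at most `-c V + K`
(`IsStableBlock.exists_lyapunov`). This bounds the mean of `V` uniformly in time
(`IsJumpChain.lintegral_lyapunov_le`), hence exponential tails, and a summability argument along the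
jump chain gives logarithmic growth.

Equal speeds. The distance `D` between the centres of mass of two adjacent clouds has a drift coming
only from momentum exchanged at their three boundary indices. In mean this exchange is `O(√n)` over
`n` jumps, because it compensates first moments whose deviations are `O(√n)`
(`IsJumpChain.exists_sum_integral_push_le`). By non-degeneracy, `D` fluctuates or the two clouds
exchange momentum at every configuration (`exists_meanGapRate_ge`), so a Huber function of `D` with
threshold `R` measures the time spent in `D ≤ R`: it is `O((R + 1)√n)` in mean. With `R` of order `t
^ (1/8)` this is negligible against `t ^ (7/8)`, and logarithmic spans make a small gap force a
small `D`. Conversely, while the two clouds do not touch, `D` is a non-negative supermartingale that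
cannot remain bounded, so they must touch again (`IsJumpChain.ae_frequently_notMem`).

Most estimates live on the jump chain with the predictable clock `clock` of mean holding times; its
difference to the true jump times is `o(n)`. Only the Lyapunov bound at a fixed time needs the
holding times directly, through `lintegral_holdLaw_renewal`. -/

lemma massSum_zero (m : Fin N → ℝ) : massSum m 0 = 0 := by simp [massSum]

lemma massSum_lt (hm : ∀ i, 0 < m i) {k l : ℕ} (hkl : k < l) (hl : l ≤ N) :
    massSum m k < massSum m l := by
  unfold massSum
  refine Finset.sum_lt_sum (fun i _ => ?_) ⟨⟨k, by omega⟩, Finset.mem_univ _, ?_⟩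
  · have := hm i
    split_ifs <;> linarith
  · simpa [hkl] using hm _

lemma massSum_le (hm : ∀ i, 0 < m i) {k l : ℕ} (hkl : k ≤ l) :
    massSum m k ≤ massSum m l := by
  unfold massSum
  refine Finset.sum_le_sum (fun i _ => ?_)
  have := hm i
  split_ifs <;> linarith

lemma massSum_mem_Icc (hm : ∀ i, 0 < m i) {k : ℕ} (hk : k ≤ N) :
    massSum m k ∈ Set.Icc 0 (massSum m N) :=
  ⟨massSum_zero m ▸ massSum_le hm (Nat.zero_le k), massSum_le hm hk⟩

lemma isConcaveMajorant_line (m a b : Fin N → ℝ) (c s d : ℝ)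
    (h : ∀ k ≤ N, potSum m a b k ≤ c + s * (massSum m k - d)) :
    IsConcaveMajorant m a b (fun x => c + s * (x - d)) := by
  refine ⟨by fun_prop, ⟨convex_Icc _ _, ?_⟩, h⟩
  intro x _ y _ α β _ _ hαβ
  simp only [smul_eq_mul]
  apply le_of_eq
  have : β = 1 - α := by linarith
  subst this
  ring

lemma exists_isConcaveMajorant (m a b : Fin N → ℝ) : ∃ f, IsConcaveMajorant m a b f := by
  refine ⟨_, isConcaveMajorant_line m a b (∑ i ∈ Finset.range (N + 1), |potSum m a b i|) 0 0 ?_⟩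
  intro k hk
  have h1 : |potSum m a b k| ≤ ∑ i ∈ Finset.range (N + 1), |potSum m a b i| :=
    Finset.single_le_sum (f := fun i => |potSum m a b i|) (fun i _ => abs_nonneg _)
      (Finset.mem_range.2 (by omega))
  have := le_abs_self (potSum m a b k)
  linarith

/-- An index with a supporting line is a boundary index. -/
lemma mem_boundaryIndices_of_line {k : ℕ} (hk : k ≤ N) (s : ℝ)
    (h : ∀ i ≤ N, potSum m a b i ≤ potSum m a b k + s * (massSum m i - massSum m k)) :
    k ∈ boundaryIndices m a b := by
  refine ⟨hk, le_antisymm ?_ ?_⟩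
  -- Order bounds on a real `sInf` need side conditions: non-emptiness here, and boundedness below
  -- in the second half, where the value `potSum m a b k` itself is a lower bound.
  · obtain ⟨f, hf⟩ := exists_isConcaveMajorant m a b
    refine le_csInf ⟨_, f, hf, rfl⟩ ?_
    rintro y ⟨g, hg, rfl⟩
    exact hg.2.2 k hk
  · refine csInf_le ⟨potSum m a b k, ?_⟩ ⟨_, isConcaveMajorant_line m a b _ s _ h, by simp⟩
    rintro y ⟨g, hg, rfl⟩
    exact hg.2.2 k hk

/-- At a boundary index the polygon lies above all chords. -/
lemma chord_le_of_mem_boundaryIndices (hm : ∀ i, 0 < m i) {k : ℕ}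
    (hk : k ∈ boundaryIndices m a b) {i l : ℕ} (hik : i < k) (hkl : k < l) (hl : l ≤ N) :
    potSum m a b i * (massSum m l - massSum m k) + potSum m a b l * (massSum m k - massSum m i) ≤
      potSum m a b k * (massSum m l - massSum m i) := by
  have h1 := massSum_lt hm hik (hkl.le.trans hl)
  have h2 := massSum_lt hm hkl hl
  rw [hk.2]
  have h3 : 0 < massSum m l - massSum m i := by linarith
  rw [← div_le_iff₀ h3]
  obtain ⟨f, hf⟩ := exists_isConcaveMajorant m a b
  refine le_csInf ⟨_, f, hf, rfl⟩ ?_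
  rintro y ⟨g, hg, rfl⟩
  have hi := hg.2.2 i (by omega)
  have hl' := hg.2.2 l hl
  have := hg.2.1.2 (massSum_mem_Icc hm (k := i) (by omega)) (massSum_mem_Icc hm hl)
    (div_nonneg (sub_nonneg.2 h2.le) h3.le) (div_nonneg (sub_nonneg.2 h1.le) h3.le)
    (by field_simp; ring)
  simp only [smul_eq_mul] at this
  have e : (massSum m l - massSum m k) / (massSum m l - massSum m i) * massSum m i +
      (massSum m k - massSum m i) / (massSum m l - massSum m i) * massSum m l = massSum m k := by
    field_simp; ring
  rw [e] at this
  refine le_trans ?_ this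
  rw [div_le_iff₀ h3]
  have e2 : ((massSum m l - massSum m k) / (massSum m l - massSum m i) * g (massSum m i) +
      (massSum m k - massSum m i) / (massSum m l - massSum m i) * g (massSum m l)) *
      (massSum m l - massSum m i) = (massSum m l - massSum m k) * g (massSum m i) +
      (massSum m k - massSum m i) * g (massSum m l) := by
    field_simp
  rw [e2]
  nlinarith

/-- Strictly between two consecutive boundary indices the polygon lies strictly below the
boundary segment. -/
lemma lt_chord_of_consecutive (hm : ∀ i, 0 < m i) {p q : ℕ}
    (hp : p ∈ boundaryIndices m a b) (hq : q ∈ boundaryIndices m a b)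
    (hgap : ∀ k, p < k → k < q → k ∉ boundaryIndices m a b) {k : ℕ} (hpk : p < k) (hkq : k < q) :
    potSum m a b k * (massSum m q - massSum m p) <
      potSum m a b p * (massSum m q - massSum m k) +
        potSum m a b q * (massSum m k - massSum m p) := by
  have hpq := massSum_lt hm (hpk.trans hkq) hq.1
  -- `g i` is the height of the point `i` over the chord from `p` to `q`, multiplied by the positive
  -- length of the chord's base.
  set g : ℕ → ℝ := fun i => potSum m a b i * (massSum m q - massSum m p) -
    (potSum m a b p * (massSum m q - massSum m i) + potSum m a b q * (massSum m i - massSum m p))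
    with hg
  obtain ⟨k', hk', hmax⟩ := (Finset.Ioo p q).exists_max_image g
    ⟨k, Finset.mem_Ioo.2 ⟨hpk, hkq⟩⟩
  rw [Finset.mem_Ioo] at hk'
  suffices h : g k' < 0 by
    have := hmax k (Finset.mem_Ioo.2 ⟨hpk, hkq⟩)
    have h3 : g k < 0 := this.trans_lt h
    simp only [hg] at h3
    linarith
  by_contra! h
  -- Outside `[p, q]` the chord inequalities at `p` and `q` give `g ≤ 0`. If the interior maximum of
  -- `g` were non-negative, it would be global, and the parallel to the chord through `k'` would
  -- support the polygon, making `k'` a boundary index.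
  have hall : ∀ i ≤ N, g i ≤ g k' := by
    intro i hi
    rcases lt_trichotomy i p with h1 | h1 | h1
    · refine le_trans ?_ h
      have := chord_le_of_mem_boundaryIndices hm hp h1 (hpk.trans hkq) hq.1
      simp only [hg]
      nlinarith
    · refine le_trans (le_of_eq ?_) h
      simp only [hg, h1]; ring
    · rcases lt_trichotomy i q with h2 | h2 | h2
      · exact hmax i (Finset.mem_Ioo.2 ⟨h1, h2⟩)
      · refine le_trans (le_of_eq ?_) h
        simp only [hg, h2]; ring
      · refine le_trans ?_ h
        have := chord_le_of_mem_boundaryIndices hm hq (hpk.trans hkq) h2 hi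
        simp only [hg]
        nlinarith
  refine hgap k' hk'.1 hk'.2 (mem_boundaryIndices_of_line (hk'.2.le.trans hq.1)
    ((potSum m a b q - potSum m a b p) / (massSum m q - massSum m p)) ?_)
  intro i hi
  have := hall i hi
  have h3 : 0 < massSum m q - massSum m p := by linarith
  simp only [hg] at this
  rw [← mul_le_mul_iff_of_pos_right h3]
  have e : (potSum m a b k' + (potSum m a b q - potSum m a b p) / (massSum m q - massSum m p) *
      (massSum m i - massSum m k')) * (massSum m q - massSum m p) =
      potSum m a b k' * (massSum m q - massSum m p) + (potSum m a b q - potSum m a b p) *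
      (massSum m i - massSum m k') := by
    field_simp
  rw [e]
  nlinarith

/-- A slope exceeding all difference quotients from the left end gives a supporting line there. The
sum of their absolute values will do; its term at `i = 0` is `0 / 0 = 0`. -/
lemma zero_mem_boundaryIndices (hm : ∀ i, 0 < m i) : 0 ∈ boundaryIndices m a b := by
  refine mem_boundaryIndices_of_line (Nat.zero_le N)
    (∑ i ∈ Finset.range (N + 1), |potSum m a b i - potSum m a b 0| / massSum m i) ?_
  intro k hk
  rcases Nat.eq_zero_or_pos k with rfl | hk0
  · simp
  have hM : 0 < massSum m k := massSum_zero m ▸ massSum_lt hm hk0 hk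
  have h1 : |potSum m a b k - potSum m a b 0| / massSum m k ≤
      ∑ i ∈ Finset.range (N + 1), |potSum m a b i - potSum m a b 0| / massSum m i :=
    Finset.single_le_sum (f := fun i => |potSum m a b i - potSum m a b 0| / massSum m i)
      (fun i _ => div_nonneg (abs_nonneg _) (massSum_zero m ▸ massSum_le hm (Nat.zero_le i)))
      (Finset.mem_range.2 (by omega))
  rw [div_le_iff₀ hM] at h1
  have := le_abs_self (potSum m a b k - potSum m a b 0)
  rw [massSum_zero, sub_zero]
  linarith

lemma last_mem_boundaryIndices (hm : ∀ i, 0 < m i) : N ∈ boundaryIndices m a b := by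
  refine mem_boundaryIndices_of_line le_rfl
    (-∑ i ∈ Finset.range N, |potSum m a b i - potSum m a b N| / (massSum m N - massSum m i)) ?_
  intro k hk
  rcases hk.eq_or_lt with rfl | hk0
  · simp
  have hM : 0 < massSum m N - massSum m k := sub_pos.2 (massSum_lt hm hk0 le_rfl)
  have h1 : |potSum m a b k - potSum m a b N| / (massSum m N - massSum m k) ≤
      ∑ i ∈ Finset.range N, |potSum m a b i - potSum m a b N| / (massSum m N - massSum m i) :=
    Finset.single_le_sum
      (f := fun i => |potSum m a b i - potSum m a b N| / (massSum m N - massSum m i))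
      (fun i hi => div_nonneg (abs_nonneg _)
        (sub_nonneg.2 (massSum_le hm (Finset.mem_range.1 hi).le)))
      (Finset.mem_range.2 hk0)
  rw [div_le_iff₀ hM] at h1
  have := le_abs_self (potSum m a b k - potSum m a b N)
  linarith

variable {ν : ℕ} {κ : Fin (ν + 1) → ℕ}

lemma kappa_zero (hm : ∀ i, 0 < m i) (hκ : StrictMono κ)
    (hV : Set.range κ = boundaryIndices m a b) : κ 0 = 0 := by
  have : (0 : ℕ) ∈ Set.range κ := hV ▸ zero_mem_boundaryIndices hm
  obtain ⟨i, hi⟩ := this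
  have := hκ.monotone (Fin.zero_le i)
  omega

lemma kappa_le (hV : Set.range κ = boundaryIndices m a b) (j : Fin (ν + 1)) : κ j ≤ N := by
  have : κ j ∈ boundaryIndices m a b := hV ▸ Set.mem_range_self j
  exact this.1

lemma kappa_last (hm : ∀ i, 0 < m i) (hκ : StrictMono κ)
    (hV : Set.range κ = boundaryIndices m a b) : κ (Fin.last ν) = N := by
  have : N ∈ Set.range κ := hV ▸ last_mem_boundaryIndices hm
  obtain ⟨i, hi⟩ := this
  have := hκ.monotone (Fin.le_last i)
  have := kappa_le hV (Fin.last ν)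
  omega

lemma kappa_lt (hκ : StrictMono κ) (j : Fin ν) : κ j.castSucc < κ j.succ :=
  hκ (Fin.castSucc_lt_succ)

lemma notMem_boundaryIndices (hκ : StrictMono κ) (hV : Set.range κ = boundaryIndices m a b)
    (j : Fin ν) (k : ℕ) (h1 : κ j.castSucc < k) (h2 : k < κ j.succ) :
    k ∉ boundaryIndices m a b := by
  rw [← hV]
  rintro ⟨i, rfl⟩
  have h1' := hκ.lt_iff_lt.1 h1
  have h2' := hκ.lt_iff_lt.1 h2
  simp only [Fin.lt_def, Fin.val_castSucc, Fin.val_succ] at h1' h2'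
  omega

lemma mem_cloud {j : Fin ν} {i : Fin N} :
    i ∈ cloud N κ j ↔ κ j.castSucc ≤ i ∧ (i : ℕ) < κ j.succ := by
  simp only [cloud, Finset.mem_filter, Finset.mem_univ, true_and]
  omega

lemma cloud_lt_of_lt (hκ : StrictMono κ) {j j' : Fin ν} (h : j < j') {i i' : Fin N}
    (hi : i ∈ cloud N κ j) (hi' : i' ∈ cloud N κ j') : i < i' := by
  rw [mem_cloud] at hi hi'
  have : κ j.succ ≤ κ j'.castSucc := hκ.monotone (by
    simp only [Fin.le_def, Fin.val_castSucc, Fin.val_succ]; exact h)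
  rw [Fin.lt_def]; omega

lemma exists_mem_cloud (hm : ∀ i, 0 < m i) (hκ : StrictMono κ)
    (hV : Set.range κ = boundaryIndices m a b) (i : Fin N) : ∃ j, i ∈ cloud N κ j := by
  by_contra! h
  have key : ∀ l : ℕ, ∀ hl : l < ν + 1, κ ⟨l, hl⟩ ≤ i := by
    intro l
    induction l with
    | zero =>
      intro hl
      have := kappa_zero hm hκ hV
      have e : (⟨0, hl⟩ : Fin (ν + 1)) = 0 := rfl
      rw [e]; omega
    | succ l ih =>
      intro hl
      have h1 := ih (by omega)
      have h2 := h ⟨l, by omega⟩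
      rw [mem_cloud] at h2
      by_contra! h3
      exact h2 ⟨h1, h3⟩
  have := key ν (by omega)
  have h2 := kappa_last hm hκ hV
  have e : (⟨ν, by omega⟩ : Fin (ν + 1)) = Fin.last ν := rfl
  rw [e, h2] at this
  have := i.2
  omega

lemma isCloudDecomposition_cloud (hm : ∀ i, 0 < m i) (hκ : StrictMono κ)
    (hV : Set.range κ = boundaryIndices m a b) : IsCloudDecomposition (cloud N κ) := by
  refine ⟨fun j => ?_, exists_mem_cloud hm hκ hV, fun j j' h i hi i' hi' =>
    cloud_lt_of_lt hκ h hi hi'⟩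
  have h1 := kappa_lt hκ j
  have h2 := kappa_le hV j.succ
  exact ⟨⟨κ j.castSucc, by omega⟩, mem_cloud.2 ⟨le_rfl, h1⟩⟩

/-- For neighbouring segments this is the chord inequality at their common boundary index; induction
extends it to all pairs. -/
lemma slope_anti (hm : ∀ i, 0 < m i) (hκ : StrictMono κ)
    (hV : Set.range κ = boundaryIndices m a b) : Antitone (slope m a b κ) := by
  have key : ∀ j j' : Fin ν, (j' : ℕ) = j + 1 → slope m a b κ j' ≤ slope m a b κ j := by
    intro j j' hj
    have e : j'.castSucc = j.succ := by ext; simp [hj]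
    have h1 := kappa_lt hκ j
    have h2 := kappa_lt hκ j'
    have hN := kappa_le hV j'.succ
    rw [e] at h2
    have hc := chord_le_of_mem_boundaryIndices hm (hV ▸ Set.mem_range_self j.succ) h1 h2 hN
    have m1 := massSum_lt hm h1 (h2.le.trans hN)
    have m2 := massSum_lt hm h2 hN
    unfold slope
    rw [e, div_le_div_iff₀ (by linarith) (by linarith)]
    nlinarith
  intro j j' h
  obtain ⟨j, hj⟩ := j
  obtain ⟨j', hj'⟩ := j'
  simp only [Fin.mk_le_mk] at h
  induction j', h using Nat.le_induction with
  | base => exact le_rfl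
  | succ l hl ih => exact (key ⟨l, by omega⟩ ⟨l + 1, hj'⟩ rfl).trans (ih (by omega))

end Majorant

/-! ### Stacks of particles, the generator and the transfer of momentum. -/

section Stacks

variable {N : ℕ}

/-- The lowest label of the stack of particles sitting at the site of particle `j`. -/
def bot (x : Fin N → ℤ) (j : Fin N) : Fin N :=
  (Finset.univ.filter fun i => x i = x j).min' ⟨j, by simp⟩

/-- The highest label of the stack of particles sitting at the site of particle `j`. -/
def top (x : Fin N → ℤ) (j : Fin N) : Fin N :=
  (Finset.univ.filter fun i => x i = x j).max' ⟨j, by simp⟩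

lemma apply_bot (x : Fin N → ℤ) (j : Fin N) : x (bot x j) = x j :=
  (Finset.mem_filter.1 ((Finset.univ.filter fun i => x i = x j).min'_mem ⟨j, by simp⟩)).2

lemma apply_top (x : Fin N → ℤ) (j : Fin N) : x (top x j) = x j :=
  (Finset.mem_filter.1 ((Finset.univ.filter fun i => x i = x j).max'_mem ⟨j, by simp⟩)).2

lemma bot_le_of_eq {x : Fin N → ℤ} {i j : Fin N} (h : x i = x j) : bot x j ≤ i :=
  Finset.min'_le _ _ (by simp [h])

lemma le_top_of_eq {x : Fin N → ℤ} {i j : Fin N} (h : x i = x j) : i ≤ top x j :=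
  Finset.le_max' _ _ (by simp [h])

lemma bot_le (x : Fin N → ℤ) (j : Fin N) : bot x j ≤ j := bot_le_of_eq rfl

lemma le_top (x : Fin N → ℤ) (j : Fin N) : j ≤ top x j := le_top_of_eq rfl

/-- In an ordered configuration a stack is an interval of labels, and the neighbour condition in the
rate singles out its lowest label. So the particles `j` whose momentum `i` receives are exactly
those with `bot x j = i`. -/
lemma leftRate_eq_sum_bot (m a : Fin N → ℝ) {x : Fin N → ℤ} (hx : Monotone x) (i : Fin N) :
    leftRate m a i x = ∑ j, if bot x j = i then m j * a j / m i else 0 := by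
  unfold leftRate
  split_ifs with h
  · refine Finset.sum_congr rfl fun j _ => if_congr ?_ rfl rfl
    constructor
    · rintro ⟨h1, h2⟩
      refine le_antisymm (bot_le_of_eq h2.symm) ?_
      by_contra! h3
      have h4 : (bot x j : ℕ) < i := h3
      have h5 := h ⟨(i : ℕ) - 1, by omega⟩ (by simp; omega)
      have h6 : x (bot x j) ≤ x ⟨(i : ℕ) - 1, by omega⟩ := hx (by rw [Fin.le_def]; simp; omega)
      rw [apply_bot x, h2] at h6
      omega
    · rintro rfl
      exact ⟨bot_le x j, (apply_bot x j).symm⟩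
  · push Not at h
    obtain ⟨k, hk, hki⟩ := h
    symm
    refine Finset.sum_eq_zero fun j _ => if_neg ?_
    rintro rfl
    have h1 : x k = x (bot x j) := le_antisymm (hx (by rw [Fin.le_def]; omega)) hki
    rw [apply_bot x] at h1
    have := bot_le_of_eq h1
    rw [Fin.le_def] at this
    omega

lemma rightRate_eq_sum_top (m b : Fin N → ℝ) {x : Fin N → ℤ} (hx : Monotone x) (i : Fin N) :
    rightRate m b i x = ∑ j, if top x j = i then m j * b j / m i else 0 := by
  unfold rightRate
  split_ifs with h
  · refine Finset.sum_congr rfl fun j _ => if_congr ?_ rfl rfl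
    constructor
    · rintro ⟨h1, h2⟩
      refine le_antisymm ?_ (le_top_of_eq h2.symm)
      by_contra! h3
      have h4 : (i : ℕ) < top x j := h3
      have h7 := (top x j).2
      have h5 := h ⟨(i : ℕ) + 1, by omega⟩ (by simp)
      have h6 : x ⟨(i : ℕ) + 1, by omega⟩ ≤ x (top x j) := hx (by rw [Fin.le_def]; simp; omega)
      rw [apply_top x, h2] at h6
      omega
    · rintro rfl
      exact ⟨le_top x j, (apply_top x j).symm⟩
  · push Not at h
    obtain ⟨k, hk, hki⟩ := h
    symm
    refine Finset.sum_eq_zero fun j _ => if_neg ?_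
    rintro rfl
    have h1 : x k = x (top x j) := le_antisymm hki (hx (by rw [Fin.le_def]; omega))
    rw [apply_top x] at h1
    have := le_top_of_eq h1
    rw [Fin.le_def] at this
    omega

/-- The momentum carried by a stack is transferred to its extreme particles. -/
lemma sum_rates_eq (m a b : Fin N → ℝ) {x : Fin N → ℤ} (hx : Monotone x) (g g' : Fin N → ℝ) :
    ∑ i, (leftRate m a i x * g i + rightRate m b i x * g' i) =
      ∑ j, (m j * a j / m (bot x j) * g (bot x j) + m j * b j / m (top x j) * g' (top x j)) := by
  simp only [Finset.sum_add_distrib, leftRate_eq_sum_bot m a hx, rightRate_eq_sum_top m b hx,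
    Finset.sum_mul]
  congr 1
  · rw [Finset.sum_comm]
    refine Finset.sum_congr rfl fun j _ => ?_
    simp [ite_mul]
  · rw [Finset.sum_comm]
    refine Finset.sum_congr rfl fun j _ => ?_
    simp [ite_mul]

variable {m a b : Fin N → ℝ}

lemma leftRate_nonneg (hm : ∀ i, 0 < m i) (ha : ∀ i, 0 ≤ a i) (i : Fin N) (x : Fin N → ℤ) :
    0 ≤ leftRate m a i x := by
  unfold leftRate
  split_ifs
  · refine Finset.sum_nonneg fun j _ => ?_
    split_ifs
    · exact div_nonneg (mul_nonneg (hm j).le (ha j)) (hm i).le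
    · exact le_rfl
  · exact le_rfl

lemma rightRate_nonneg (hm : ∀ i, 0 < m i) (hb : ∀ i, 0 ≤ b i) (i : Fin N) (x : Fin N → ℤ) :
    0 ≤ rightRate m b i x := by
  unfold rightRate
  split_ifs
  · refine Finset.sum_nonneg fun j _ => ?_
    split_ifs
    · exact div_nonneg (mul_nonneg (hm j).le (hb j)) (hm i).le
    · exact le_rfl
  · exact le_rfl

lemma totalRate_nonneg (hm : ∀ i, 0 < m i) (ha : ∀ i, 0 ≤ a i) (hb : ∀ i, 0 ≤ b i)
    (x : Fin N → ℤ) : 0 ≤ totalRate m a b x :=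
  Finset.sum_nonneg fun i _ => add_nonneg (leftRate_nonneg hm ha i x) (rightRate_nonneg hm hb i x)

/-- A non-zero rate implies the neighbour condition `x (i - 1) < x i`, so on integers one step to
the left cannot overtake. -/
lemma monotone_sub_single {x : Fin N → ℤ} (hx : Monotone x) {i : Fin N}
    (h : leftRate m a i x ≠ 0) : Monotone (x - Pi.single i 1) := by
  have hc : ∀ k : Fin N, (k : ℕ) + 1 = i → x k < x i := by
    by_contra h'
    exact h (by unfold leftRate; rw [if_neg h'])
  intro p q hpq
  have h1 := hx hpq
  simp only [Pi.sub_apply]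
  by_cases hq : q = i
  · subst hq
    by_cases hp : p = q
    · subst hp; exact le_rfl
    · have hlt : (p : ℕ) < q := lt_of_le_of_ne hpq (fun h => hp (Fin.ext h))
      have h2 := hc ⟨(q : ℕ) - 1, by omega⟩ (by simp; omega)
      have h3 : x p ≤ x ⟨(q : ℕ) - 1, by omega⟩ := hx (by rw [Fin.le_def]; simp; omega)
      rw [Pi.single_eq_same, Pi.single_eq_of_ne hp]
      omega
  · rw [Pi.single_eq_of_ne hq]
    by_cases hp : p = i
    · subst hp; rw [Pi.single_eq_same]; omega
    · rw [Pi.single_eq_of_ne hp]; omega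

lemma monotone_add_single {x : Fin N → ℤ} (hx : Monotone x) {i : Fin N}
    (h : rightRate m b i x ≠ 0) : Monotone (x + Pi.single i 1) := by
  have hc : ∀ k : Fin N, (i : ℕ) + 1 = k → x i < x k := by
    by_contra h'
    exact h (by unfold rightRate; rw [if_neg h'])
  intro p q hpq
  have h1 := hx hpq
  simp only [Pi.add_apply]
  by_cases hp : p = i
  · subst hp
    by_cases hq : q = p
    · subst hq; exact le_rfl
    · have hlt : (p : ℕ) < q := lt_of_le_of_ne hpq (fun h => hq (Fin.ext h.symm))
      have h2 := hc ⟨(p : ℕ) + 1, by omega⟩ (by simp)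
      have h3 : x ⟨(p : ℕ) + 1, by omega⟩ ≤ x q := hx (by rw [Fin.le_def]; simp; omega)
      rw [Pi.single_eq_same, Pi.single_eq_of_ne hq]
      omega
  · rw [Pi.single_eq_of_ne hp]
    by_cases hq : q = i
    · subst hq; rw [Pi.single_eq_same]; omega
    · rw [Pi.single_eq_of_ne hq]; omega

/-- The generator of the chain. -/
def gen (m a b : Fin N → ℝ) (f : (Fin N → ℤ) → ℝ) (x : Fin N → ℤ) : ℝ :=
  ∑ i, (leftRate m a i x * (f (x - Pi.single i 1) - f x) +
    rightRate m b i x * (f (x + Pi.single i 1) - f x))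

lemma gen_eq (m a b : Fin N → ℝ) (f : (Fin N → ℤ) → ℝ) {x : Fin N → ℤ} (hx : Monotone x) :
    gen m a b f x = ∑ j, (m j * a j / m (bot x j) * (f (x - Pi.single (bot x j) 1) - f x) +
      m j * b j / m (top x j) * (f (x + Pi.single (top x j) 1) - f x)) :=
  sum_rates_eq m a b hx _ _

lemma gen_congr {f g : (Fin N → ℤ) → ℝ} {x : Fin N → ℤ}
    (h : ∀ y, f y = g y) : gen m a b f x = gen m a b g x := by
  rw [show f = g from funext h]

lemma gen_add (f g : (Fin N → ℤ) → ℝ) (x : Fin N → ℤ) :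
    gen m a b (fun y => f y + g y) x = gen m a b f x + gen m a b g x := by
  simp only [gen, ← Finset.sum_add_distrib]
  exact Finset.sum_congr rfl fun i _ => by ring

lemma gen_const_mul (c : ℝ) (f : (Fin N → ℤ) → ℝ) (x : Fin N → ℤ) :
    gen m a b (fun y => c * f y) x = c * gen m a b f x := by
  simp only [gen, Finset.mul_sum]
  exact Finset.sum_congr rfl fun i _ => by ring

/-- A pointwise bound on the increments along the possible jumps bounds the generator. -/
lemma gen_le_of_incr_le (hm : ∀ i, 0 < m i) (ha : ∀ i, 0 ≤ a i) (hb : ∀ i, 0 ≤ b i)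
    {f g : (Fin N → ℤ) → ℝ} {x : Fin N → ℤ} (hx : Monotone x) (α β : ℝ)
    (h : ∀ y, Monotone y → (∃ i, y = x - Pi.single i 1 ∨ y = x + Pi.single i 1) →
      f y - f x ≤ α * (g y - g x) + β) :
    gen m a b f x ≤ α * gen m a b g x + β * totalRate m a b x := by
  simp only [gen, totalRate, Finset.mul_sum, ← Finset.sum_add_distrib]
  refine Finset.sum_le_sum fun i _ => ?_
  have h1 : leftRate m a i x * (f (x - Pi.single i 1) - f x) ≤
      leftRate m a i x * (α * (g (x - Pi.single i 1) - g x) + β) := by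
    by_cases h0 : leftRate m a i x = 0
    · simp [h0]
    · exact mul_le_mul_of_nonneg_left (h _ (monotone_sub_single hx h0) ⟨i, Or.inl rfl⟩)
        (leftRate_nonneg hm ha i x)
  have h2 : rightRate m b i x * (f (x + Pi.single i 1) - f x) ≤
      rightRate m b i x * (α * (g (x + Pi.single i 1) - g x) + β) := by
    by_cases h0 : rightRate m b i x = 0
    · simp [h0]
    · exact mul_le_mul_of_nonneg_left (h _ (monotone_add_single hx h0) ⟨i, Or.inr rfl⟩)
        (rightRate_nonneg hm hb i x)
  linarith

/-- A uniform lower bound for the total jump rate. -/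
def rateMin (m a b : Fin N → ℝ) : ℝ := (∑ j, m j * (a j + b j)) / ∑ i, m i

/-- A uniform upper bound for the total jump rate. -/
def rateMax (m a b : Fin N → ℝ) : ℝ := ∑ j, ∑ i, m j * (a j + b j) / m i

lemma totalRate_eq {x : Fin N → ℤ} (hx : Monotone x) :
    totalRate m a b x = ∑ j, (m j * a j / m (bot x j) + m j * b j / m (top x j)) := by
  have := sum_rates_eq m a b hx (fun _ => 1) (fun _ => 1)
  simpa [totalRate] using this

lemma le_sum_mass (hm : ∀ i, 0 < m i) (i : Fin N) : m i ≤ ∑ i, m i :=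
  Finset.single_le_sum (fun i _ => (hm i).le) (Finset.mem_univ i)

/-- The momentum of each particle is redirected but not lost, and the particle receiving it has at
most the total mass. When `rateMin` is positive, this excludes absorbing states and keeps the mean
holding times bounded. -/
lemma rateMin_le (hm : ∀ i, 0 < m i) (ha : ∀ i, 0 ≤ a i) (hb : ∀ i, 0 ≤ b i)
    {x : Fin N → ℤ} (hx : Monotone x) : rateMin m a b ≤ totalRate m a b x := by
  rw [totalRate_eq hx, rateMin, Finset.sum_div]
  refine Finset.sum_le_sum fun j _ => ?_
  rw [mul_add, add_div]
  have h1 := mul_nonneg (hm j).le (ha j)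
  have h2 := mul_nonneg (hm j).le (hb j)
  exact add_le_add (div_le_div_of_nonneg_left h1 (hm _) (le_sum_mass hm _))
    (div_le_div_of_nonneg_left h2 (hm _) (le_sum_mass hm _))

lemma le_rateMax (hm : ∀ i, 0 < m i) (ha : ∀ i, 0 ≤ a i) (hb : ∀ i, 0 ≤ b i)
    {x : Fin N → ℤ} (hx : Monotone x) : totalRate m a b x ≤ rateMax m a b := by
  rw [totalRate_eq hx, rateMax]
  refine Finset.sum_le_sum fun j _ => ?_
  have h1 : ∀ i, 0 ≤ m j * a j / m i := fun i =>
    div_nonneg (mul_nonneg (hm j).le (ha j)) (hm i).le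
  have h2 : ∀ i, 0 ≤ m j * b j / m i := fun i =>
    div_nonneg (mul_nonneg (hm j).le (hb j)) (hm i).le
  have e : ∑ i, m j * (a j + b j) / m i = ∑ i, m j * a j / m i + ∑ i, m j * b j / m i := by
    rw [← Finset.sum_add_distrib]
    exact Finset.sum_congr rfl fun i _ => by ring
  rw [e]
  exact add_le_add
    (Finset.single_le_sum (f := fun i => m j * a j / m i) (fun i _ => h1 i) (Finset.mem_univ _))
    (Finset.single_le_sum (f := fun i => m j * b j / m i) (fun i _ => h2 i) (Finset.mem_univ _))

lemma rateMin_pos (hm : ∀ i, 0 < m i) (ha : ∀ i, 0 ≤ a i) (hb : ∀ i, 0 ≤ b i) {s : Finset (Fin N)}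
    (h : 0 < ∑ i ∈ s, (a i + b i)) : 0 < rateMin m a b := by
  obtain ⟨i, hi, hi'⟩ := Finset.exists_ne_zero_of_sum_ne_zero h.ne'
  have hi2 : 0 < a i + b i := lt_of_le_of_ne (add_nonneg (ha i) (hb i)) hi'.symm
  refine div_pos ?_ ((hm i).trans_le (le_sum_mass hm i))
  exact Finset.sum_pos' (fun j _ => mul_nonneg (hm j).le (add_nonneg (ha j) (hb j)))
    ⟨i, Finset.mem_univ i, mul_pos (hm i) hi2⟩

/-- The momentum transferred across the index `k` by particles sharing a site. -/
def push (m a b : Fin N → ℝ) (k : ℕ) (x : Fin N → ℤ) : ℝ :=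
  ∑ j : Fin N, ((if (bot x j : ℕ) < k ∧ k ≤ j then m j * a j else 0) +
    (if (j : ℕ) < k ∧ k ≤ top x j then m j * b j else 0))

lemma push_nonneg (hm : ∀ i, 0 < m i) (ha : ∀ i, 0 ≤ a i) (hb : ∀ i, 0 ≤ b i) (k : ℕ)
    (x : Fin N → ℤ) : 0 ≤ push m a b k x := by
  refine Finset.sum_nonneg fun j _ => ?_
  have h1 := mul_nonneg (hm j).le (ha j)
  have h2 := mul_nonneg (hm j).le (hb j)
  split_ifs <;> linarith

/-- There is no transfer of momentum across an index at which the configuration increases. -/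
lemma push_eq_zero {k : ℕ} {x : Fin N → ℤ}
    (h : ∀ p q : Fin N, (p : ℕ) < k → k ≤ q → x p < x q) : push m a b k x = 0 := by
  refine Finset.sum_eq_zero fun j _ => ?_
  rw [if_neg, if_neg, add_zero]
  · rintro ⟨h1, h2⟩
    have := h _ _ h1 h2
    rw [apply_top x] at this
    omega
  · rintro ⟨h1, h2⟩
    have := h _ _ h1 h2
    rw [apply_bot x] at this
    omega

/-- The total first moment of the particles with label at least `k`. -/
def upperMoment (m : Fin N → ℝ) (k : ℕ) (x : Fin N → ℤ) : ℝ :=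
  ∑ i : Fin N, if k ≤ (i : ℕ) then m i * x i else 0

lemma upperMoment_sub_single (m : Fin N → ℝ) (k : ℕ) (x : Fin N → ℤ) (i : Fin N) :
    upperMoment m k (x - Pi.single i 1) - upperMoment m k x = -if k ≤ (i : ℕ) then m i else 0 := by
  rw [upperMoment, upperMoment, ← Finset.sum_sub_distrib, Finset.sum_eq_single i]
  · split_ifs <;> simp; ring
  · intro j _ hj
    simp [Pi.single_eq_of_ne hj]
  · simp

lemma upperMoment_add_single (m : Fin N → ℝ) (k : ℕ) (x : Fin N → ℤ) (i : Fin N) :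
    upperMoment m k (x + Pi.single i 1) - upperMoment m k x = if k ≤ (i : ℕ) then m i else 0 := by
  rw [upperMoment, upperMoment, ← Finset.sum_sub_distrib, Finset.sum_eq_single i]
  · split_ifs <;> simp; ring
  · intro j _ hj
    simp [Pi.single_eq_of_ne hj]
  · simp

lemma potSum_sub_potSum (k : ℕ) : potSum m a b k - potSum m a b N =
    ∑ j : Fin N, if k ≤ (j : ℕ) then m j * (b j - a j) else 0 := by
  simp only [potSum, neg_sub_neg, ← Finset.sum_sub_distrib]
  refine Finset.sum_congr rfl fun j _ => ?_
  rw [if_pos j.2]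
  split_ifs <;> first | omega | simp

/-- The mass of the particle that jumps cancels, so `j` contributes `-m j * a j` when `bot x j` is
at least `k` and `m j * b j` when `top x j` is. These conditions differ from `k ≤ j` only for stacks
straddling `k`, and the discrepancy is `push`. -/
lemma gen_upperMoment (hm : ∀ i, 0 < m i) (k : ℕ) {x : Fin N → ℤ} (hx : Monotone x) :
    gen m a b (upperMoment m k) x = potSum m a b k - potSum m a b N + push m a b k x := by
  rw [gen_eq m a b _ hx, potSum_sub_potSum, push, ← Finset.sum_add_distrib]
  refine Finset.sum_congr rfl fun j _ => ?_
  rw [upperMoment_sub_single, upperMoment_add_single]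
  have h1 := bot_le x j
  have h2 := le_top x j
  rw [Fin.le_def] at h1 h2
  have e1 : m j * a j / m (bot x j) * -(if k ≤ (bot x j : ℕ) then m (bot x j) else 0) =
      -if k ≤ (bot x j : ℕ) then m j * a j else 0 := by
    have := (hm (bot x j)).ne'
    split_ifs
    · field_simp
    · simp
  have e2 : m j * b j / m (top x j) * (if k ≤ (top x j : ℕ) then m (top x j) else 0) =
      if k ≤ (top x j : ℕ) then m j * b j else 0 := by
    have := (hm (top x j)).ne'
    split_ifs
    · field_simp
    · simp
  rw [e1, e2]
  split_ifs <;> first | omega | ring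

end Stacks

/-! ### Summation by parts over blocks of consecutive labels. -/

section Abel

/-- The labels `i` with `lo ≤ i < hi`. -/
def block (N lo hi : ℕ) : Finset (Fin N) := Finset.univ.filter fun i => lo ≤ (i : ℕ) ∧ (i : ℕ) < hi

lemma mem_block {N lo hi : ℕ} {i : Fin N} : i ∈ block N lo hi ↔ lo ≤ (i : ℕ) ∧ (i : ℕ) < hi := by
  simp [block]

lemma cloud_eq_block {N ν : ℕ} (κ : Fin (ν + 1) → ℕ) (j : Fin ν) :
    cloud N κ j = block N (κ j.castSucc) (κ j.succ) := by
  ext i; rw [mem_cloud, mem_block]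

lemma sum_mul_by_parts (r x : ℕ → ℝ) (lo n : ℕ) :
    ∑ i ∈ Finset.Ico lo (lo + n + 1), r i * x i =
      (∑ i ∈ Finset.Ico lo (lo + n + 1), r i) * x (lo + n) -
        ∑ l ∈ Finset.Ico lo (lo + n), (∑ i ∈ Finset.Ico lo (l + 1), r i) * (x (l + 1) - x l) := by
  induction n with
  | zero => simp
  | succ n ih =>
    have e1 := Finset.sum_Ico_succ_top (a := lo) (b := lo + n + 1) (by omega) (fun i => r i * x i)
    have e2 := Finset.sum_Ico_succ_top (a := lo) (b := lo + n + 1) (by omega) r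
    have e3 := Finset.sum_Ico_succ_top (a := lo) (b := lo + n) (by omega)
      (fun l => (∑ i ∈ Finset.Ico lo (l + 1), r i) * (x (l + 1) - x l))
    rw [← add_assoc, e1, e2, e3, ih]
    ring

lemma sum_block_eq {N : ℕ} (f : ℕ → ℝ) (lo : ℕ) {hi : ℕ} (h : hi ≤ N) :
    ∑ i ∈ block N lo hi, f i = ∑ i ∈ Finset.Ico lo hi, f i := by
  refine Finset.sum_bij (fun i _ => (i : ℕ)) ?_ ?_ ?_ ?_
  · intro i hi; rw [mem_block] at hi; exact Finset.mem_Ico.2 hi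
  · intro i _ j _ h; exact Fin.ext h
  · intro k hk
    rw [Finset.mem_Ico] at hk
    exact ⟨⟨k, by omega⟩, mem_block.2 hk, rfl⟩
  · intros; rfl

/-- If all partial sums of `r` over a block are at least `ρ` and the full sum vanishes, then
pairing `r` with a non-decreasing `x` gives at most `-ρ` times the increment of `x`. -/
lemma sum_block_mul_le {N lo hi : ℕ} (hlt : lo < hi) (hN : hi ≤ N) (r x : Fin N → ℝ)
    (hx : Monotone x) (ρ : ℝ) (hr : ∀ k, lo < k → k < hi → ρ ≤ ∑ i ∈ block N lo k, r i)
    (h0 : ∑ i ∈ block N lo hi, r i = 0) :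
    ∑ i ∈ block N lo hi, r i * x i ≤ -(ρ * (x ⟨hi - 1, by omega⟩ - x ⟨lo, by omega⟩)) := by
  set r' : ℕ → ℝ := fun n => if h : n < N then r ⟨n, h⟩ else 0 with hr'
  set x' : ℕ → ℝ := fun n => if h : n < N then x ⟨n, h⟩ else 0 with hx'
  have er : ∀ i : Fin N, r i = r' i := fun i => by simp [hr']
  have ex : ∀ i : Fin N, x i = x' i := fun i => by simp [hx']
  obtain ⟨n, rfl⟩ : ∃ n, hi = lo + n + 1 := ⟨hi - lo - 1, by omega⟩
  simp only [er, ex] at h0 hr ⊢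
  rw [sum_block_eq r' lo hN] at h0
  rw [sum_block_eq (fun i => r' i * x' i) lo hN, sum_mul_by_parts, h0, zero_mul, zero_sub,
    neg_le_neg_iff]
  have e : ρ * (x' (lo + n + 1 - 1) - x' lo) =
      ∑ l ∈ Finset.Ico lo (lo + n), ρ * (x' (l + 1) - x' l) := by
    rw [← Finset.mul_sum, Finset.sum_Ico_sub _ (by omega)]
    simp
  rw [e]
  refine Finset.sum_le_sum fun l hl => ?_
  rw [Finset.mem_Ico] at hl
  have h1 := hr (l + 1) (by omega) (by omega)
  rw [sum_block_eq r' lo (by omega)] at h1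
  refine mul_le_mul_of_nonneg_right h1 ?_
  have h2 : l + 1 < N := by omega
  have h3 : l < N := by omega
  simp only [hx', dif_pos h2, dif_pos h3, sub_nonneg]
  exact hx (by rw [Fin.le_def]; simp)

lemma massSum_sub {N : ℕ} (m : Fin N → ℝ) {lo hi : ℕ} (h : lo ≤ hi) :
    massSum m hi - massSum m lo = ∑ i ∈ block N lo hi, m i := by
  simp only [massSum, ← Finset.sum_sub_distrib, block, Finset.sum_filter]
  refine Finset.sum_congr rfl fun i _ => ?_
  split_ifs <;> first | omega | simp

lemma potSum_sub {N : ℕ} (m a b : Fin N → ℝ) {lo hi : ℕ} (h : lo ≤ hi) :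
    potSum m a b hi - potSum m a b lo = -∑ i ∈ block N lo hi, m i * (b i - a i) := by
  simp only [potSum, neg_sub_neg, ← Finset.sum_sub_distrib, block, Finset.sum_filter,
    ← Finset.sum_neg_distrib]
  refine Finset.sum_congr rfl fun i _ => ?_
  split_ifs <;> first | omega | simp

end Abel

/-! ### Clouds as stable blocks. -/

section Blocks

variable {N : ℕ} {m a b : Fin N → ℝ}

/-- The block of labels `lo ≤ i < hi` has mean velocity `w`, and every proper initial segment of
it has an excess of momentum of at least `ρ` over the mean velocity. -/
structure IsStableBlock (m a b : Fin N → ℝ) (lo hi : ℕ) (w ρ : ℝ) : Prop where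
  lt : lo < hi
  le : hi ≤ N
  rho_pos : 0 < ρ
  sum_eq : ∑ i ∈ block N lo hi, m i * (b i - a i - w) = 0
  partial_ge : ∀ k, lo < k → k < hi → ρ ≤ ∑ i ∈ block N lo k, m i * (b i - a i - w)

lemma sum_velocity_excess (w : ℝ) {lo hi : ℕ} (h : lo ≤ hi) :
    ∑ i ∈ block N lo hi, m i * (b i - a i - w) =
      -(potSum m a b hi - potSum m a b lo) - w * (massSum m hi - massSum m lo) := by
  rw [potSum_sub m a b h, massSum_sub m h, Finset.mul_sum, neg_neg, ← Finset.sum_sub_distrib]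
  exact Finset.sum_congr rfl fun i _ => by ring

/-- The excess of momentum of an initial segment is, up to a positive factor, the depth of the
polygon below the boundary segment. Depth is strictly positive between consecutive boundary indices,
and there are finitely many of these, so a minimum `ρ` exists. -/
lemma exists_isStableBlock {ν : ℕ} {κ : Fin (ν + 1) → ℕ} (hm : ∀ i, 0 < m i) (hκ : StrictMono κ)
    (hV : Set.range κ = boundaryIndices m a b) (j : Fin ν) :
    ∃ ρ, IsStableBlock m a b (κ j.castSucc) (κ j.succ) (-slope m a b κ j) ρ := by
  have hlt := kappa_lt hκ j
  have hle := kappa_le hV j.succ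
  have hM := massSum_lt hm hlt hle
  have hM' : massSum m (κ j.succ) - massSum m (κ j.castSucc) ≠ 0 := by linarith
  have key : ∀ k, κ j.castSucc < k → k < κ j.succ →
      0 < ∑ i ∈ block N (κ j.castSucc) k, m i * (b i - a i - -slope m a b κ j) := by
    intro k h1 h2
    have := lt_chord_of_consecutive hm (hV ▸ Set.mem_range_self j.castSucc)
      (hV ▸ Set.mem_range_self j.succ) (notMem_boundaryIndices hκ hV j) h1 h2
    rw [sum_velocity_excess _ h1.le, slope, neg_mul, sub_neg_eq_add, div_mul_eq_mul_div,
      ← sub_neg_eq_add, ← neg_add', neg_pos, ← sub_eq_add_neg, sub_neg, lt_div_iff₀ (by linarith)]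
    nlinarith
  have hρ : ∃ ρ : ℝ, 0 < ρ ∧ ∀ k ∈ Finset.Ioo (κ j.castSucc) (κ j.succ),
      ρ ≤ ∑ i ∈ block N (κ j.castSucc) k, m i * (b i - a i - -slope m a b κ j) := by
    rcases (Finset.Ioo (κ j.castSucc) (κ j.succ)).eq_empty_or_nonempty with h | h
    -- A one-particle block has no proper initial segment; any positive `ρ` will do.
    · exact ⟨1, one_pos, by simp [h]⟩
    · obtain ⟨k, hk, hmin⟩ := Finset.exists_min_image _
        (fun k => ∑ i ∈ block N (κ j.castSucc) k, m i * (b i - a i - -slope m a b κ j)) h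
      rw [Finset.mem_Ioo] at hk
      exact ⟨_, key k hk.1 hk.2, hmin⟩
  obtain ⟨ρ, hρ0, hρ⟩ := hρ
  refine ⟨ρ, hlt, hle, hρ0, ?_, fun k h1 h2 => hρ k (Finset.mem_Ioo.2 ⟨h1, h2⟩)⟩
  rw [sum_velocity_excess _ hlt.le, slope, neg_mul, div_mul_cancel₀ _ hM']
  ring

lemma IsStableBlock.sum_momentum {lo hi : ℕ} {w ρ : ℝ} (h : IsStableBlock m a b lo hi w ρ) :
    ∑ i ∈ block N lo hi, m i * (b i - a i) = w * ∑ i ∈ block N lo hi, m i := by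
  have := h.sum_eq
  rw [Finset.mul_sum, ← sub_eq_zero, ← Finset.sum_sub_distrib, ← this]
  exact Finset.sum_congr rfl fun i _ => by ring

lemma IsStableBlock.sum_mul_le {lo hi : ℕ} {w ρ : ℝ} (h : IsStableBlock m a b lo hi w ρ)
    {x : Fin N → ℤ} (hx : Monotone x) :
    ∑ i ∈ block N lo hi, m i * (b i - a i - w) * (x i : ℝ) ≤
      -(ρ * ((x ⟨hi - 1, by have := h.lt; have := h.le; omega⟩ : ℝ) -
        x ⟨lo, by have := h.lt; have := h.le; omega⟩)) :=
  sum_block_mul_le h.lt h.le _ (fun i => (x i : ℝ)) (fun _ _ hij => Int.cast_le.2 (hx hij))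
    ρ h.partial_ge h.sum_eq

end Blocks

/-! ### The second moment around the expected motion. -/

section QuadraticMoment

variable {N : ℕ} {m a b w : Fin N → ℝ}

/-- The second moment around particles moving with velocities `w`. -/
def sqMoment (m w : Fin N → ℝ) (x : Fin N → ℤ) (σ : ℝ) : ℝ := ∑ i, m i * (x i - w i * σ) ^ 2

lemma sqMoment_nonneg (hm : ∀ i, 0 < m i) (x : Fin N → ℤ) (σ : ℝ) : 0 ≤ sqMoment m w x σ :=
  Finset.sum_nonneg fun i _ => mul_nonneg (hm i).le (sq_nonneg _)

lemma sqMoment_sub_single (x : Fin N → ℤ) (σ : ℝ) (i : Fin N) :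
    sqMoment m w (x - Pi.single i 1) σ - sqMoment m w x σ =
      m i * (-2 * (x i - w i * σ) + 1) := by
  rw [sqMoment, sqMoment, ← Finset.sum_sub_distrib, Finset.sum_eq_single i]
  · simp; ring
  · intro j _ hj
    simp [Pi.single_eq_of_ne hj]
  · simp

lemma sqMoment_add_single (x : Fin N → ℤ) (σ : ℝ) (i : Fin N) :
    sqMoment m w (x + Pi.single i 1) σ - sqMoment m w x σ =
      m i * (2 * (x i - w i * σ) + 1) := by
  rw [sqMoment, sqMoment, ← Finset.sum_sub_distrib, Finset.sum_eq_single i]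
  · simp; ring
  · intro j _ hj
    simp [Pi.single_eq_of_ne hj]
  · simp

/-- The particle that jumps for `j` has the same position but possibly another velocity: a smaller
one on the left, a larger one on the right. Since `w` is monotone and `σ ≥ 0`, replacing it by `w j`
only increases the bound. -/
lemma gen_sqMoment_le (hm : ∀ i, 0 < m i) (ha : ∀ i, 0 ≤ a i) (hb : ∀ i, 0 ≤ b i)
    (hw : Monotone w) {σ : ℝ} (hσ : 0 ≤ σ) {x : Fin N → ℤ} (hx : Monotone x) :
    gen m a b (fun y => sqMoment m w y σ) x ≤
      2 * ∑ j, m j * (b j - a j) * (x j - w j * σ) + ∑ j, m j * (a j + b j) := by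
  rw [gen_eq m a b _ hx, Finset.mul_sum, ← Finset.sum_add_distrib]
  refine Finset.sum_le_sum fun j _ => ?_
  rw [sqMoment_sub_single, sqMoment_add_single, apply_bot x, apply_top x]
  have h1 := (hm (bot x j)).ne'
  have h2 := (hm (top x j)).ne'
  have e1 : m j * a j / m (bot x j) * (m (bot x j) * (-2 * (x j - w (bot x j) * σ) + 1)) =
      m j * a j * (-2 * (x j - w (bot x j) * σ) + 1) := by field_simp
  have e2 : m j * b j / m (top x j) * (m (top x j) * (2 * (x j - w (top x j) * σ) + 1)) =
      m j * b j * (2 * (x j - w (top x j) * σ) + 1) := by field_simp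
  rw [e1, e2]
  have h3 : m j * a j * (w (bot x j) * σ) ≤ m j * a j * (w j * σ) :=
    mul_le_mul_of_nonneg_left (mul_le_mul_of_nonneg_right (hw (bot_le x j)) hσ)
      (mul_nonneg (hm j).le (ha j))
  have h4 : m j * b j * (w j * σ) ≤ m j * b j * (w (top x j) * σ) :=
    mul_le_mul_of_nonneg_left (mul_le_mul_of_nonneg_right (hw (le_top x j)) hσ)
      (mul_nonneg (hm j).le (hb j))
  nlinarith

/-- One step of the jump chain, with the clock advanced by the mean holding time `1 / l`,
increases the second moment at most linearly. -/
lemma sqMoment_step_le (hm : ∀ i, 0 < m i) (ha : ∀ i, 0 ≤ a i) (hb : ∀ i, 0 ≤ b i)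
    (hw : Monotone w) (hw0 : ∑ j, m j * (b j - a j - w j) * w j = 0)
    {x : Fin N → ℤ} (hx : Monotone x) (hwx : ∑ j, m j * (b j - a j - w j) * (x j : ℝ) ≤ 0)
    {τ l : ℝ} (hτ : 0 ≤ τ) (hl : 0 < l) :
    sqMoment m w x (τ + l⁻¹) + gen m a b (fun y => sqMoment m w y (τ + l⁻¹)) x / l ≤
      sqMoment m w x τ + (∑ j, m j * (a j + b j)) / l := by
  have h1 := gen_sqMoment_le (w := w) hm ha hb hw (add_nonneg hτ (inv_nonneg.2 hl.le)) hx
  have h2 := div_le_div_of_nonneg_right h1 hl.le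
  have e1 : sqMoment m w x (τ + l⁻¹) = sqMoment m w x τ
      - 2 * l⁻¹ * (∑ j, m j * w j * (x j : ℝ)) + 2 * τ * l⁻¹ * (∑ j, m j * w j * w j)
      + l⁻¹ ^ 2 * (∑ j, m j * w j * w j) := by
    simp only [sqMoment, Finset.mul_sum, ← Finset.sum_add_distrib, ← Finset.sum_sub_distrib]
    exact Finset.sum_congr rfl fun i _ => by ring
  have e2 : ∑ j, m j * (b j - a j) * (x j - w j * (τ + l⁻¹)) =
      ∑ j, m j * (b j - a j - w j) * (x j : ℝ) + ∑ j, m j * w j * (x j : ℝ)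
      - (τ + l⁻¹) * (∑ j, m j * (b j - a j - w j) * w j) -
      (τ + l⁻¹) * ∑ j, m j * w j * w j := by
    simp only [Finset.mul_sum, ← Finset.sum_add_distrib, ← Finset.sum_sub_distrib]
    exact Finset.sum_congr rfl fun i _ => by ring
  rw [e2, hw0] at h2
  rw [e1]
  have h3 : 0 ≤ ∑ j, m j * w j * w j := Finset.sum_nonneg fun j _ => by
    rw [mul_assoc]; exact mul_nonneg (hm j).le (mul_self_nonneg _)
  set A := ∑ j, m j * w j * w j
  set B := ∑ j, m j * w j * (x j : ℝ)
  set E := ∑ j, m j * (b j - a j - w j) * (x j : ℝ)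
  set G := gen m a b (fun y => sqMoment m w y (τ + l⁻¹)) x
  set c := ∑ j, m j * (a j + b j)
  have hl' : 0 < l⁻¹ := inv_pos.2 hl
  rw [div_eq_mul_inv] at h2
  rw [div_eq_mul_inv, div_eq_mul_inv]
  rw [div_eq_mul_inv] at h2
  -- After expansion the terms in `B` cancel and those in `A` add up to `-l⁻¹ ^ 2 * A`. Apart from
  -- the constant `c / l`, only this and `2 * l⁻¹ * E` remain, both non-positive.
  have h4 : l⁻¹ * E ≤ 0 := mul_nonpos_of_nonneg_of_nonpos hl'.le hwx
  have h5 : 0 ≤ l⁻¹ ^ 2 * A := by positivity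
  nlinarith

end QuadraticMoment

/-! ### The variance of a block around its centre of mass. -/

section Spread

variable {N : ℕ} {m a b : Fin N → ℝ} {lo hi : ℕ}

/-- The total mass of a block. -/
def blockMass (m : Fin N → ℝ) (lo hi : ℕ) : ℝ := ∑ i ∈ block N lo hi, m i

/-- The centre of mass of a block. -/
def blockMean (m : Fin N → ℝ) (lo hi : ℕ) (x : Fin N → ℤ) : ℝ :=
  (∑ i ∈ block N lo hi, m i * x i) / blockMass m lo hi

/-- The second moment of a block around its centre of mass. -/
def blockVar (m : Fin N → ℝ) (lo hi : ℕ) (x : Fin N → ℤ) : ℝ :=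
  ∑ i ∈ block N lo hi, m i * (x i - blockMean m lo hi x) ^ 2

lemma block_nonempty (h : lo < hi) (h' : hi ≤ N) : (block N lo hi).Nonempty :=
  ⟨⟨lo, by omega⟩, mem_block.2 ⟨le_rfl, h⟩⟩

lemma blockMass_pos (hm : ∀ i, 0 < m i) (h : lo < hi) (h' : hi ≤ N) : 0 < blockMass m lo hi :=
  Finset.sum_pos (fun i _ => hm i) (block_nonempty h h')

lemma mass_le_blockMass (hm : ∀ i, 0 < m i) {i : Fin N} (hi' : i ∈ block N lo hi) :
    m i ≤ blockMass m lo hi :=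
  Finset.single_le_sum (fun i _ => (hm i).le) hi'

lemma sum_sub_blockMean (hM : blockMass m lo hi ≠ 0) (x : Fin N → ℤ) :
    ∑ i ∈ block N lo hi, m i * (x i - blockMean m lo hi x) = 0 := by
  simp only [mul_sub, Finset.sum_sub_distrib, ← Finset.sum_mul]
  change _ - blockMass m lo hi * _ = 0
  rw [blockMean, mul_div_cancel₀ _ hM, sub_self]

lemma blockVar_eq (hM : blockMass m lo hi ≠ 0) (x : Fin N → ℤ) :
    blockVar m lo hi x = ∑ i ∈ block N lo hi, m i * (x i : ℝ) ^ 2 -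
      (∑ i ∈ block N lo hi, m i * (x i : ℝ)) ^ 2 / blockMass m lo hi := by
  have e : blockVar m lo hi x = ∑ i ∈ block N lo hi, m i * (x i : ℝ) ^ 2 -
      2 * blockMean m lo hi x * (∑ i ∈ block N lo hi, m i * (x i : ℝ)) +
      blockMean m lo hi x ^ 2 * blockMass m lo hi := by
    simp only [blockVar, blockMass, Finset.mul_sum, ← Finset.sum_add_distrib,
      ← Finset.sum_sub_distrib]
    exact Finset.sum_congr rfl fun i _ => by ring
  rw [e, blockMean]
  field_simp
  ring

lemma sum_block_add_single (x : Fin N → ℤ) {i : Fin N} (hi' : i ∈ block N lo hi) (s : ℤ)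
    (f : Fin N → ℝ → ℝ) :
    ∑ k ∈ block N lo hi, f k ((x + Pi.single i s : Fin N → ℤ) k) =
      ∑ k ∈ block N lo hi, f k (x k) + (f i (x i + s) - f i (x i)) := by
  rw [← sub_eq_iff_eq_add', ← Finset.sum_sub_distrib, Finset.sum_eq_single i]
  · simp
  · intro j _ hj
    simp [Pi.single_eq_of_ne hj]
  · exact fun h => absurd hi' h

lemma blockVar_add_single (hM : blockMass m lo hi ≠ 0) (x : Fin N → ℤ) {i : Fin N}
    (hi' : i ∈ block N lo hi) (s : ℤ) :
    blockVar m lo hi (x + Pi.single i s) - blockVar m lo hi x =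
      2 * s * (m i * (x i - blockMean m lo hi x)) +
        s ^ 2 * (m i - m i ^ 2 / blockMass m lo hi) := by
  rw [blockVar_eq hM, blockVar_eq hM, sum_block_add_single x hi' s (fun k y => m k * y ^ 2),
    sum_block_add_single x hi' s (fun k y => m k * y), blockMean]
  field_simp
  ring

lemma blockVar_add_single_of_notMem (x : Fin N → ℤ) {i : Fin N}
    (hi' : i ∉ block N lo hi) (s : ℤ) :
    blockVar m lo hi (x + Pi.single i s) = blockVar m lo hi x := by
  have e : ∀ k ∈ block N lo hi, (x + Pi.single i s : Fin N → ℤ) k = x k := by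
    intro k hk
    have : k ≠ i := by rintro rfl; exact hi' hk
    simp [Pi.single_eq_of_ne this]
  have e2 : blockMean m lo hi (x + Pi.single i s) = blockMean m lo hi x := by
    unfold blockMean
    congr 1
    exact Finset.sum_congr rfl fun k hk => by rw [e k hk]
  unfold blockVar
  rw [e2]
  exact Finset.sum_congr rfl fun k hk => by rw [e k hk]

lemma blockMean_le (hm : ∀ i, 0 < m i) (h : lo < hi) (h' : hi ≤ N) {x : Fin N → ℤ} {c : ℝ}
    (hc : ∀ i ∈ block N lo hi, (x i : ℝ) ≤ c) : blockMean m lo hi x ≤ c := by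
  rw [blockMean, div_le_iff₀ (blockMass_pos hm h h'), blockMass, Finset.mul_sum]
  exact Finset.sum_le_sum fun i hi => by
    rw [mul_comm c]; exact mul_le_mul_of_nonneg_left (hc i hi) (hm i).le

lemma le_blockMean (hm : ∀ i, 0 < m i) (h : lo < hi) (h' : hi ≤ N) {x : Fin N → ℤ} {c : ℝ}
    (hc : ∀ i ∈ block N lo hi, c ≤ (x i : ℝ)) : c ≤ blockMean m lo hi x := by
  rw [blockMean, le_div_iff₀ (blockMass_pos hm h h'), blockMass, Finset.mul_sum]
  exact Finset.sum_le_sum fun i hi => by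
    rw [mul_comm c]; exact mul_le_mul_of_nonneg_left (hc i hi) (hm i).le

lemma sub_single_eq (x : Fin N → ℤ) (i : Fin N) :
    x - Pi.single i 1 = x + Pi.single i (-1) := by
  rw [Pi.single_neg, sub_eq_add_neg]

/-- Particles outside a block can only compress it. -/
lemma gen_blockVar_le (hm : ∀ i, 0 < m i) (ha : ∀ i, 0 ≤ a i) (hb : ∀ i, 0 ≤ b i)
    (h : lo < hi) (h' : hi ≤ N) {x : Fin N → ℤ} (hx : Monotone x) :
    gen m a b (blockVar m lo hi) x ≤
      2 * ∑ j ∈ block N lo hi, m j * (b j - a j) * (x j - blockMean m lo hi x) +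
        ∑ j, m j * (a j + b j) := by
  have hM := (blockMass_pos hm h h').ne'
  set μ := blockMean m lo hi x with hμ
  -- Labels above the block lie to the right of the mean and labels below it to the left. Hence
  -- momentum imported from outside moves a particle of the block towards the mean, and momentum
  -- exported to the outside would have moved one away from it.
  have hup : ∀ j : Fin N, hi ≤ (j : ℕ) → μ ≤ x j := fun j hj =>
    blockMean_le hm h h' fun i hi' => by
      rw [mem_block] at hi'; exact_mod_cast hx (by rw [Fin.le_def]; omega)
  have hdown : ∀ j : Fin N, (j : ℕ) < lo → x j ≤ μ := fun j hj =>
    le_blockMean hm h h' fun i hi' => by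
      rw [mem_block] at hi'; exact_mod_cast hx (by rw [Fin.le_def]; omega)
  have hl : ∀ j, m j * a j / m (bot x j) *
      (blockVar m lo hi (x - Pi.single (bot x j) 1) - blockVar m lo hi x) ≤
      (if j ∈ block N lo hi then m j * a j * (-2 * (x j - μ)) else 0) + m j * a j := by
    intro j
    have hma := mul_nonneg (hm j).le (ha j)
    have hbj := bot_le x j
    have hmb := hm (bot x j)
    rw [Fin.le_def] at hbj
    rw [sub_single_eq]
    by_cases hB : bot x j ∈ block N lo hi
    · rw [blockVar_add_single hM x hB, ← hμ, apply_bot x]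
      have e : m j * a j / m (bot x j) * (2 * ((-1 : ℤ) : ℝ) * (m (bot x j) * (x j - μ)) +
          ((-1 : ℤ) : ℝ) ^ 2 * (m (bot x j) - m (bot x j) ^ 2 / blockMass m lo hi)) =
          m j * a j * (-2 * (x j - μ)) + m j * a j -
            m j * a j * (m (bot x j) / blockMass m lo hi) := by
        push_cast
        field_simp
        ring
      rw [e]
      have h1 : 0 ≤ m j * a j * (m (bot x j) / blockMass m lo hi) :=
        mul_nonneg hma (div_nonneg hmb.le (blockMass_pos hm h h').le)
      split_ifs with hj
      · linarith
      · rw [mem_block] at hB hj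
        have := hup j (by omega)
        nlinarith
    · rw [blockVar_add_single_of_notMem x hB, sub_self, mul_zero]
      split_ifs with hj
      · rw [mem_block] at hB hj
        have := hdown (bot x j) (by omega)
        rw [apply_bot x] at this
        nlinarith
      · linarith
  have hr : ∀ j, m j * b j / m (top x j) *
      (blockVar m lo hi (x + Pi.single (top x j) 1) - blockVar m lo hi x) ≤
      (if j ∈ block N lo hi then m j * b j * (2 * (x j - μ)) else 0) + m j * b j := by
    intro j
    have hma := mul_nonneg (hm j).le (hb j)
    have hbj := le_top x j
    have hmb := hm (top x j)
    rw [Fin.le_def] at hbj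
    by_cases hB : top x j ∈ block N lo hi
    · rw [blockVar_add_single hM x hB, ← hμ, apply_top x]
      have e : m j * b j / m (top x j) * (2 * ((1 : ℤ) : ℝ) * (m (top x j) * (x j - μ)) +
          ((1 : ℤ) : ℝ) ^ 2 * (m (top x j) - m (top x j) ^ 2 / blockMass m lo hi)) =
          m j * b j * (2 * (x j - μ)) + m j * b j -
            m j * b j * (m (top x j) / blockMass m lo hi) := by
        push_cast
        field_simp
        ring
      rw [e]
      have h1 : 0 ≤ m j * b j * (m (top x j) / blockMass m lo hi) :=
        mul_nonneg hma (div_nonneg hmb.le (blockMass_pos hm h h').le)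
      split_ifs with hj
      · linarith
      · rw [mem_block] at hB hj
        have := hdown j (by omega)
        nlinarith
    · rw [blockVar_add_single_of_notMem x hB, sub_self, mul_zero]
      split_ifs with hj
      · rw [mem_block] at hB hj
        have := hup (top x j) (by omega)
        rw [apply_top x] at this
        nlinarith
      · linarith
  rw [gen_eq m a b _ hx]
  calc _ ≤ ∑ j, (((if j ∈ block N lo hi then m j * a j * (-2 * (x j - μ)) else 0) + m j * a j) +
      ((if j ∈ block N lo hi then m j * b j * (2 * (x j - μ)) else 0) + m j * b j)) :=
        Finset.sum_le_sum fun j _ => add_le_add (hl j) (hr j)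
    _ = _ := by
      have e : ∑ j ∈ block N lo hi, m j * (b j - a j) * (x j - μ) =
          ∑ j, if j ∈ block N lo hi then m j * (b j - a j) * (x j - μ) else 0 := by
        rw [Finset.sum_ite_mem, Finset.univ_inter]
      rw [e, Finset.mul_sum, ← Finset.sum_add_distrib]
      refine Finset.sum_congr rfl fun j _ => ?_
      split_ifs <;> ring

/-- The span of a block in a monotone configuration. -/
def span (hlt : lo < hi) (hle : hi ≤ N) (x : Fin N → ℤ) : ℝ :=
  (x ⟨hi - 1, by omega⟩ : ℝ) - x ⟨lo, by omega⟩

/-- Neither the centre of mass nor the common velocity `w` contributes, since the deviations and the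
velocity excesses both have zero weighted sum. What remains is the Abel bound
`IsStableBlock.sum_mul_le`. -/
lemma IsStableBlock.gen_blockVar_le {w ρ : ℝ} (hm : ∀ i, 0 < m i) (ha : ∀ i, 0 ≤ a i)
    (hb : ∀ i, 0 ≤ b i) (h : IsStableBlock m a b lo hi w ρ) {x : Fin N → ℤ} (hx : Monotone x) :
    gen m a b (blockVar m lo hi) x ≤ -(2 * ρ) * span h.lt h.le x + ∑ j, m j * (a j + b j) := by
  have hM := (blockMass_pos hm h.lt h.le).ne'
  refine (Elastic.gen_blockVar_le hm ha hb h.lt h.le hx).trans ?_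
  have h1 := h.sum_mul_le hx
  have h2 := sum_sub_blockMean hM x
  have h3 := h.sum_eq
  have e : ∑ j ∈ block N lo hi, m j * (b j - a j) * (x j - blockMean m lo hi x) =
      ∑ i ∈ block N lo hi, m i * (b i - a i - w) * (x i : ℝ) -
      blockMean m lo hi x * (∑ i ∈ block N lo hi, m i * (b i - a i - w)) +
      w * ∑ i ∈ block N lo hi, m i * (x i - blockMean m lo hi x) := by
    simp only [Finset.mul_sum, ← Finset.sum_add_distrib, ← Finset.sum_sub_distrib]
    exact Finset.sum_congr rfl fun i _ => by ring
  rw [e, h2, h3]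
  unfold span
  linarith

end Spread

/-! ### Exponential Lyapunov functions for stable blocks. -/

section Lyapunov

variable {N : ℕ} {m a b : Fin N → ℝ} {lo hi : ℕ}

/-- A smooth version of the span of a block. -/
def blockSize (m : Fin N → ℝ) (lo hi : ℕ) (x : Fin N → ℤ) : ℝ := √(1 + blockVar m lo hi x)

lemma blockVar_nonneg (hm : ∀ i, 0 < m i) (x : Fin N → ℤ) : 0 ≤ blockVar m lo hi x :=
  Finset.sum_nonneg fun i _ => mul_nonneg (hm i).le (sq_nonneg _)

lemma blockSize_sq (hm : ∀ i, 0 < m i) (x : Fin N → ℤ) :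
    blockSize m lo hi x ^ 2 = 1 + blockVar m lo hi x :=
  Real.sq_sqrt (by have := blockVar_nonneg (lo := lo) (hi := hi) hm x; linarith)

lemma one_le_blockSize (hm : ∀ i, 0 < m i) (x : Fin N → ℤ) : 1 ≤ blockSize m lo hi x :=
  Real.one_le_sqrt.2 (by have := blockVar_nonneg (lo := lo) (hi := hi) hm x; linarith)

lemma abs_sub_blockMean_le (hm : ∀ i, 0 < m i) (x : Fin N → ℤ) {i : Fin N}
    (hi' : i ∈ block N lo hi) :
    |x i - blockMean m lo hi x| ≤ √(∑ i, (m i)⁻¹) * blockSize m lo hi x := by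
  have h1 : m i * (x i - blockMean m lo hi x) ^ 2 ≤ blockVar m lo hi x :=
    Finset.single_le_sum (f := fun i => m i * (x i - blockMean m lo hi x) ^ 2)
      (fun i _ => mul_nonneg (hm i).le (sq_nonneg _)) hi'
  have h2 : (m i)⁻¹ ≤ ∑ i, (m i)⁻¹ :=
    Finset.single_le_sum (fun i _ => (inv_pos.2 (hm i)).le) (Finset.mem_univ i)
  have h3 := blockVar_nonneg (lo := lo) (hi := hi) hm x
  rw [blockSize, ← Real.sqrt_mul ((inv_pos.2 (hm i)).le.trans h2)]
  refine Real.abs_le_sqrt ?_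
  have h4 : (x i - blockMean m lo hi x) ^ 2 = (m i)⁻¹ * (m i * (x i - blockMean m lo hi x) ^ 2) := by
    have := (hm i).ne'
    field_simp
  rw [h4]
  exact mul_le_mul h2 (by linarith) (mul_nonneg (hm i).le (sq_nonneg _))
    ((inv_pos.2 (hm i)).le.trans h2)

lemma span_le_blockSize (hm : ∀ i, 0 < m i) (h : lo < hi) (h' : hi ≤ N) (x : Fin N → ℤ) :
    span h h' x ≤ 2 * √(∑ i, (m i)⁻¹) * blockSize m lo hi x := by
  have h1 := abs_sub_blockMean_le (lo := lo) (hi := hi) hm x (i := ⟨hi - 1, by omega⟩)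
    (mem_block.2 ⟨by simp; omega, by simp; omega⟩)
  have h2 := abs_sub_blockMean_le (lo := lo) (hi := hi) hm x (i := ⟨lo, by omega⟩)
    (mem_block.2 ⟨le_rfl, h⟩)
  have h3 := (abs_le.1 h1).2
  have h4 := (abs_le.1 h2).1
  unfold span
  linarith

lemma span_nonneg (h : lo < hi) (h' : hi ≤ N) {x : Fin N → ℤ} (hx : Monotone x) :
    0 ≤ span h h' x :=
  sub_nonneg.2 (Int.cast_le.2 (hx (by rw [Fin.le_def]; simp; omega)))

lemma blockSize_le (hm : ∀ i, 0 < m i) (h : lo < hi) (h' : hi ≤ N) {x : Fin N → ℤ}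
    (hx : Monotone x) : blockSize m lo hi x ≤ 1 + √(blockMass m lo hi) * span h h' x := by
  have hM := blockMass_pos hm h h'
  have hs := span_nonneg h h' hx
  have h1 : blockVar m lo hi x ≤ blockMass m lo hi * span h h' x ^ 2 := by
    rw [blockVar, blockMass, Finset.sum_mul]
    refine Finset.sum_le_sum fun i hi' => mul_le_mul_of_nonneg_left ?_ (hm i).le
    rw [sq_le_sq, abs_of_nonneg hs]
    have hup : ∀ k ∈ block N lo hi, (x k : ℝ) ≤ x ⟨hi - 1, by omega⟩ := fun k hk => by
      rw [mem_block] at hk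
      exact Int.cast_le.2 (hx (by rw [Fin.le_def]; simp; omega))
    have hdn : ∀ k ∈ block N lo hi, (x ⟨lo, by omega⟩ : ℝ) ≤ x k := fun k hk => by
      rw [mem_block] at hk
      exact Int.cast_le.2 (hx (by rw [Fin.le_def]; simp; omega))
    have b1 := blockMean_le hm h h' hup
    have b2 := le_blockMean hm h h' hdn
    have b3 := hup i hi'
    have b4 := hdn i hi'
    rw [abs_le]; unfold span
    constructor <;> linarith
  refine Real.sqrt_le_iff.2 ⟨by positivity, ?_⟩
  have h2 := Real.sq_sqrt hM.le
  have h3 : 0 ≤ √(blockMass m lo hi) * span h h' x := by positivity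
  nlinarith

/-- The jumps of `blockSize` are bounded. -/
lemma abs_blockSize_sub_le (hm : ∀ i, 0 < m i) (h : lo < hi) (h' : hi ≤ N) (x : Fin N → ℤ)
    (i : Fin N) (s : ℤ) (hs : |(s : ℝ)| ≤ 1) :
    |blockSize m lo hi (x + Pi.single i s) - blockSize m lo hi x| ≤
      blockMass m lo hi * (2 * √(∑ i, (m i)⁻¹) + 1) := by
  have hM := blockMass_pos hm h h'
  have hB : 0 ≤ blockMass m lo hi * (2 * √(∑ i, (m i)⁻¹) + 1) := by positivity
  by_cases hi' : i ∈ block N lo hi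
  · have h1 := one_le_blockSize (lo := lo) (hi := hi) hm x
    have h2 := one_le_blockSize (lo := lo) (hi := hi) hm (x + Pi.single i s)
    have e := blockVar_add_single hM.ne' x hi' s
    have e1 := blockSize_sq (lo := lo) (hi := hi) hm x
    have e2 := blockSize_sq (lo := lo) (hi := hi) hm (x + Pi.single i s)
    have h3 := abs_sub_blockMean_le hm x hi'
    have h4 := mass_le_blockMass hm hi'
    have hmi := hm i
    set u := blockSize m lo hi x
    set v := blockSize m lo hi (x + Pi.single i s)
    have h5 : |v ^ 2 - u ^ 2| ≤ blockMass m lo hi * (2 * √(∑ i, (m i)⁻¹) + 1) * u := by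
      have e3 : v ^ 2 - u ^ 2 = 2 * s * (m i * (x i - blockMean m lo hi x)) +
        s ^ 2 * (m i - m i ^ 2 / blockMass m lo hi) := by linarith
      rw [e3]
      have t1 : |2 * s * (m i * (x i - blockMean m lo hi x))| ≤
          2 * (blockMass m lo hi * (√(∑ i, (m i)⁻¹) * u)) := by
        rw [abs_mul, abs_mul, abs_mul, abs_of_pos hmi, abs_two]
        have : m i * |x i - blockMean m lo hi x| ≤
            blockMass m lo hi * (√(∑ i, (m i)⁻¹) * u) :=
          mul_le_mul h4 h3 (abs_nonneg _) hM.le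
        have h0 : 0 ≤ m i * |x i - blockMean m lo hi x| := by positivity
        nlinarith [abs_nonneg (s : ℝ)]
      have t2 : |(s : ℝ) ^ 2 * (m i - m i ^ 2 / blockMass m lo hi)| ≤ blockMass m lo hi := by
        have q1 : 0 ≤ m i - m i ^ 2 / blockMass m lo hi := by
          rw [sub_nonneg, div_le_iff₀ hM]; nlinarith
        have q2 : 0 ≤ m i ^ 2 / blockMass m lo hi := by positivity
        rw [abs_mul, abs_of_nonneg q1, abs_pow]
        have : |(s : ℝ)| ^ 2 ≤ 1 := pow_le_one₀ (abs_nonneg _) hs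
        nlinarith
      refine (abs_add_le _ _).trans ?_
      nlinarith
    have h6 : |v - u| * (v + u) = |v ^ 2 - u ^ 2| := by
      rw [show v ^ 2 - u ^ 2 = (v - u) * (v + u) by ring, abs_mul,
        abs_of_pos (show 0 < v + u by linarith)]
    have h7 : |v - u| * u ≤ blockMass m lo hi * (2 * √(∑ i, (m i)⁻¹) + 1) * u := by
      refine le_trans ?_ h5
      rw [← h6]
      exact mul_le_mul_of_nonneg_left (by linarith) (abs_nonneg _)
    exact le_of_mul_le_mul_right h7 (by linarith)
  · rw [blockSize, blockVar_add_single_of_notMem x hi', ← blockSize, sub_self, abs_zero]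
    exact hB

/-- By concavity of the square root, an increment of `blockSize` is at most the increment of the
variance divided by `2 * blockSize`. The linear drift of the variance thus becomes a constant
negative drift, up to a term of order `1 / blockSize`. -/
lemma IsStableBlock.gen_blockSize_le {w ρ : ℝ} (hm : ∀ i, 0 < m i) (ha : ∀ i, 0 ≤ a i)
    (hb : ∀ i, 0 ≤ b i) (h : IsStableBlock m a b lo hi w ρ) {x : Fin N → ℤ} (hx : Monotone x) :
    gen m a b (blockSize m lo hi) x ≤ -(ρ / √(blockMass m lo hi)) +
      (ρ / √(blockMass m lo hi) + (∑ j, m j * (a j + b j)) / 2) / blockSize m lo hi x := by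
  have hM := blockMass_pos hm h.lt h.le
  have h1 := one_le_blockSize (lo := lo) (hi := hi) hm x
  have hstep : gen m a b (blockSize m lo hi) x ≤
      (2 * blockSize m lo hi x)⁻¹ * gen m a b (blockVar m lo hi) x + 0 * totalRate m a b x := by
    refine gen_le_of_incr_le hm ha hb hx _ _ fun y _ _ => ?_
    have e1 := blockSize_sq (lo := lo) (hi := hi) hm x
    have e2 := blockSize_sq (lo := lo) (hi := hi) hm y
    rw [add_zero, inv_mul_eq_div, le_div_iff₀ (by linarith)]
    nlinarith [sq_nonneg (blockSize m lo hi y - blockSize m lo hi x)]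
  have h2 := h.gen_blockVar_le hm ha hb hx
  have h3 := blockSize_le hm h.lt h.le hx
  have hsM : 0 < √(blockMass m lo hi) := Real.sqrt_pos.2 hM
  set u := blockSize m lo hi x
  set c := ∑ j, m j * (a j + b j)
  have h4 : -(2 * ρ) * span h.lt h.le x + c ≤ -(2 * (ρ / √(blockMass m lo hi))) * (u - 1) + c := by
    have : (u - 1) / √(blockMass m lo hi) ≤ span h.lt h.le x := by
      rw [div_le_iff₀ hsM]; linarith
    have := mul_le_mul_of_nonneg_left this h.rho_pos.le
    have e : ρ * ((u - 1) / √(blockMass m lo hi)) = ρ / √(blockMass m lo hi) * (u - 1) := by ring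
    rw [e] at this
    linarith
  rw [zero_mul, add_zero] at hstep
  refine hstep.trans ((mul_le_mul_of_nonneg_left (h2.trans h4) (by positivity)).trans
    (le_of_eq ?_))
  have : u ≠ 0 := by positivity
  field_simp
  ring

set_option maxHeartbeats 1000000 in
/-- An exponential Lyapunov function for a stable block. -/
lemma IsStableBlock.exists_lyapunov {w ρ : ℝ} (hm : ∀ i, 0 < m i) (ha : ∀ i, 0 ≤ a i)
    (hb : ∀ i, 0 ≤ b i) (h : IsStableBlock m a b lo hi w ρ) (hrate : 0 < rateMin m a b) :
    ∃ (V : (Fin N → ℤ) → ℝ) (c K δ C : ℝ), 0 < c ∧ c < rateMin m a b ∧ 0 ≤ K ∧ 0 < δ ∧ 0 ≤ C ∧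
      (∀ x, 0 < V x) ∧
      (∀ x, Monotone x → gen m a b V x ≤ -(c * V x) + K) ∧
      (∀ x, Real.exp (δ * span h.lt h.le x) ≤ V x) ∧
      (∀ x, Monotone x → V x ≤ Real.exp (C * (1 + span h.lt h.le x))) := by
  have hM := blockMass_pos hm h.lt h.le
  have hsM : 0 < √(blockMass m lo hi) := Real.sqrt_pos.2 hM
  set α := ρ / √(blockMass m lo hi) with hα
  set β := α + (∑ j, m j * (a j + b j)) / 2 with hβ
  set B := blockMass m lo hi * (2 * √(∑ i, (m i)⁻¹) + 1) with hB
  have hα0 : 0 < α := div_pos h.rho_pos hsM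
  have hc0 : 0 ≤ ∑ j, m j * (a j + b j) :=
    Finset.sum_nonneg fun j _ => mul_nonneg (hm j).le (add_nonneg (ha j) (hb j))
  have hβ0 : 0 < β := by linarith
  have hB0 : 0 < B := by positivity
  have hx0 : Monotone (fun _ : Fin N => (0 : ℤ)) := monotone_const
  have hΛ : 0 < rateMax m a b :=
    hrate.trans_le ((rateMin_le hm ha hb hx0).trans (le_rateMax hm ha hb hx0))
  set Λ := rateMax m a b
  -- `d * B ≤ 1` permits the second-order bound for the exponential of a jump, and `d * (B ^ 2 * Λ)
  -- ≤ α / 2` lets the quadratic error consume at most half of the drift `-α`.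
  set d := min (B⁻¹) (α / (2 * (B ^ 2 * Λ))) with hd
  have hd0 : 0 < d := by
    refine lt_min (inv_pos.2 hB0) (by positivity)
  have hdB : d * B ≤ 1 := by
    have := min_le_left (B⁻¹) (α / (2 * (B ^ 2 * Λ)))
    calc d * B ≤ B⁻¹ * B := mul_le_mul_of_nonneg_right this hB0.le
      _ = 1 := inv_mul_cancel₀ hB0.ne'
  have hdΛ : d * (B ^ 2 * Λ) ≤ α / 2 := by
    have := min_le_right (B⁻¹) (α / (2 * (B ^ 2 * Λ)))
    calc d * (B ^ 2 * Λ) ≤ α / (2 * (B ^ 2 * Λ)) * (B ^ 2 * Λ) :=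
          mul_le_mul_of_nonneg_right this (by positivity)
      _ = α / 2 := by field_simp
  have hκ0 : 0 < 2 * √(∑ i, (m i)⁻¹) := by
    have : 0 < ∑ i, (m i)⁻¹ := Finset.sum_pos (fun i _ => inv_pos.2 (hm i))
      ⟨⟨lo, lt_of_lt_of_le h.lt h.le⟩, Finset.mem_univ _⟩
    positivity
  -- The second entry keeps `c` below every jump rate, as `lintegral_holdLaw_renewal` requires.
  set c := min (d * α / 4) (rateMin m a b / 2) with hc
  have hc1 : c ≤ d * α / 4 := min_le_left _ _
  have hcpos : 0 < c := lt_min (by positivity) (by positivity)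
  refine ⟨fun x => Real.exp (d * blockSize m lo hi x), c,
    d * (β + α) * Real.exp (d * (4 * β / α)), d / (2 * √(∑ i, (m i)⁻¹)),
    d * (1 + √(blockMass m lo hi)), hcpos, (min_le_right _ _).trans_lt (by linarith),
    by positivity, by positivity, by positivity, fun x => Real.exp_pos _, ?_, ?_, ?_⟩
  · intro x hx
    set V : (Fin N → ℤ) → ℝ := fun x => Real.exp (d * blockSize m lo hi x) with hV
    have hVx : 0 < V x := Real.exp_pos _
    have hgen : gen m a b V x ≤ (V x * d) * gen m a b (blockSize m lo hi) x +
        (V x * (d ^ 2 * B ^ 2)) * totalRate m a b x := by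
      refine gen_le_of_incr_le hm ha hb hx _ _ fun y _ hy => ?_
      have hu : |blockSize m lo hi y - blockSize m lo hi x| ≤ B := by
        obtain ⟨i, rfl | rfl⟩ := hy
        · rw [sub_single_eq]
          exact abs_blockSize_sub_le hm h.lt h.le x i _ (by simp)
        · exact abs_blockSize_sub_le hm h.lt h.le x i _ (by simp)
      set u := blockSize m lo hi y - blockSize m lo hi x with hu'
      have e : V y = V x * Real.exp (d * u) := by
        simp only [hV, ← Real.exp_add, hu']; ring_nf
      have hdu : |d * u| ≤ 1 := by
        rw [abs_mul, abs_of_pos hd0]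
        exact (mul_le_mul_of_nonneg_left hu hd0.le).trans hdB
      have h1 := Real.abs_exp_sub_one_sub_id_le hdu
      have h2 := (abs_le.1 h1).2
      have h3 : u ^ 2 ≤ B ^ 2 := by
        rw [sq_le_sq, abs_of_pos hB0]; exact hu
      have h4 : Real.exp (d * u) - 1 ≤ d * u + d ^ 2 * B ^ 2 := by
        have : (d * u) ^ 2 ≤ d ^ 2 * B ^ 2 := by
          rw [mul_pow]; exact mul_le_mul_of_nonneg_left h3 (sq_nonneg d)
        linarith
      rw [e]
      have := mul_le_mul_of_nonneg_left h4 hVx.le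
      linarith
    have h1 := one_le_blockSize (lo := lo) (hi := hi) hm x
    have h2 := h.gen_blockSize_le hm ha hb hx
    have h3 := le_rateMax hm ha hb hx
    rw [← hα, ← hβ] at h2
    set u := blockSize m lo hi x with hu
    have h4 : gen m a b V x ≤ V x * d * (-(α / 2) + β / u) := by
      have s1 := mul_le_mul_of_nonneg_left h2 (show 0 ≤ V x * d by positivity)
      have s2 := mul_le_mul_of_nonneg_left h3 (show 0 ≤ V x * (d ^ 2 * B ^ 2) by positivity)
      have s3 := mul_le_mul_of_nonneg_left hdΛ (show 0 ≤ V x * d by positivity)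
      linarith
    refine h4.trans ?_
    -- Beyond `4 * β / α` the error `β / u` is at most `α / 4`, leaving drift at most `-(d * α / 4)
    -- * V`. Below it `V` is bounded, and everything is absorbed in the constant.
    rcases le_total (4 * β / α) u with hbig | hsmall
    · have s1 : β / u ≤ α / 4 := by
        rw [div_le_iff₀ hα0] at hbig
        rw [div_le_iff₀ (by linarith)]
        linarith
      have s2 : V x * d * (-(α / 2) + β / u) ≤ V x * d * (-(α / 4)) :=
        mul_le_mul_of_nonneg_left (by linarith) (by positivity)
      have s3 : 0 ≤ d * (β + α) * Real.exp (d * (4 * β / α)) := by positivity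
      have s4 := mul_le_mul_of_nonneg_right hc1 hVx.le
      linarith
    · have s1 : β / u ≤ β := div_le_self hβ0.le h1
      have s2 : V x ≤ Real.exp (d * (4 * β / α)) :=
        Real.exp_le_exp.2 (mul_le_mul_of_nonneg_left hsmall hd0.le)
      have s3 : V x * d * (-(α / 2) + β / u) ≤ V x * d * (-(α / 2) + β) :=
        mul_le_mul_of_nonneg_left (by linarith) (by positivity)
      have s4 := mul_le_mul_of_nonneg_right hc1 hVx.le
      have s5 : d * (β + α) * V x ≤ d * (β + α) * Real.exp (d * (4 * β / α)) :=
        mul_le_mul_of_nonneg_left s2 (by positivity)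
      have s6 : 0 ≤ V x * d * α := by positivity
      linarith
  · intro x
    refine Real.exp_le_exp.2 ?_
    rw [div_mul_eq_mul_div, div_le_iff₀ hκ0]
    have := mul_le_mul_of_nonneg_left (span_le_blockSize hm h.lt h.le x) hd0.le
    linarith
  · intro x hx
    refine Real.exp_le_exp.2 ?_
    have h1 := mul_le_mul_of_nonneg_left (blockSize_le hm h.lt h.le hx) hd0.le
    have hs := span_nonneg h.lt h.le hx
    have h2 : 0 ≤ d * span h.lt h.le x := by positivity
    have h3 : 0 ≤ d * √(blockMass m lo hi) := by positivity
    linarith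

end Lyapunov

/-! ### Two adjacent blocks: the distance of their centres of mass. -/

section Separation

variable {N : ℕ} {m a b : Fin N → ℝ} {k₀ k₁ k₂ : ℕ}

lemma upperMoment_sub_upperMoment (m : Fin N → ℝ) {lo hi : ℕ} (h : lo ≤ hi) (x : Fin N → ℤ) :
    upperMoment m lo x - upperMoment m hi x = ∑ i ∈ block N lo hi, m i * (x i : ℝ) := by
  simp only [upperMoment, ← Finset.sum_sub_distrib, block, Finset.sum_filter]
  refine Finset.sum_congr rfl fun i _ => ?_
  split_ifs <;> first | omega | simp

/-- The block's first moment is a difference of two upper moments, so collisions inside the block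
cancel and only exchanges at its two ends disturb the mean velocity. -/
lemma IsStableBlock.gen_blockMean {lo hi : ℕ} {w ρ : ℝ} (hm : ∀ i, 0 < m i)
    (h : IsStableBlock m a b lo hi w ρ) {x : Fin N → ℤ} (hx : Monotone x) :
    gen m a b (blockMean m lo hi) x =
      w + (push m a b lo x - push m a b hi x) / blockMass m lo hi := by
  have hM := (blockMass_pos hm h.lt h.le).ne'
  have e : ∀ y, blockMean m lo hi y = (blockMass m lo hi)⁻¹ * upperMoment m lo y +
      (-(blockMass m lo hi)⁻¹) * upperMoment m hi y := fun y => by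
    rw [blockMean, ← upperMoment_sub_upperMoment m h.lt.le]; ring
  rw [gen_congr e, gen_add, gen_const_mul, gen_const_mul, gen_upperMoment hm lo hx,
    gen_upperMoment hm hi hx]
  have h1 := potSum_sub m a b h.lt.le
  rw [h.sum_momentum] at h1
  change _ = -(w * blockMass m lo hi) at h1
  have h2 : potSum m a b hi = potSum m a b lo - w * blockMass m lo hi := by linarith
  rw [h2]
  field_simp
  ring

/-- The distance between the centres of mass of two adjacent blocks. -/
def meanGap (m : Fin N → ℝ) (k₀ k₁ k₂ : ℕ) (x : Fin N → ℤ) : ℝ :=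
  blockMean m k₁ k₂ x - blockMean m k₀ k₁ x

/-- The change of `meanGap` when particle `i` moves one step to the right. -/
def meanGapStep (m : Fin N → ℝ) (k₀ k₁ k₂ : ℕ) (i : Fin N) : ℝ :=
  (if i ∈ block N k₁ k₂ then m i / blockMass m k₁ k₂ else 0) -
    (if i ∈ block N k₀ k₁ then m i / blockMass m k₀ k₁ else 0)

lemma blockMean_add_single (m : Fin N → ℝ) (lo hi : ℕ) (x : Fin N → ℤ) (i : Fin N) (s : ℤ) :
    blockMean m lo hi (x + Pi.single i s) - blockMean m lo hi x =
      s * if i ∈ block N lo hi then m i / blockMass m lo hi else 0 := by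
  split_ifs with h
  · rw [blockMean, blockMean, sum_block_add_single x h s (fun k y => m k * y)]
    ring
  · have e : ∑ k ∈ block N lo hi, m k * ((x + Pi.single i s : Fin N → ℤ) k : ℝ) =
        ∑ k ∈ block N lo hi, m k * (x k : ℝ) := by
      refine Finset.sum_congr rfl fun k hk => ?_
      have : k ≠ i := by rintro rfl; exact h hk
      simp [Pi.single_eq_of_ne this]
    rw [blockMean, blockMean, e]; simp

lemma meanGap_add_single (m : Fin N → ℝ) (x : Fin N → ℤ) (i : Fin N) (s : ℤ) :
    meanGap m k₀ k₁ k₂ (x + Pi.single i s) - meanGap m k₀ k₁ k₂ x =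
      s * meanGapStep m k₀ k₁ k₂ i := by
  have h1 := blockMean_add_single m k₁ k₂ x i s
  have h2 := blockMean_add_single m k₀ k₁ x i s
  unfold meanGap meanGapStep
  linarith

lemma abs_meanGapStep_le (hm : ∀ i, 0 < m i) (i : Fin N) :
    |meanGapStep m k₀ k₁ k₂ i| ≤ 1 := by
  have key : ∀ lo hi, i ∈ block N lo hi → |m i / blockMass m lo hi| ≤ 1 := by
    intro lo hi h
    have h1 := mass_le_blockMass hm h
    rw [abs_of_nonneg (div_nonneg (hm i).le ((hm i).le.trans h1))]
    exact div_le_one_of_le₀ h1 ((hm i).le.trans h1)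
  unfold meanGapStep
  split_ifs with h1 h2 h2
  · rw [mem_block] at h1 h2; omega
  · simpa using key _ _ h1
  · simpa using key _ _ h2
  · simp

lemma meanGap_nonneg (hm : ∀ i, 0 < m i) (h₁ : k₀ < k₁) (h₂ : k₁ < k₂) (hN : k₂ ≤ N)
    {x : Fin N → ℤ} (hx : Monotone x) : 0 ≤ meanGap m k₀ k₁ k₂ x := by
  have h1 : (x ⟨k₁, by omega⟩ : ℝ) ≤ blockMean m k₁ k₂ x := le_blockMean hm h₂ hN fun i hi => by
    rw [mem_block] at hi; exact Int.cast_le.2 (hx (by rw [Fin.le_def]; simp; omega))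
  have h2 : blockMean m k₀ k₁ x ≤ (x ⟨k₁, by omega⟩ : ℝ) :=
    blockMean_le hm h₁ (by omega) fun i hi => by
      rw [mem_block] at hi; exact Int.cast_le.2 (hx (by rw [Fin.le_def]; simp; omega))
  unfold meanGap
  linarith

lemma meanGap_le (hm : ∀ i, 0 < m i) (h₁ : k₀ < k₁) (h₂ : k₁ < k₂) (hN : k₂ ≤ N)
    {x : Fin N → ℤ} (hx : Monotone x) :
    meanGap m k₀ k₁ k₂ x ≤ (x ⟨k₁, by omega⟩ - x ⟨k₁ - 1, by omega⟩ : ℝ) +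
      span h₁ (h₂.le.trans hN) x + span h₂ hN x := by
  have h1 : blockMean m k₁ k₂ x ≤ (x ⟨k₂ - 1, by omega⟩ : ℝ) := blockMean_le hm h₂ hN fun i hi => by
    rw [mem_block] at hi; exact Int.cast_le.2 (hx (by rw [Fin.le_def]; simp; omega))
  have h2 : (x ⟨k₀, by omega⟩ : ℝ) ≤ blockMean m k₀ k₁ x :=
    le_blockMean hm h₁ (by omega) fun i hi => by
      rw [mem_block] at hi; exact Int.cast_le.2 (hx (by rw [Fin.le_def]; simp; omega))
  unfold meanGap span
  linarith

/-- A quadratic function, continued linearly beyond `R + 1`. -/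
def huber (R d : ℝ) : ℝ := if d ≤ R + 1 then d ^ 2 else 2 * (R + 1) * d - (R + 1) ^ 2

/-- The derivative of `huber` on the non-negative half line. -/
def huberSlope (R d : ℝ) : ℝ := 2 * min d (R + 1)

lemma huber_nonneg {R d : ℝ} (hR : 0 ≤ R) : 0 ≤ huber R d := by
  unfold huber; split_ifs with h
  · positivity
  · push Not at h; nlinarith

lemma huber_le {R d : ℝ} (hd : 0 ≤ d) : huber R d ≤ 2 * (R + 1) * d := by
  unfold huber; split_ifs with h <;> nlinarith

/-- `huber` is convex and continuously differentiable, so it lies above its tangents. For `d ≤ R`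
and `|u| ≤ 1` the end point stays in the quadratic zone, where the excess over the tangent is
exactly `u ^ 2`; the margin of one between `R` and `R + 1` serves this purpose. -/
lemma huber_add_ge {R d u : ℝ} (hu : |u| ≤ 1) :
    huberSlope R d * u + (if d ≤ R then u ^ 2 else 0) ≤ huber R (d + u) - huber R d := by
  have h1 := (abs_le.1 hu).1
  have h2 := (abs_le.1 hu).2
  unfold huber huberSlope
  rcases le_total d (R + 1) with h | h
  · rw [min_eq_left h, if_pos h]
    split_ifs <;> nlinarith [sq_nonneg (R + 1 - d), sq_nonneg u]
  · rw [min_eq_right h]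
    split_ifs <;> nlinarith [sq_nonneg (d + u - (R + 1)), sq_nonneg (d - (R + 1))]

/-- The rate of fluctuation of `meanGap`. -/
def meanGapRate (m a b : Fin N → ℝ) (k₀ k₁ k₂ : ℕ) (x : Fin N → ℤ) : ℝ :=
  ∑ i, (leftRate m a i x * meanGapStep m k₀ k₁ k₂ i ^ 2 +
    rightRate m b i x * meanGapStep m k₀ k₁ k₂ i ^ 2)

lemma gen_huber_ge (hm : ∀ i, 0 < m i) (ha : ∀ i, 0 ≤ a i) (hb : ∀ i, 0 ≤ b i) (R : ℝ)
    (x : Fin N → ℤ) :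
    huberSlope R (meanGap m k₀ k₁ k₂ x) * gen m a b (meanGap m k₀ k₁ k₂) x +
      (if meanGap m k₀ k₁ k₂ x ≤ R then meanGapRate m a b k₀ k₁ k₂ x else 0) ≤
      gen m a b (fun y => huber R (meanGap m k₀ k₁ k₂ y)) x := by
  have e : (if meanGap m k₀ k₁ k₂ x ≤ R then meanGapRate m a b k₀ k₁ k₂ x else 0) =
      ∑ i, (leftRate m a i x *
        (if meanGap m k₀ k₁ k₂ x ≤ R then meanGapStep m k₀ k₁ k₂ i ^ 2 else 0) +
      rightRate m b i x *
        (if meanGap m k₀ k₁ k₂ x ≤ R then meanGapStep m k₀ k₁ k₂ i ^ 2 else 0)) := by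
    split_ifs
    · rfl
    · simp
  rw [e, gen, gen, Finset.mul_sum, ← Finset.sum_add_distrib]
  refine Finset.sum_le_sum fun i _ => ?_
  have hs := abs_meanGapStep_le (k₀ := k₀) (k₁ := k₁) (k₂ := k₂) hm i
  have e1 : meanGap m k₀ k₁ k₂ (x - Pi.single i 1) - meanGap m k₀ k₁ k₂ x =
      -meanGapStep m k₀ k₁ k₂ i := by
    rw [sub_single_eq, meanGap_add_single]; simp
  have e2 : meanGap m k₀ k₁ k₂ (x + Pi.single i 1) - meanGap m k₀ k₁ k₂ x =
      meanGapStep m k₀ k₁ k₂ i := by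
    rw [meanGap_add_single]; simp
  have e1' : meanGap m k₀ k₁ k₂ (x - Pi.single i 1) =
    meanGap m k₀ k₁ k₂ x + -meanGapStep m k₀ k₁ k₂ i := by linarith
  have e2' : meanGap m k₀ k₁ k₂ (x + Pi.single i 1) =
    meanGap m k₀ k₁ k₂ x + meanGapStep m k₀ k₁ k₂ i := by linarith
  have h1 := mul_le_mul_of_nonneg_left
    (huber_add_ge (R := R) (d := meanGap m k₀ k₁ k₂ x) (by rwa [abs_neg])) (leftRate_nonneg hm ha i x)
  have h2 := mul_le_mul_of_nonneg_left
    (huber_add_ge (R := R) (d := meanGap m k₀ k₁ k₂ x) hs) (rightRate_nonneg hm hb i x)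
  rw [neg_sq] at h1
  rw [e1, e2, e1', e2']
  linarith

lemma gen_meanGap {w ρ₁ ρ₂ : ℝ} (hm : ∀ i, 0 < m i) (h₁ : IsStableBlock m a b k₀ k₁ w ρ₁)
    (h₂ : IsStableBlock m a b k₁ k₂ w ρ₂) {x : Fin N → ℤ} (hx : Monotone x) :
    gen m a b (meanGap m k₀ k₁ k₂) x =
      (push m a b k₁ x - push m a b k₂ x) / blockMass m k₁ k₂ -
        (push m a b k₀ x - push m a b k₁ x) / blockMass m k₀ k₁ := by
  have e : ∀ y, meanGap m k₀ k₁ k₂ y = blockMean m k₁ k₂ y + (-1) * blockMean m k₀ k₁ y :=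
    fun y => by unfold meanGap; ring
  rw [gen_congr e, gen_add, gen_const_mul, h₁.gen_blockMean hm hx, h₂.gen_blockMean hm hx]
  ring

/-- Two adjacent blocks of equal speed cannot both be at rest without exchanging momentum. -/
lemma sum_exchange_pos {w ρ₁ ρ₂ : ℝ} (hm : ∀ i, 0 < m i) (ha : ∀ i, 0 ≤ a i) (hb : ∀ i, 0 ≤ b i)
    (h₁ : IsStableBlock m a b k₀ k₁ w ρ₁) (h₂ : IsStableBlock m a b k₁ k₂ w ρ₂)
    (hn₁ : 0 < ∑ i ∈ block N k₀ k₁, (a i + b i)) (hn₂ : 0 < ∑ i ∈ block N k₁ k₂, (a i + b i)) :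
    0 < ∑ i ∈ block N k₀ k₁, m i * b i + ∑ i ∈ block N k₁ k₂, m i * a i := by
  have n1 : 0 ≤ ∑ i ∈ block N k₀ k₁, m i * b i :=
    Finset.sum_nonneg fun i _ => mul_nonneg (hm i).le (hb i)
  have n2 : 0 ≤ ∑ i ∈ block N k₁ k₂, m i * a i :=
    Finset.sum_nonneg fun i _ => mul_nonneg (hm i).le (ha i)
  -- Otherwise the left block carries only leftward and the right block only rightward momentum. By
  -- non-degeneracy the common velocity `w` would be both negative and positive.
  by_contra! hle
  have z1 : ∑ i ∈ block N k₀ k₁, m i * b i = 0 := by linarith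
  have z2 : ∑ i ∈ block N k₁ k₂, m i * a i = 0 := by linarith
  have z1' := (Finset.sum_eq_zero_iff_of_nonneg fun i _ => mul_nonneg (hm i).le (hb i)).1 z1
  have z2' := (Finset.sum_eq_zero_iff_of_nonneg fun i _ => mul_nonneg (hm i).le (ha i)).1 z2
  have p1 : 0 < ∑ i ∈ block N k₀ k₁, m i * a i := by
    obtain ⟨i, hi, hi'⟩ := Finset.exists_ne_zero_of_sum_ne_zero hn₁.ne'
    have hbi : b i = 0 := (mul_eq_zero.1 (z1' i hi)).resolve_left (hm i).ne'
    rw [hbi, add_zero] at hi'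
    exact Finset.sum_pos' (fun j _ => mul_nonneg (hm j).le (ha j))
      ⟨i, hi, mul_pos (hm i) (lt_of_le_of_ne (ha i) hi'.symm)⟩
  have p2 : 0 < ∑ i ∈ block N k₁ k₂, m i * b i := by
    obtain ⟨i, hi, hi'⟩ := Finset.exists_ne_zero_of_sum_ne_zero hn₂.ne'
    have hai : a i = 0 := (mul_eq_zero.1 (z2' i hi)).resolve_left (hm i).ne'
    rw [hai, zero_add] at hi'
    exact Finset.sum_pos' (fun j _ => mul_nonneg (hm j).le (hb j))
      ⟨i, hi, mul_pos (hm i) (lt_of_le_of_ne (hb i) hi'.symm)⟩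
  have s1 := h₁.sum_momentum
  have s2 := h₂.sum_momentum
  simp only [mul_sub, Finset.sum_sub_distrib] at s1 s2
  rw [z1] at s1
  rw [z2] at s2
  have M1 := blockMass_pos hm h₁.lt h₁.le
  have M2 := blockMass_pos hm h₂.lt h₂.le
  unfold blockMass at M1 M2
  have w1 : w < 0 := by
    by_contra! hw
    have := mul_nonneg hw M1.le
    linarith
  have := mul_neg_of_neg_of_pos w1 M2
  linarith

/-- Either `meanGap` fluctuates or momentum is exchanged between the two blocks. -/
lemma exists_meanGapRate_ge {w ρ₁ ρ₂ : ℝ} (hm : ∀ i, 0 < m i) (ha : ∀ i, 0 ≤ a i)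
    (hb : ∀ i, 0 ≤ b i)
    (h₁ : IsStableBlock m a b k₀ k₁ w ρ₁) (h₂ : IsStableBlock m a b k₁ k₂ w ρ₂)
    (hn₁ : 0 < ∑ i ∈ block N k₀ k₁, (a i + b i)) (hn₂ : 0 < ∑ i ∈ block N k₁ k₂, (a i + b i)) :
    ∃ C : ℝ, 0 < C ∧ ∀ x : Fin N → ℤ, Monotone x →
      1 ≤ C * (meanGapRate m a b k₀ k₁ k₂ x + push m a b k₁ x) := by
  have hE := sum_exchange_pos hm ha hb h₁ h₂ hn₁ hn₂
  set e := ∑ i ∈ block N k₀ k₁, m i * b i + ∑ i ∈ block N k₁ k₂, m i * a i with he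
  have M1 := blockMass_pos hm h₁.lt h₁.le
  have M2 := blockMass_pos hm h₂.lt h₂.le
  obtain ⟨c, hc0, hc⟩ : ∃ c : ℝ, 0 < c ∧ ∀ i ∈ block N k₀ k₂, c ≤ meanGapStep m k₀ k₁ k₂ i ^ 2 / m i := by
    obtain ⟨i, hi, hmin⟩ := Finset.exists_min_image _
      (fun i => meanGapStep m k₀ k₁ k₂ i ^ 2 / m i)
      (block_nonempty (h₁.lt.trans h₂.lt) h₂.le)
    refine ⟨_, div_pos (sq_pos_of_ne_zero ?_) (hm i), hmin⟩
    rw [mem_block] at hi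
    unfold meanGapStep
    by_cases h : (i : ℕ) < k₁
    · rw [if_neg (by rw [mem_block]; omega), if_pos (mem_block.2 ⟨hi.1, h⟩), zero_sub]
      exact neg_ne_zero.2 (div_pos (hm i) M1).ne'
    · rw [if_pos (by rw [mem_block]; omega), if_neg (by rw [mem_block]; omega), sub_zero]
      exact (div_pos (hm i) M2).ne'
  -- Rightward momentum of a particle `j` of the left block either moves a label below `k₁`, which
  -- makes `meanGap` fluctuate, or crosses `k₁` and is counted by `push`. The right block is
  -- symmetric.
  have key : ∀ x : Fin N → ℤ, Monotone x →
      e ≤ c⁻¹ * meanGapRate m a b k₀ k₁ k₂ x + push m a b k₁ x := by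
    intro x hx
    rw [meanGapRate, sum_rates_eq m a b hx, Finset.mul_sum, push, ← Finset.sum_add_distrib]
    have e' : e = ∑ j, ((if j ∈ block N k₀ k₁ then m j * b j else 0) +
        (if j ∈ block N k₁ k₂ then m j * a j else 0)) := by
      rw [Finset.sum_add_distrib, Finset.sum_ite_mem, Finset.sum_ite_mem, Finset.univ_inter,
        Finset.univ_inter]
    rw [e']
    refine Finset.sum_le_sum fun j _ => ?_
    have hma := mul_nonneg (hm j).le (ha j)
    have hmb := mul_nonneg (hm j).le (hb j)
    have l1 := bot_le x j
    have l2 := le_top x j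
    rw [Fin.le_def] at l1 l2
    have qa : ∀ i, 0 ≤ c⁻¹ * (m j * a j / m i * meanGapStep m k₀ k₁ k₂ i ^ 2) := fun i => by
      have := hm i; positivity
    have qb : ∀ i, 0 ≤ c⁻¹ * (m j * b j / m i * meanGapStep m k₀ k₁ k₂ i ^ 2) := fun i => by
      have := hm i; positivity
    have ra : ∀ i ∈ block N k₀ k₂,
        m j * a j ≤ c⁻¹ * (m j * a j / m i * meanGapStep m k₀ k₁ k₂ i ^ 2) := fun i hi => by
      have h3 := mul_le_mul_of_nonneg_left (hc i hi) hma
      rw [inv_mul_eq_div, le_div_iff₀ hc0]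
      refine h3.trans (le_of_eq ?_)
      ring
    have rb : ∀ i ∈ block N k₀ k₂,
        m j * b j ≤ c⁻¹ * (m j * b j / m i * meanGapStep m k₀ k₁ k₂ i ^ 2) := fun i hi => by
      have h3 := mul_le_mul_of_nonneg_left (hc i hi) hmb
      rw [inv_mul_eq_div, le_div_iff₀ hc0]
      refine h3.trans (le_of_eq ?_)
      ring
    rw [mul_add]
    have t1 : (if j ∈ block N k₀ k₁ then m j * b j else 0) ≤
        c⁻¹ * (m j * b j / m (top x j) * meanGapStep m k₀ k₁ k₂ (top x j) ^ 2) +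
        (if (j : ℕ) < k₁ ∧ k₁ ≤ top x j then m j * b j else 0) := by
      have q := qb (top x j)
      split_ifs with g1 g2 g2
      · linarith
      · rw [mem_block] at g1
        have := h₂.lt
        have := rb (top x j) (mem_block.2 ⟨by omega, by omega⟩)
        linarith
      · linarith
      · linarith
    have t2 : (if j ∈ block N k₁ k₂ then m j * a j else 0) ≤
        c⁻¹ * (m j * a j / m (bot x j) * meanGapStep m k₀ k₁ k₂ (bot x j) ^ 2) +
        (if (bot x j : ℕ) < k₁ ∧ k₁ ≤ j then m j * a j else 0) := by
      have q := qa (bot x j)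
      split_ifs with g1 g2 g2
      · linarith
      · rw [mem_block] at g1
        have := h₁.lt
        have := ra (bot x j) (mem_block.2 ⟨by omega, by omega⟩)
        linarith
      · linarith
      · linarith
    linarith
  have hci : 0 < c⁻¹ := inv_pos.2 hc0
  refine ⟨(c⁻¹ + 1) / e, by positivity, fun x hx => ?_⟩
  have h3 := key x hx
  have h4 := push_nonneg hm ha hb k₁ x
  have h5 : 0 ≤ meanGapRate m a b k₀ k₁ k₂ x := Finset.sum_nonneg fun i _ => by
    have := leftRate_nonneg hm ha i x
    have := rightRate_nonneg hm hb i x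
    positivity
  rw [div_mul_eq_mul_div, le_div_iff₀ hE]
  nlinarith [mul_nonneg hci.le h4]

/-- The time that `meanGap` spends below `R` is controlled by a Lyapunov function and by the
exchange of momentum at the ends of the two blocks. -/
lemma exists_indicator_meanGap_le {w ρ₁ ρ₂ : ℝ} (hm : ∀ i, 0 < m i) (ha : ∀ i, 0 ≤ a i)
    (hb : ∀ i, 0 ≤ b i)
    (h₁ : IsStableBlock m a b k₀ k₁ w ρ₁) (h₂ : IsStableBlock m a b k₁ k₂ w ρ₂)
    (hn₁ : 0 < ∑ i ∈ block N k₀ k₁, (a i + b i)) (hn₂ : 0 < ∑ i ∈ block N k₁ k₂, (a i + b i)) :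
    ∃ C C' : ℝ, 0 < C ∧ 0 < C' ∧ ∀ R : ℝ, 0 ≤ R → ∀ x : Fin N → ℤ, Monotone x →
      (if meanGap m k₀ k₁ k₂ x ≤ R then 1 else 0) ≤
        C * (gen m a b (fun y => huber R (meanGap m k₀ k₁ k₂ y)) x +
          C' * (R + 1) * (push m a b k₀ x + push m a b k₁ x + push m a b k₂ x)) := by
  obtain ⟨C, hC0, hC⟩ := exists_meanGapRate_ge hm ha hb h₁ h₂ hn₁ hn₂
  have M1 := blockMass_pos hm h₁.lt h₁.le
  have M2 := blockMass_pos hm h₂.lt h₂.le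
  set I₁ := (blockMass m k₀ k₁)⁻¹
  set I₂ := (blockMass m k₁ k₂)⁻¹
  have hI1 : 0 < I₁ := inv_pos.2 M1
  have hI2 : 0 < I₂ := inv_pos.2 M2
  refine ⟨C, 1 + 2 * I₁ + 2 * I₂, hC0, by positivity, fun R hR x hx => ?_⟩
  have p0 := push_nonneg hm ha hb k₀ x
  have p1 := push_nonneg hm ha hb k₁ x
  have p2 := push_nonneg hm ha hb k₂ x
  have hD := meanGap_nonneg hm h₁.lt h₂.lt h₂.le hx
  have g1 := gen_huber_ge (k₀ := k₀) (k₁ := k₁) (k₂ := k₂) hm ha hb R x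
  have g2 := gen_meanGap hm h₁ h₂ hx
  rw [div_eq_mul_inv, div_eq_mul_inv] at g2
  change _ = _ * I₂ - _ * I₁ at g2
  have s0 : 0 ≤ huberSlope R (meanGap m k₀ k₁ k₂ x) :=
    mul_nonneg two_pos.le (le_min hD (by linarith))
  have s1 : huberSlope R (meanGap m k₀ k₁ k₂ x) ≤ 2 * (R + 1) :=
    mul_le_mul_of_nonneg_left (min_le_right _ _) two_pos.le
  set s := huberSlope R (meanGap m k₀ k₁ k₂ x)
  set G := gen m a b (fun y => huber R (meanGap m k₀ k₁ k₂ y)) x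
  set p := push m a b k₀ x + push m a b k₁ x + push m a b k₂ x
  have hp : 0 ≤ p := by positivity
  -- Exchange at `k₁` drives the centres apart; only exchange at `k₀` and `k₂` gives a negative
  -- drift. The bound charges it to the total `p`.
  have l1 : -(2 * (R + 1) * ((I₁ + I₂) * p)) ≤ s * gen m a b (meanGap m k₀ k₁ k₂) x := by
    have t1 : -((I₁ + I₂) * p) ≤ gen m a b (meanGap m k₀ k₁ k₂) x := by
      rw [g2]
      have := mul_nonneg hI1.le p0
      have := mul_nonneg hI1.le p1
      have := mul_nonneg hI1.le p2
      have := mul_nonneg hI2.le p0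
      have := mul_nonneg hI2.le p1
      have := mul_nonneg hI2.le p2
      simp only [p]
      linarith
    have t2 := mul_le_mul_of_nonneg_left t1 s0
    have t3 : s * ((I₁ + I₂) * p) ≤ 2 * (R + 1) * ((I₁ + I₂) * p) :=
      mul_le_mul_of_nonneg_right s1 (by positivity)
    linarith
  have l2 : (if meanGap m k₀ k₁ k₂ x ≤ R then (1 : ℝ) else 0) ≤
      C * ((if meanGap m k₀ k₁ k₂ x ≤ R then meanGapRate m a b k₀ k₁ k₂ x else 0) +
        push m a b k₁ x) := by
    split_ifs
    · exact hC x hx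
    · positivity
  have l3 : (if meanGap m k₀ k₁ k₂ x ≤ R then meanGapRate m a b k₀ k₁ k₂ x else 0) +
      push m a b k₁ x ≤ G + (2 * (R + 1) * ((I₁ + I₂) * p)) + (R + 1) * p := by
    have : push m a b k₁ x ≤ p := by simp only [p]; linarith
    have : 0 ≤ R * p := mul_nonneg hR hp
    linarith
  refine l2.trans ((mul_le_mul_of_nonneg_left l3 hC0.le).trans (le_of_eq ?_))
  ring

/-- While two adjacent blocks of equal speed do not touch, a bounded function of the distance of
their centres of mass decreases on average. -/
lemma exists_gen_huber_gap_le {w ρ₁ ρ₂ : ℝ} (hm : ∀ i, 0 < m i) (ha : ∀ i, 0 ≤ a i)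
    (hb : ∀ i, 0 ≤ b i)
    (h₁ : IsStableBlock m a b k₀ k₁ w ρ₁) (h₂ : IsStableBlock m a b k₁ k₂ w ρ₂)
    (hn₁ : 0 < ∑ i ∈ block N k₀ k₁, (a i + b i)) (hn₂ : 0 < ∑ i ∈ block N k₁ k₂, (a i + b i)) :
    ∃ c : ℝ, 0 < c ∧ ∀ x : Fin N → ℤ, Monotone x → push m a b k₁ x = 0 →
      gen m a b (meanGap m k₀ k₁ k₂) x ≤ 0 ∧
      ∀ R : ℝ, 0 ≤ R →
        gen m a b (fun y => 2 * (R + 1) * meanGap m k₀ k₁ k₂ y -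
          huber R (meanGap m k₀ k₁ k₂ y)) x ≤ -if meanGap m k₀ k₁ k₂ x ≤ R then c else 0 := by
  obtain ⟨C, hC0, hC⟩ := exists_meanGapRate_ge hm ha hb h₁ h₂ hn₁ hn₂
  have M1 := blockMass_pos hm h₁.lt h₁.le
  have M2 := blockMass_pos hm h₂.lt h₂.le
  refine ⟨C⁻¹, inv_pos.2 hC0, fun x hx hp => ?_⟩
  have p0 := push_nonneg hm ha hb k₀ x
  have p2 := push_nonneg hm ha hb k₂ x
  -- With no exchange at `k₁`, the remaining exchanges at the outer ends can only push the two
  -- centres together.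
  have hgen : gen m a b (meanGap m k₀ k₁ k₂) x ≤ 0 := by
    rw [gen_meanGap hm h₁ h₂ hx, hp]
    have := div_nonneg p0 M1.le
    have := div_nonneg p2 M2.le
    rw [zero_sub, sub_zero, neg_div]
    linarith
  refine ⟨hgen, fun R hR => ?_⟩
  have hD := meanGap_nonneg hm h₁.lt h₂.lt h₂.le hx
  have g1 := gen_huber_ge (k₀ := k₀) (k₁ := k₁) (k₂ := k₂) hm ha hb R x
  have e : ∀ y, 2 * (R + 1) * meanGap m k₀ k₁ k₂ y - huber R (meanGap m k₀ k₁ k₂ y) =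
      2 * (R + 1) * meanGap m k₀ k₁ k₂ y + (-1) * huber R (meanGap m k₀ k₁ k₂ y) :=
    fun y => by ring
  rw [gen_congr e, gen_add, gen_const_mul, gen_const_mul]
  have s1 : huberSlope R (meanGap m k₀ k₁ k₂ x) ≤ 2 * (R + 1) :=
    mul_le_mul_of_nonneg_left (min_le_right _ _) two_pos.le
  have l1 := mul_nonpos_of_nonneg_of_nonpos (sub_nonneg.2 s1) hgen
  have l2 : (if meanGap m k₀ k₁ k₂ x ≤ R then C⁻¹ else 0) ≤
      (if meanGap m k₀ k₁ k₂ x ≤ R then meanGapRate m a b k₀ k₁ k₂ x else 0) := by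
    split_ifs
    · have := hC x hx
      rw [hp, add_zero] at this
      rwa [inv_eq_one_div, div_le_iff₀' hC0]
    · exact le_rfl
  linarith

end Separation

/-! ### The jump chain with holding times as a Markov chain. -/

section Kernels

open ProbabilityTheory

variable {N : ℕ} {m a b : Fin N → ℝ}

/-- The law of the next state of the jump chain. -/
def jumpLaw (m a b : Fin N → ℝ) (x : Fin N → ℤ) : Measure (Fin N → ℤ) :=
  if totalRate m a b x = 0 then Measure.dirac x
  else ∑ i, (ENNReal.ofReal (leftRate m a i x / totalRate m a b x) •
      Measure.dirac (x - Pi.single i 1) +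
    ENNReal.ofReal (rightRate m b i x / totalRate m a b x) • Measure.dirac (x + Pi.single i 1))

/-- The exponential law with parameter `l`, as a law of an extended holding time. -/
def holdLaw (l : ℝ) : Measure ℝ≥0∞ :=
  if l = 0 then Measure.dirac ∞ else (expMeasure l).map ENNReal.ofReal

lemma jumpLaw_singleton (hm : ∀ i, 0 < m i) (ha : ∀ i, 0 ≤ a i) (hb : ∀ i, 0 ≤ b i)
    (x y : Fin N → ℤ) : jumpLaw m a b x {y} = ENNReal.ofReal (jumpProb m a b x y) := by
  unfold jumpLaw jumpProb
  split_ifs with h h2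
  · simp [h2]
  · simp [Ne.symm h2]
  · have hl := totalRate_nonneg hm ha hb x
    have h1 := fun i => div_nonneg (leftRate_nonneg hm ha i x) hl
    have h2 := fun i => div_nonneg (rightRate_nonneg hm hb i x) hl
    rw [transRate, Finset.sum_div, ENNReal.ofReal_sum_of_nonneg, Measure.finsetSum_apply]
    · refine Finset.sum_congr rfl fun i _ => ?_
      rw [add_div, ENNReal.ofReal_add]
      · simp only [Measure.add_apply, Measure.smul_apply, smul_eq_mul,
          Measure.dirac_apply' _ (measurableSet_singleton y), Set.indicator_apply,
          Set.mem_singleton_iff, Pi.one_apply, eq_comm (a := y)]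
        congr 1 <;> split_ifs <;> simp
      · split_ifs <;> simp [h1 i]
      · split_ifs <;> simp [h2 i]
    · intro i _
      have := h1 i
      have := h2 i
      rw [add_div]
      split_ifs <;> simp <;> positivity

lemma isProbabilityMeasure_jumpLaw (hm : ∀ i, 0 < m i) (ha : ∀ i, 0 ≤ a i) (hb : ∀ i, 0 ≤ b i)
    (x : Fin N → ℤ) : IsProbabilityMeasure (jumpLaw m a b x) := by
  unfold jumpLaw
  split_ifs with h
  · infer_instance
  · have hl := totalRate_nonneg hm ha hb x
    have h1 := fun i => div_nonneg (leftRate_nonneg hm ha i x) hl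
    have h2 := fun i => div_nonneg (rightRate_nonneg hm hb i x) hl
    constructor
    simp only [Measure.finsetSum_apply, Measure.add_apply, Measure.smul_apply, smul_eq_mul,
      measure_univ, mul_one]
    simp_rw [← ENNReal.ofReal_add (h1 _) (h2 _)]
    rw [← ENNReal.ofReal_sum_of_nonneg fun i _ => add_nonneg (h1 i) (h2 i)]
    simp_rw [← add_div]
    rw [← Finset.sum_div, ← totalRate, div_self h, ENNReal.ofReal_one]

lemma isProbabilityMeasure_holdLaw {l : ℝ} (hl : 0 ≤ l) : IsProbabilityMeasure (holdLaw l) := by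
  unfold holdLaw
  split_ifs with h
  · infer_instance
  · have := isProbabilityMeasure_expMeasure (lt_of_le_of_ne hl (Ne.symm h))
    exact Measure.isProbabilityMeasure_map ENNReal.measurable_ofReal.aemeasurable

lemma expMeasure_Iic {l : ℝ} (hl : 0 < l) {s : ℝ} (hs : 0 ≤ s) :
    expMeasure l (Set.Iic s) = ENNReal.ofReal (1 - Real.exp (-(l * s))) := by
  have := isProbabilityMeasure_expMeasure hl
  have h := cdf_expMeasure_eq hl s
  rw [cdf_eq_real, if_pos hs] at h
  rw [← h, measureReal_def, ENNReal.ofReal_toReal (measure_ne_top _ _)]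

lemma holdLaw_Iic {l : ℝ} (hl : 0 ≤ l) {s : ℝ} (hs : 0 ≤ s) :
    holdLaw l (Set.Iic (ENNReal.ofReal s)) = ENNReal.ofReal (1 - Real.exp (-(l * s))) := by
  unfold holdLaw
  split_ifs with h
  · rw [Measure.dirac_apply' _ measurableSet_Iic]; simp [h]
  · rw [Measure.map_apply ENNReal.measurable_ofReal measurableSet_Iic,
      ← expMeasure_Iic (lt_of_le_of_ne hl (Ne.symm h)) hs]
    congr 1
    ext r
    simp [ENNReal.ofReal_le_ofReal_iff hs]

/-- The joint law of the next state and the holding time. -/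
def stepKernel (m a b : Fin N → ℝ) : Kernel (Fin N → ℤ) ((Fin N → ℤ) × ℝ≥0∞) :=
  Kernel.ofFunOfCountable fun x => (jumpLaw m a b x).prod (holdLaw (totalRate m a b x))

lemma stepKernel_apply (x : Fin N → ℤ) :
    stepKernel m a b x = (jumpLaw m a b x).prod (holdLaw (totalRate m a b x)) := rfl

lemma isMarkovKernel_stepKernel (hm : ∀ i, 0 < m i) (ha : ∀ i, 0 ≤ a i) (hb : ∀ i, 0 ≤ b i) :
    IsMarkovKernel (stepKernel m a b) := by
  constructor
  intro x
  have := isProbabilityMeasure_jumpLaw hm ha hb x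
  have := isProbabilityMeasure_holdLaw (totalRate_nonneg hm ha hb x)
  rw [stepKernel_apply]
  infer_instance

/-- `Y` and `S` are the jump chain and the holding times of the elastic system. -/
structure IsJumpChain {Ω : Type*} [MeasurableSpace Ω] (P : Measure Ω) {N : ℕ}
    (m a b : Fin N → ℝ) (x₀ : Fin N → ℤ) (Y : ℕ → Ω → Fin N → ℤ) (S : ℕ → Ω → ℝ≥0∞) : Prop where
  mass_pos : ∀ i, 0 < m i
  left_nonneg : ∀ i, 0 ≤ a i
  right_nonneg : ∀ i, 0 ≤ b i
  meas_Y : ∀ n, Measurable (Y n)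
  meas_S : ∀ n, Measurable (S n)
  init : ∀ᵐ ω ∂P, Y 0 ω = x₀
  law : ∀ (n : ℕ) (A : Set Ω), MeasurableSet[jumpHistory Y S n] A →
    ∀ (x y : Fin N → ℤ) (s : ℝ), 0 ≤ s →
      P (A ∩ {ω | Y n ω = x ∧ Y (n + 1) ω = y ∧ ENNReal.ofReal s < S n ω}) =
        P (A ∩ {ω | Y n ω = x}) *
          ENNReal.ofReal (jumpProb m a b x y * Real.exp (-(totalRate m a b x * s)))

lemma measurable_jumpHistory_Y {Ω : Type*} (Y : ℕ → Ω → Fin N → ℤ) (S : ℕ → Ω → ℝ≥0∞) {k n : ℕ} (h : k ≤ n) :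
    Measurable[jumpHistory Y S n] (Y k) :=
  Measurable.mono (comap_measurable (Y k))
    ((le_iSup₂ (f := fun k (_ : k ≤ n) => MeasurableSpace.comap (Y k) inferInstance) k h).trans
      le_sup_left) le_rfl

lemma measurable_jumpHistory_S {Ω : Type*} (Y : ℕ → Ω → Fin N → ℤ) (S : ℕ → Ω → ℝ≥0∞) {k n : ℕ} (h : k < n) :
    Measurable[jumpHistory Y S n] (S k) :=
  Measurable.mono (comap_measurable (S k))
    ((le_iSup₂ (f := fun k (_ : k < n) => MeasurableSpace.comap (S k) inferInstance) k h).trans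
      le_sup_right) le_rfl

variable {Ω : Type*} [MeasurableSpace Ω] {P : Measure Ω} {x₀ : Fin N → ℤ}
  {Y : ℕ → Ω → Fin N → ℤ} {S : ℕ → Ω → ℝ≥0∞}

lemma IsJumpChain.jumpHistory_le (h : IsJumpChain P m a b x₀ Y S) (n : ℕ) :
    jumpHistory Y S n ≤ ‹MeasurableSpace Ω› :=
  sup_le (iSup₂_le fun k _ => (h.meas_Y k).comap_le) (iSup₂_le fun k _ => (h.meas_S k).comap_le)

lemma IsJumpChain.measure_eq_mul (h : IsJumpChain P m a b x₀ Y S) (n : ℕ) {A : Set Ω}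
    (hA : MeasurableSet[jumpHistory Y S n] A) (x y : Fin N → ℤ) {s : ℝ} (hs : 0 ≤ s) :
    P (A ∩ {ω | Y n ω = x ∧ Y (n + 1) ω = y ∧ ENNReal.ofReal s < S n ω}) =
      P (A ∩ {ω | Y n ω = x}) *
        (jumpLaw m a b x {y} * ENNReal.ofReal (Real.exp (-(totalRate m a b x * s)))) := by
  rw [h.law n A hA x y s hs, jumpLaw_singleton h.mass_pos h.left_nonneg h.right_nonneg,
    ENNReal.ofReal_mul' (Real.exp_pos _).le]

variable [IsProbabilityMeasure P]

/-- Taking `s = 0` in the law and summing over the next states shows that `S n > 0` costs no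
probability, because `jumpLaw` has total mass one. -/
lemma IsJumpChain.hold_pos (h : IsJumpChain P m a b x₀ Y S) (n : ℕ) : ∀ᵐ ω ∂P, 0 < S n ω := by
  have key : ∀ x, P ({ω | Y n ω = x} ∩ {ω | S n ω = 0}) = 0 := by
    intro x
    have hx : MeasurableSet {ω | Y n ω = x} := h.meas_Y n (measurableSet_singleton x)
    have hS : MeasurableSet {ω | S n ω = 0} := h.meas_S n (measurableSet_singleton 0)
    have hJ := isProbabilityMeasure_jumpLaw h.mass_pos h.left_nonneg h.right_nonneg x
    have h1 : P ({ω | Y n ω = x} ∩ {ω | 0 < S n ω}) = P {ω | Y n ω = x} := by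
      set μ := (P.restrict ({ω | Y n ω = x} ∩ {ω | 0 < S n ω})).map (Y (n + 1)) with hμ
      have e : μ = P {ω | Y n ω = x} • jumpLaw m a b x := by
        refine Measure.ext_iff_singleton.2 fun y => ?_
        have := h.measure_eq_mul n (A := Set.univ) MeasurableSet.univ x y le_rfl
        simp only [Set.univ_inter, ENNReal.ofReal_zero, mul_zero, neg_zero, Real.exp_zero,
          ENNReal.ofReal_one, mul_one] at this
        rw [hμ, Measure.map_apply (h.meas_Y _) (measurableSet_singleton y),
          Measure.restrict_apply (h.meas_Y _ (measurableSet_singleton y)), Measure.smul_apply,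
          smul_eq_mul, ← this]
        congr 1
        ext ω
        simp only [Set.mem_inter_iff, Set.mem_preimage, Set.mem_singleton_iff, Set.mem_ofPred_eq]
        tauto
      have e2 := congrArg (fun ν => ν Set.univ) e
      simp only [hμ, Measure.map_apply (h.meas_Y _) MeasurableSet.univ, Set.preimage_univ,
        Measure.restrict_apply_univ, Measure.smul_apply, measure_univ, smul_eq_mul, mul_one] at e2
      exact e2
    have hpos : MeasurableSet {ω | 0 < S n ω} := h.meas_S n measurableSet_Ioi
    have h2 := measure_inter_add_sdiff {ω | Y n ω = x} (μ := P) hpos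
    rw [h1] at h2
    have h3 : P ({ω | Y n ω = x} \ {ω | 0 < S n ω}) = 0 :=
      (ENNReal.add_right_inj (measure_ne_top _ _)).1 (h2.trans (add_zero _).symm)
    refine measure_mono_null ?_ h3
    rintro ω ⟨q1, q2⟩
    refine ⟨q1, ?_⟩
    simp only [Set.mem_ofPred_eq] at q2 ⊢
    simp [q2]
  rw [ae_iff]
  refine measure_mono_null (t := ⋃ x, {ω | Y n ω = x} ∩ {ω | S n ω = 0}) ?_
    (measure_iUnion_null key)
  intro ω hω
  exact Set.mem_iUnion.2 ⟨Y n ω, rfl, by simpa using hω⟩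

/-- The hypothesis fixes the law only on singletons times tails. Singletons determine the first
marginal and the intervals `Iic` the second, so the two steps together identify the measure on
rectangles. -/
lemma IsJumpChain.map_restrict (h : IsJumpChain P m a b x₀ Y S) (n : ℕ) {A : Set Ω}
    (hA : MeasurableSet[jumpHistory Y S n] A) (x : Fin N → ℤ) :
    (P.restrict (A ∩ {ω | Y n ω = x})).map (fun ω => (Y (n + 1) ω, S n ω)) =
      P (A ∩ {ω | Y n ω = x}) • stepKernel m a b x := by
  have hJ := isProbabilityMeasure_jumpLaw h.mass_pos h.left_nonneg h.right_nonneg x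
  have hl := totalRate_nonneg h.mass_pos h.left_nonneg h.right_nonneg x
  have hH := isProbabilityMeasure_holdLaw hl
  have hx : MeasurableSet {ω | Y n ω = x} := h.meas_Y n (measurableSet_singleton x)
  have hA' := h.jumpHistory_le n A hA
  have hYS : Measurable fun ω => (Y (n + 1) ω, S n ω) := (h.meas_Y _).prodMk (h.meas_S _)
  have htot : ∀ y, P (A ∩ {ω | Y n ω = x} ∩ {ω | Y (n + 1) ω = y}) =
      P (A ∩ {ω | Y n ω = x}) * jumpLaw m a b x {y} := by
    intro y
    have := h.measure_eq_mul n hA x y le_rfl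
    simp only [ENNReal.ofReal_zero, mul_zero, neg_zero, Real.exp_zero, ENNReal.ofReal_one,
      mul_one] at this
    rw [← this]
    refine measure_congr (Filter.eventuallyEq_set.2 ?_)
    filter_upwards [h.hold_pos n] with ω hω
    simp only [Set.mem_inter_iff, Set.mem_ofPred_eq, hω, and_true, and_assoc]
  have hS : ∀ y, (P.restrict (A ∩ {ω | Y n ω = x} ∩ {ω | Y (n + 1) ω = y})).map (S n) =
      (P (A ∩ {ω | Y n ω = x}) * jumpLaw m a b x {y}) • holdLaw (totalRate m a b x) := by
    intro y
    have hfin : IsFiniteMeasure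
        ((P.restrict (A ∩ {ω | Y n ω = x} ∩ {ω | Y (n + 1) ω = y})).map (S n)) := inferInstance
    refine Measure.ext_of_Iic _ _ fun t => ?_
    rw [Measure.map_apply (h.meas_S n) measurableSet_Iic,
      Measure.restrict_apply (h.meas_S n measurableSet_Iic), Measure.smul_apply, smul_eq_mul]
    by_cases ht : t = ∞
    -- `Iic ∞` is the whole space and is not described by a finite tail; here the total mass `htot`
    -- is used.
    · subst ht
      simp [htot y]
    obtain ⟨s, hs, rfl⟩ : ∃ s : ℝ, 0 ≤ s ∧ t = ENNReal.ofReal s :=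
      ⟨t.toReal, ENNReal.toReal_nonneg, (ENNReal.ofReal_toReal ht).symm⟩
    rw [holdLaw_Iic hl hs]
    have h1 := h.measure_eq_mul n hA x y hs
    have h2 := measure_inter_add_sdiff (A ∩ {ω | Y n ω = x} ∩ {ω | Y (n + 1) ω = y}) (μ := P)
      (h.meas_S n measurableSet_Iic : MeasurableSet (S n ⁻¹' Set.Iic (ENNReal.ofReal s)))
    have e : (A ∩ {ω | Y n ω = x} ∩ {ω | Y (n + 1) ω = y}) \ (S n ⁻¹' Set.Iic (ENNReal.ofReal s)) =
        A ∩ {ω | Y n ω = x ∧ Y (n + 1) ω = y ∧ ENNReal.ofReal s < S n ω} := by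
      ext ω
      simp only [Set.mem_sdiff, Set.mem_inter_iff, Set.mem_ofPred_eq, Set.mem_preimage, Set.mem_Iic,
        not_le, and_assoc]
    rw [e, h1, htot y, Set.inter_comm] at h2
    have hle : Real.exp (-(totalRate m a b x * s)) ≤ 1 :=
      Real.exp_le_one_iff.2 (neg_nonpos.2 (mul_nonneg hl hs))
    have h3 : ENNReal.ofReal (1 - Real.exp (-(totalRate m a b x * s))) +
        ENNReal.ofReal (Real.exp (-(totalRate m a b x * s))) = 1 := by
      rw [← ENNReal.ofReal_add (by linarith) (Real.exp_pos _).le]; simp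
    have h4 : P (A ∩ {ω | Y n ω = x}) * jumpLaw m a b x {y} =
        P (A ∩ {ω | Y n ω = x}) * jumpLaw m a b x {y} *
          ENNReal.ofReal (1 - Real.exp (-(totalRate m a b x * s))) +
        P (A ∩ {ω | Y n ω = x}) * (jumpLaw m a b x {y} *
          ENNReal.ofReal (Real.exp (-(totalRate m a b x * s)))) := by
      rw [← mul_assoc, ← mul_add, h3, mul_one]
    rw [h4] at h2
    refine (ENNReal.add_left_inj ?_).1 h2
    exact ENNReal.mul_ne_top (measure_ne_top _ _)
      (ENNReal.mul_ne_top (measure_ne_top _ _) ENNReal.ofReal_ne_top)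
  refine Measure.ext_prod fun {s t} hs ht => ?_
  rw [Measure.map_apply hYS (hs.prod ht), Measure.restrict_apply (hYS (hs.prod ht)),
    Measure.smul_apply, smul_eq_mul, stepKernel_apply, Measure.prod_prod]
  have e : (P.restrict (A ∩ {ω | Y n ω = x} ∩ S n ⁻¹' t)).map (Y (n + 1)) =
      (P (A ∩ {ω | Y n ω = x}) * holdLaw (totalRate m a b x) t) • jumpLaw m a b x := by
    refine Measure.ext_iff_singleton.2 fun y => ?_
    have h1 := congrArg (fun ν => ν t) (hS y)
    simp only [Measure.map_apply (h.meas_S n) ht, Measure.restrict_apply (h.meas_S n ht),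
      Measure.smul_apply, smul_eq_mul] at h1
    rw [Measure.map_apply (h.meas_Y _) (measurableSet_singleton y),
      Measure.restrict_apply (h.meas_Y _ (measurableSet_singleton y)), Measure.smul_apply,
      smul_eq_mul, mul_right_comm, ← h1]
    congr 1
    ext ω
    simp only [Set.mem_inter_iff, Set.mem_ofPred_eq, Set.mem_preimage, Set.mem_singleton_iff]
    tauto
  have h1 := congrArg (fun ν => ν s) e
  simp only [Measure.map_apply (h.meas_Y _) hs, Measure.restrict_apply (h.meas_Y _ hs),
    Measure.smul_apply, smul_eq_mul] at h1
  rw [mul_comm (jumpLaw m a b x s), ← mul_assoc, ← h1]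
  congr 1
  ext ω
  simp only [Set.mem_inter_iff, Set.mem_ofPred_eq, Set.mem_preimage, Set.mem_prod]
  tauto

/-- The Markov property of the jump chain with its holding times. -/
lemma IsJumpChain.map_eq_compProd {β : Type*} [MeasurableSpace β]
    (h : IsJumpChain P m a b x₀ Y S) (n : ℕ) {Z : Ω → β}
    (hZ : Measurable[jumpHistory Y S n] Z) :
    P.map (fun ω => ((Y n ω, Z ω), (Y (n + 1) ω, S n ω))) =
      (P.map fun ω => (Y n ω, Z ω)) ⊗ₘ ((stepKernel m a b).comap Prod.fst measurable_fst) := by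
  have hK := isMarkovKernel_stepKernel h.mass_pos h.left_nonneg h.right_nonneg
  have hZ' : Measurable Z := hZ.mono (h.jumpHistory_le n) le_rfl
  have hYS : Measurable fun ω => (Y (n + 1) ω, S n ω) := (h.meas_Y _).prodMk (h.meas_S _)
  have hYZ : Measurable fun ω => (Y n ω, Z ω) := (h.meas_Y n).prodMk hZ'
  have hYZ' : Measurable[jumpHistory Y S n] fun ω => (Y n ω, Z ω) :=
    Measurable.prodMk (measurable_jumpHistory_Y Y S le_rfl) hZ
  have : IsProbabilityMeasure (P.map fun ω => (Y n ω, Z ω)) :=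
    Measure.isProbabilityMeasure_map hYZ.aemeasurable
  have : IsProbabilityMeasure (P.map (fun ω => ((Y n ω, Z ω), (Y (n + 1) ω, S n ω)))) :=
    Measure.isProbabilityMeasure_map (hYZ.prodMk hYS).aemeasurable
  refine Measure.ext_prod fun {B C} hB hC => ?_
  rw [Measure.map_apply (hYZ.prodMk hYS) (hB.prod hC), Measure.compProd_apply_prod hB hC,
    setLIntegral_map hB (Kernel.measurable_coe _ hC) hYZ]
  set A := (fun ω => (Y n ω, Z ω)) ⁻¹' B with hA
  have hA1 : MeasurableSet[jumpHistory Y S n] A := hYZ' hB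
  have hA2 : MeasurableSet A := hYZ hB
  change _ = ∫⁻ ω in A, stepKernel m a b (Y n ω) C ∂P
  have e1 : ∫⁻ ω in A, stepKernel m a b (Y n ω) C ∂P =
      ∫⁻ x, stepKernel m a b x C ∂((P.restrict A).map (Y n)) := by
    rw [lintegral_map (Kernel.measurable_coe _ hC) (h.meas_Y n)]
  rw [e1, lintegral_countable']
  have e2 : P ((fun ω => ((Y n ω, Z ω), (Y (n + 1) ω, S n ω))) ⁻¹' (B ×ˢ C)) =
      ∑' x, P (A ∩ {ω | Y n ω = x} ∩ (fun ω => (Y (n + 1) ω, S n ω)) ⁻¹' C) := by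
    rw [← measure_iUnion]
    · congr 1
      ext ω
      simp [hA]
    · intro x y hxy
      refine Set.disjoint_left.2 fun ω h1 h2 => hxy ?_
      exact h1.1.2.symm.trans h2.1.2
    · exact fun x => (hA2.inter (h.meas_Y n (measurableSet_singleton x))).inter (hYS hC)
  rw [e2]
  refine tsum_congr fun x => ?_
  have h1 := congrArg (fun ν => ν C) (h.map_restrict n hA1 x)
  simp only [Measure.map_apply hYS hC, Measure.restrict_apply (hYS hC), Measure.smul_apply,
    smul_eq_mul] at h1
  rw [Set.inter_comm, h1, mul_comm, Measure.map_apply (h.meas_Y n) (measurableSet_singleton x),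
    Measure.restrict_apply (h.meas_Y n (measurableSet_singleton x)), Set.inter_comm]
  rfl

/-- `Z` carries whatever part of the history the integrand needs besides the current state, such as
the jump time or the accumulated deviation from the clock. -/
lemma IsJumpChain.lintegral_step {β : Type*} [MeasurableSpace β]
    (h : IsJumpChain P m a b x₀ Y S) (n : ℕ) {Z : Ω → β}
    (hZ : Measurable[jumpHistory Y S n] Z)
    {g : (((Fin N → ℤ) × β) × ((Fin N → ℤ) × ℝ≥0∞)) → ℝ≥0∞} (hg : Measurable g) :
    ∫⁻ ω, g ((Y n ω, Z ω), (Y (n + 1) ω, S n ω)) ∂P =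
      ∫⁻ ω, ∫⁻ z, g ((Y n ω, Z ω), z) ∂(stepKernel m a b (Y n ω)) ∂P := by
  have hK := isMarkovKernel_stepKernel h.mass_pos h.left_nonneg h.right_nonneg
  have hZ' : Measurable Z := hZ.mono (h.jumpHistory_le n) le_rfl
  have hYS : Measurable fun ω => (Y (n + 1) ω, S n ω) := (h.meas_Y _).prodMk (h.meas_S _)
  have hYZ : Measurable fun ω => (Y n ω, Z ω) := (h.meas_Y n).prodMk hZ'
  have : IsProbabilityMeasure (P.map fun ω => (Y n ω, Z ω)) :=
    Measure.isProbabilityMeasure_map hYZ.aemeasurable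
  rw [← lintegral_map (f := g) hg (hYZ.prodMk hYS), h.map_eq_compProd n hZ,
    Measure.lintegral_compProd hg, lintegral_map (Measurable.lintegral_kernel_prod_right' hg) hYZ]
  rfl

lemma IsJumpChain.integral_step {β : Type*} [MeasurableSpace β]
    (h : IsJumpChain P m a b x₀ Y S) (n : ℕ) {Z : Ω → β}
    (hZ : Measurable[jumpHistory Y S n] Z)
    {g : (((Fin N → ℤ) × β) × ((Fin N → ℤ) × ℝ≥0∞)) → ℝ} (hg : Measurable g)
    (hInt : Integrable (fun ω => g ((Y n ω, Z ω), (Y (n + 1) ω, S n ω))) P) :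
    ∫ ω, g ((Y n ω, Z ω), (Y (n + 1) ω, S n ω)) ∂P =
      ∫ ω, ∫ z, g ((Y n ω, Z ω), z) ∂(stepKernel m a b (Y n ω)) ∂P := by
  have hK := isMarkovKernel_stepKernel h.mass_pos h.left_nonneg h.right_nonneg
  have hZ' : Measurable Z := hZ.mono (h.jumpHistory_le n) le_rfl
  have hYS : Measurable fun ω => (Y (n + 1) ω, S n ω) := (h.meas_Y _).prodMk (h.meas_S _)
  have hYZ : Measurable fun ω => (Y n ω, Z ω) := (h.meas_Y n).prodMk hZ'
  have : IsProbabilityMeasure (P.map fun ω => (Y n ω, Z ω)) :=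
    Measure.isProbabilityMeasure_map hYZ.aemeasurable
  have hInt' : Integrable g (P.map (fun ω => ((Y n ω, Z ω), (Y (n + 1) ω, S n ω)))) :=
    (integrable_map_measure hg.aestronglyMeasurable (hYZ.prodMk hYS).aemeasurable).2 hInt
  rw [h.map_eq_compProd n hZ] at hInt'
  have hI := (hg.stronglyMeasurable.integral_kernel_prod_right'
    (κ := (stepKernel m a b).comap (Prod.fst : (Fin N → ℤ) × β → _) measurable_fst))
  rw [← integral_map (f := g) (hYZ.prodMk hYS).aemeasurable hg.aestronglyMeasurable,
    h.map_eq_compProd n hZ, Measure.integral_compProd hInt',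
    integral_map hYZ.aemeasurable hI.aestronglyMeasurable]
  rfl

end Kernels

/-! ### Drift inequalities along the jump chain. -/

section Chain

open ProbabilityTheory

variable {N : ℕ} {m a b : Fin N → ℝ}

lemma integral_jumpLaw (hm : ∀ i, 0 < m i) (ha : ∀ i, 0 ≤ a i) (hb : ∀ i, 0 ≤ b i)
    {x : Fin N → ℤ} (hl : totalRate m a b x ≠ 0) (f : (Fin N → ℤ) → ℝ) :
    ∫ y, f y ∂jumpLaw m a b x = f x + gen m a b f x / totalRate m a b x := by
  have hl0 := totalRate_nonneg hm ha hb x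
  have h1 := fun i => div_nonneg (leftRate_nonneg hm ha i x) hl0
  have h2 := fun i => div_nonneg (rightRate_nonneg hm hb i x) hl0
  have hi : ∀ (c : ℝ) (y : Fin N → ℤ), Integrable f (ENNReal.ofReal c • Measure.dirac y) :=
    fun c y => (integrable_dirac (by simp)).smul_measure ENNReal.ofReal_ne_top
  rw [jumpLaw, if_neg hl, integral_finsetSum_measure fun i _ => (hi _ _).add_measure (hi _ _)]
  have e : ∀ i, ∫ y, f y ∂(ENNReal.ofReal (leftRate m a i x / totalRate m a b x) •
      Measure.dirac (x - Pi.single i 1) +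
    ENNReal.ofReal (rightRate m b i x / totalRate m a b x) • Measure.dirac (x + Pi.single i 1)) =
    (leftRate m a i x + rightRate m b i x) * (f x / totalRate m a b x) +
    (leftRate m a i x * (f (x - Pi.single i 1) - f x) +
    rightRate m b i x * (f (x + Pi.single i 1) - f x)) / totalRate m a b x := by
    intro i
    rw [integral_add_measure (hi _ _) (hi _ _), integral_smul_measure, integral_smul_measure,
      integral_dirac, integral_dirac, ENNReal.toReal_ofReal (h1 i), ENNReal.toReal_ofReal (h2 i),
      smul_eq_mul, smul_eq_mul]
    ring
  rw [Finset.sum_congr rfl fun i _ => e i, Finset.sum_add_distrib, ← Finset.sum_mul,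
    ← Finset.sum_div, ← gen, ← totalRate, mul_div_cancel₀ _ hl]

lemma ae_jumpLaw {x : Fin N → ℤ} (hx : Monotone x) (hl : totalRate m a b x ≠ 0) :
    ∀ᵐ y ∂jumpLaw m a b x, Monotone y ∧ ∃ i, y = x - Pi.single i 1 ∨ y = x + Pi.single i 1 := by
  rw [jumpLaw, if_neg hl, ae_finsetSum_measure_iff]
  intro i _
  rw [ae_add_measure_iff]
  constructor
  · by_cases h : leftRate m a i x = 0
    · simp [h]
    · refine Measure.ae_smul_measure ?_ _
      rw [ae_dirac_eq]
      exact ⟨monotone_sub_single hx h, i, Or.inl rfl⟩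
  · by_cases h : rightRate m b i x = 0
    · simp [h]
    · refine Measure.ae_smul_measure ?_ _
      rw [ae_dirac_eq]
      exact ⟨monotone_add_single hx h, i, Or.inr rfl⟩

lemma ae_holdLaw {l : ℝ} (hl : l ≠ 0) : ∀ᵐ s ∂holdLaw l, s < ∞ := by
  rw [holdLaw, if_neg hl, ae_map_iff ENNReal.measurable_ofReal.aemeasurable measurableSet_Iio]
  exact ae_of_all _ fun r => ENNReal.ofReal_lt_top

/-- The predictable clock of the jump chain: the sum of the mean holding times. -/
def clock {Ω : Type*} (m a b : Fin N → ℝ) (Y : ℕ → Ω → Fin N → ℤ) (n : ℕ) (ω : Ω) : ℝ :=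
  ∑ k ∈ Finset.range n, (totalRate m a b (Y k ω))⁻¹

lemma measurable_clock {Ω : Type*} {mΩ : MeasurableSpace Ω} {Y : ℕ → Ω → Fin N → ℤ} {n : ℕ}
    (hY : ∀ k < n, Measurable (Y k)) :
    Measurable (clock m a b Y n) :=
  Finset.measurable_fun_sum _ fun k hk =>
    (measurable_of_countable fun x => (totalRate m a b x)⁻¹).comp (hY k (Finset.mem_range.1 hk))

variable {Ω : Type*} [MeasurableSpace Ω] {P : Measure Ω} {x₀ : Fin N → ℤ}
  {Y : ℕ → Ω → Fin N → ℤ} {S : ℕ → Ω → ℝ≥0∞}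

lemma finite_box (x₀ : Fin N → ℤ) (n : ℕ) : {x : Fin N → ℤ | ∀ i, |x i - x₀ i| ≤ n}.Finite := by
  refine (Set.finite_Icc (fun i => x₀ i - n) (fun i => x₀ i + n)).subset fun x hx => ?_
  refine ⟨fun i => ?_, fun i => ?_⟩
  · have := (abs_le.1 (hx i)).1; simp only; linarith
  · have := (abs_le.1 (hx i)).2; simp only; linarith

lemma exists_bound_on_box (x₀ : Fin N → ℤ) (n : ℕ) {f : (Fin N → ℤ) → ℝ → ℝ}
    (hf : ∀ x, Continuous (f x)) (c : ℝ) :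
    ∃ B, ∀ x, (∀ i, |x i - x₀ i| ≤ n) → ∀ t ∈ Set.Icc 0 c, |f x t| ≤ B := by
  have : ∀ x, ∃ B, ∀ t ∈ Set.Icc 0 c, ‖f x t‖ ≤ B := fun x =>
    isCompact_Icc.exists_bound_of_continuousOn (hf x).continuousOn
  choose B hB using this
  refine ⟨∑ x ∈ (finite_box x₀ n).toFinset, |B x|, fun x hx t ht => ?_⟩
  refine ((hB x t ht).trans (le_abs_self _)).trans ?_
  exact Finset.single_le_sum (f := fun x => |B x|) (fun x _ => abs_nonneg _)
    ((finite_box x₀ n).mem_toFinset.2 hx)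

lemma measurable_uncurry_of_continuous {f : (Fin N → ℤ) → ℝ → ℝ} (hf : ∀ x, Continuous (f x)) :
    Measurable (fun p : (Fin N → ℤ) × ℝ => f p.1 p.2) :=
  measurable_from_prod_countable_right fun x => (hf x).measurable

lemma IsJumpChain.measurable_comp (h : IsJumpChain P m a b x₀ Y S) {f : (Fin N → ℤ) → ℝ → ℝ}
    (hf : ∀ x, Continuous (f x)) (n k : ℕ) :
    Measurable fun ω => f (Y n ω) (clock m a b Y k ω) :=
  (measurable_uncurry_of_continuous hf).comp
    ((h.meas_Y n).prodMk (measurable_clock fun k _ => h.meas_Y k))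

variable [IsProbabilityMeasure P]

/-- `lintegral_step` for the indicator of the exceptional set turns almost sure statements about the
kernel into statements about paths. -/
lemma IsJumpChain.ae_step (h : IsJumpChain P m a b x₀ Y S) (n : ℕ)
    {r : ((Fin N → ℤ) × ((Fin N → ℤ) × ℝ≥0∞)) → Prop} (hr : MeasurableSet {p | r p})
    (hae : ∀ᵐ ω ∂P, ∀ᵐ z ∂stepKernel m a b (Y n ω), r (Y n ω, z)) :
    ∀ᵐ ω ∂P, r (Y n ω, (Y (n + 1) ω, S n ω)) := by
  have hYS : Measurable fun ω => (Y n ω, (Y (n + 1) ω, S n ω)) :=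
    (h.meas_Y n).prodMk ((h.meas_Y _).prodMk (h.meas_S _))
  have key := h.lintegral_step n (Z := fun _ : Ω => ()) measurable_const
    (g := fun p => Set.indicator {q | r q}ᶜ (fun _ => (1 : ℝ≥0∞)) (p.1.1, p.2))
    ((measurable_const.indicator hr.compl).comp (by fun_prop))
  have e1 : ∫⁻ ω, Set.indicator {q | r q}ᶜ (fun _ => (1 : ℝ≥0∞)) (Y n ω, (Y (n + 1) ω, S n ω)) ∂P =
      P ((fun ω => (Y n ω, (Y (n + 1) ω, S n ω))) ⁻¹' {q | r q}ᶜ) := by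
    rw [← lintegral_indicator_one (hYS hr.compl)]
    rfl
  rw [e1] at key
  rw [ae_iff]
  change P ((fun ω => (Y n ω, (Y (n + 1) ω, S n ω))) ⁻¹' {q | r q}ᶜ) = 0
  rw [key, lintegral_eq_zero_iff']
  · filter_upwards [hae] with ω hω
    rw [Pi.zero_apply, lintegral_eq_zero_iff]
    · filter_upwards [hω] with z hz
      simp [hz]
    · exact (measurable_const.indicator hr.compl).comp (by fun_prop)
  · have hK := isMarkovKernel_stepKernel h.mass_pos h.left_nonneg h.right_nonneg
    have hmeas : Measurable fun x : Fin N → ℤ =>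
        ∫⁻ z, Set.indicator {q | r q}ᶜ (fun _ => (1 : ℝ≥0∞)) (x, z) ∂stepKernel m a b x :=
      measurable_of_countable _
    exact (hmeas.comp (h.meas_Y n)).aemeasurable

lemma IsJumpChain.ae_monotone (h : IsJumpChain P m a b x₀ Y S) (hx₀ : Monotone x₀)
    (hrate : 0 < rateMin m a b) : ∀ᵐ ω ∂P, ∀ n, Monotone (Y n ω) := by
  rw [ae_all_iff]
  intro n
  induction n with
  | zero => filter_upwards [h.init] with ω hω; rw [hω]; exact hx₀
  | succ n ih =>
    refine h.ae_step n (r := fun p => Monotone p.2.1) ?_ ?_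
    · exact (show Measurable fun p : ((Fin N → ℤ) × ((Fin N → ℤ) × ℝ≥0∞)) => p.2.1 by fun_prop)
        (MeasurableSet.of_discrete (s := {y : Fin N → ℤ | Monotone y}))
    · filter_upwards [ih] with ω hω
      have hl := (hrate.trans_le
        (rateMin_le h.mass_pos h.left_nonneg h.right_nonneg hω)).ne'
      have := isProbabilityMeasure_jumpLaw h.mass_pos h.left_nonneg h.right_nonneg (Y n ω)
      have := isProbabilityMeasure_holdLaw
        (totalRate_nonneg h.mass_pos h.left_nonneg h.right_nonneg (Y n ω))
      rw [stepKernel_apply]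
      exact Measure.quasiMeasurePreserving_fst.ae
        ((ae_jumpLaw hω hl).mono fun y hy => hy.1)

lemma IsJumpChain.ae_jump (h : IsJumpChain P m a b x₀ Y S) (hx₀ : Monotone x₀)
    (hrate : 0 < rateMin m a b) :
    ∀ᵐ ω ∂P, ∀ n, S n ω < ∞ ∧
      ∃ i, Y (n + 1) ω = Y n ω - Pi.single i 1 ∨ Y (n + 1) ω = Y n ω + Pi.single i 1 := by
  rw [ae_all_iff]
  intro n
  refine h.ae_step n (r := fun p => p.2.2 < ∞ ∧
      ∃ i, p.2.1 = p.1 - Pi.single i 1 ∨ p.2.1 = p.1 + Pi.single i 1) ?_ ?_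
  · refine MeasurableSet.inter
      (measurableSet_lt (measurable_snd.comp measurable_snd) measurable_const) ?_
    exact (show Measurable fun p : ((Fin N → ℤ) × ((Fin N → ℤ) × ℝ≥0∞)) => (p.1, p.2.1) by fun_prop)
      (MeasurableSet.of_discrete (s := {q : (Fin N → ℤ) × (Fin N → ℤ) |
        ∃ i, q.2 = q.1 - Pi.single i 1 ∨ q.2 = q.1 + Pi.single i 1}))
  · filter_upwards [h.ae_monotone hx₀ hrate] with ω hω'
    have hω := hω' n
    have hl := (hrate.trans_le
      (rateMin_le h.mass_pos h.left_nonneg h.right_nonneg hω)).ne'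
    have := isProbabilityMeasure_jumpLaw h.mass_pos h.left_nonneg h.right_nonneg (Y n ω)
    have := isProbabilityMeasure_holdLaw
      (totalRate_nonneg h.mass_pos h.left_nonneg h.right_nonneg (Y n ω))
    rw [stepKernel_apply]
    have h1 := (Measure.quasiMeasurePreserving_fst (μ := jumpLaw m a b (Y n ω))
      (ν := holdLaw (totalRate m a b (Y n ω)))).ae
      (ae_jumpLaw hω hl)
    have h2 := (Measure.quasiMeasurePreserving_snd (μ := jumpLaw m a b (Y n ω))
      (ν := holdLaw (totalRate m a b (Y n ω)))).ae (ae_holdLaw hl)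
    filter_upwards [h1, h2] with z hz1 hz2
    exact ⟨hz2, hz1.2⟩

lemma IsJumpChain.ae_mem_box (h : IsJumpChain P m a b x₀ Y S) (hx₀ : Monotone x₀)
    (hrate : 0 < rateMin m a b) :
    ∀ᵐ ω ∂P, ∀ n, (∀ i, |Y n ω i - x₀ i| ≤ n) ∧
      clock m a b Y n ω ∈ Set.Icc 0 (n * (rateMin m a b)⁻¹) := by
  filter_upwards [h.ae_monotone hx₀ hrate, h.ae_jump hx₀ hrate, h.init] with ω h1 h2 h3
  intro n
  induction n with
  | zero => simp [h3, clock]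
  | succ n ih =>
    refine ⟨fun i => ?_, ?_⟩
    · have q := abs_le.1 (ih.1 i)
      obtain ⟨-, k, hk | hk⟩ := h2 n
      all_goals
        rw [hk, abs_le]
        simp only [Pi.sub_apply, Pi.add_apply, Pi.single_apply]
        push_cast
        split_ifs <;> constructor <;> linarith [q.1, q.2]
    · have hl := rateMin_le h.mass_pos h.left_nonneg h.right_nonneg (h1 n)
      have e : clock m a b Y (n + 1) ω = clock m a b Y n ω + (totalRate m a b (Y n ω))⁻¹ :=
        Finset.sum_range_succ _ _
      have h4 : (totalRate m a b (Y n ω))⁻¹ ≤ (rateMin m a b)⁻¹ := inv_anti₀ hrate hl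
      have h5 : 0 ≤ (totalRate m a b (Y n ω))⁻¹ := inv_nonneg.2 (hrate.le.trans hl)
      have h6 := ih.2
      rw [Set.mem_Icc] at h6 ⊢
      rw [e]
      push_cast
      constructor <;> linarith

/-- After `n` jumps the state lies in a finite box and the clock after `k` jumps in a compact
interval, so the integrand is bounded. This makes even exponential functions integrable without
further estimates. -/
lemma IsJumpChain.integrable_comp (h : IsJumpChain P m a b x₀ Y S) (hx₀ : Monotone x₀)
    (hrate : 0 < rateMin m a b) {f : (Fin N → ℤ) → ℝ → ℝ} (hf : ∀ x, Continuous (f x)) (n k : ℕ) :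
    Integrable (fun ω => f (Y n ω) (clock m a b Y k ω)) P := by
  obtain ⟨B, hB⟩ := exists_bound_on_box x₀ n hf (k * (rateMin m a b)⁻¹)
  refine Integrable.of_bound (h.measurable_comp hf n k).aestronglyMeasurable B ?_
  filter_upwards [h.ae_mem_box hx₀ hrate] with ω hω
  exact hB _ (hω n).1 _ (hω k).2

lemma IsJumpChain.setIntegral_step (h : IsJumpChain P m a b x₀ Y S) (hx₀ : Monotone x₀)
    (hrate : 0 < rateMin m a b) {f : (Fin N → ℤ) → ℝ → ℝ} (hf : ∀ x, Continuous (f x)) (n : ℕ)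
    {A : Set Ω} (hA : MeasurableSet[jumpHistory Y S n] A) :
    ∫ ω in A, f (Y (n + 1) ω) (clock m a b Y (n + 1) ω) ∂P =
      ∫ ω in A, (f (Y n ω) (clock m a b Y (n + 1) ω) +
        gen m a b (fun y => f y (clock m a b Y (n + 1) ω)) (Y n ω) / totalRate m a b (Y n ω)) ∂P := by
  have hA' := h.jumpHistory_le n A hA
  -- The clock at step `n + 1` involves only the states up to `Y n`, hence it belongs to the
  -- history, and so does the indicator of `A`.
  set Z : Ω → ℝ × ℝ := fun ω => (clock m a b Y (n + 1) ω, A.indicator (fun _ => (1 : ℝ)) ω) with hZ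
  have hZm : Measurable[jumpHistory Y S n] Z :=
    Measurable.prodMk (measurable_clock (mΩ := jumpHistory Y S n)
      fun k hk => measurable_jumpHistory_Y Y S (Nat.lt_succ_iff.1 hk))
      (Measurable.indicator (m := jumpHistory Y S n) measurable_const hA)
  set g : (((Fin N → ℤ) × (ℝ × ℝ)) × ((Fin N → ℤ) × ℝ≥0∞)) → ℝ :=
    fun p => p.1.2.2 * f p.2.1 p.1.2.1 with hg
  have hgm : Measurable g := Measurable.mul (by fun_prop)
    ((measurable_uncurry_of_continuous hf).comp (g := fun q : (Fin N → ℤ) × ℝ => f q.1 q.2)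
      (f := fun p : (((Fin N → ℤ) × (ℝ × ℝ)) × ((Fin N → ℤ) × ℝ≥0∞)) => (p.2.1, p.1.2.1))
      (by fun_prop))
  have e : ∀ (F : Ω → ℝ), ∫ ω in A, F ω ∂P = ∫ ω, A.indicator (fun _ => (1 : ℝ)) ω * F ω ∂P := by
    intro F
    rw [← integral_indicator hA']
    congr 1
    ext ω
    by_cases hω : ω ∈ A <;> simp [hω]
  have hInt : Integrable (fun ω => g ((Y n ω, Z ω), (Y (n + 1) ω, S n ω))) P := by
    have : (fun ω => g ((Y n ω, Z ω), (Y (n + 1) ω, S n ω))) =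
        A.indicator fun ω => f (Y (n + 1) ω) (clock m a b Y (n + 1) ω) := by
      ext ω
      by_cases hω : ω ∈ A <;> simp [hg, hZ, hω]
    rw [this]
    exact (h.integrable_comp hx₀ hrate hf (n + 1) (n + 1)).indicator hA'
  have key := h.integral_step n hZm hgm hInt
  rw [e, e]
  refine key.trans (integral_congr_ae ?_)
  filter_upwards [h.ae_monotone hx₀ hrate] with ω hω
  have hl := (hrate.trans_le (rateMin_le h.mass_pos h.left_nonneg h.right_nonneg (hω n))).ne'
  have i1 := isProbabilityMeasure_jumpLaw h.mass_pos h.left_nonneg h.right_nonneg (Y n ω)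
  have i2 := isProbabilityMeasure_holdLaw
    (totalRate_nonneg h.mass_pos h.left_nonneg h.right_nonneg (Y n ω))
  simp only [hg, hZ]
  rw [integral_const_mul, stepKernel_apply,
    integral_fun_fst (f := fun y => f y (clock m a b Y (n + 1) ω)),
    integral_jumpLaw h.mass_pos h.left_nonneg h.right_nonneg hl]
  simp

/-- Summed drift inequality for functions of the jump chain and its clock. -/
lemma IsJumpChain.integral_le_add_sum (h : IsJumpChain P m a b x₀ Y S) (hx₀ : Monotone x₀)
    (hrate : 0 < rateMin m a b) {f g : (Fin N → ℤ) → ℝ → ℝ} (hf : ∀ x, Continuous (f x))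
    (hg : ∀ x, Continuous (g x))
    (hfg : ∀ x, Monotone x → ∀ t, 0 ≤ t →
      f x (t + (totalRate m a b x)⁻¹) +
        gen m a b (fun y => f y (t + (totalRate m a b x)⁻¹)) x / totalRate m a b x ≤
      f x t + g x t) (n : ℕ) :
    ∫ ω, f (Y n ω) (clock m a b Y n ω) ∂P ≤
      f x₀ 0 + ∑ k ∈ Finset.range n, ∫ ω, g (Y k ω) (clock m a b Y k ω) ∂P := by
  induction n with
  | zero =>
    have : ∫ ω, f (Y 0 ω) (clock m a b Y 0 ω) ∂P = ∫ ω, f x₀ 0 ∂P := by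
      refine integral_congr_ae ?_
      filter_upwards [h.init] with ω hω
      simp [hω, clock]
    simp [this]
  | succ n ih =>
    have key := h.setIntegral_step hx₀ hrate hf n (A := Set.univ) MeasurableSet.univ
    rw [setIntegral_univ, setIntegral_univ] at key
    have e : ∀ ω, clock m a b Y (n + 1) ω = clock m a b Y n ω + (totalRate m a b (Y n ω))⁻¹ :=
      fun ω => Finset.sum_range_succ _ _
    rw [Finset.sum_range_succ, key]
    have hI1 := h.integrable_comp hx₀ hrate hf n n
    have hI2 := h.integrable_comp hx₀ hrate hg n n
    have step : ∫ ω, (f (Y n ω) (clock m a b Y (n + 1) ω) +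
        gen m a b (fun y => f y (clock m a b Y (n + 1) ω)) (Y n ω) / totalRate m a b (Y n ω)) ∂P ≤
        ∫ ω, (f (Y n ω) (clock m a b Y n ω) + g (Y n ω) (clock m a b Y n ω)) ∂P := by
      refine integral_mono_ae ?_ (hI1.add hI2) ?_
      · exact h.integrable_comp hx₀ hrate (f := fun x t => f x t +
          gen m a b (fun y => f y t) x / totalRate m a b x)
          (fun x => by unfold gen; fun_prop) n (n + 1)
      · filter_upwards [h.ae_monotone hx₀ hrate, h.ae_mem_box hx₀ hrate] with ω h1 h2
        simp only [e]
        exact hfg _ (h1 n) _ (h2 n).2.1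
    rw [integral_add hI1 hI2] at step
    linarith

end Chain

/-! ### Integrals against exponential holding times. -/

section Exponential

open ProbabilityTheory

lemma lintegral_holdLaw {l : ℝ} (hl : 0 < l) {g : ℝ → ℝ≥0∞} (hg : Measurable g) :
    ∫⁻ s, g s.toReal ∂holdLaw l =
      ∫⁻ r in Set.Ioi 0, ENNReal.ofReal (l * Real.exp (-(l * r))) * g r := by
  have hpdf : Measurable (exponentialPDF l) :=
    (measurable_exponentialPDFReal l).ennreal_ofReal
  rw [holdLaw, if_neg hl.ne', lintegral_map (f := fun s : ℝ≥0∞ => g s.toReal)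
    (hg.comp ENNReal.measurable_toReal) ENNReal.measurable_ofReal]
  change ∫⁻ r, g (ENNReal.ofReal r).toReal ∂(volume.withDensity (exponentialPDF l)) = _
  rw [lintegral_withDensity_eq_lintegral_mul _ hpdf
    (show Measurable fun r : ℝ => g (ENNReal.ofReal r).toReal from
      hg.comp (ENNReal.measurable_toReal.comp ENNReal.measurable_ofReal)),
    ← setLIntegral_univ, ← Set.Iic_union_Ioi (a := (0 : ℝ)),
    lintegral_union measurableSet_Ioi (Set.Iic_disjoint_Ioi le_rfl)]
  have e1 : ∫⁻ r in Set.Iic (0 : ℝ), (exponentialPDF l * fun r => g (ENNReal.ofReal r).toReal) r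
      = 0 := by
    rw [setLIntegral_congr Iio_ae_eq_Iic.symm, setLIntegral_congr_fun (g := fun _ => 0)
      measurableSet_Iio]
    · simp
    · intro r hr
      simp [exponentialPDF_of_neg (show r < 0 from hr)]
  rw [e1, zero_add]
  refine setLIntegral_congr_fun measurableSet_Ioi fun r hr => ?_
  have hr' : (0 : ℝ) ≤ r := le_of_lt hr
  simp [exponentialPDF_of_nonneg hr', ENNReal.toReal_ofReal hr']

lemma tendsto_pow_mul_exp_neg_mul {l : ℝ} (hl : 0 < l) (k : ℕ) :
    Tendsto (fun r : ℝ => r ^ k * Real.exp (-(l * r))) atTop (𝓝 0) := by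
  have := tendsto_rpow_mul_exp_neg_mul_atTop_nhds_zero k l hl
  refine this.congr fun r => ?_
  rw [Real.rpow_natCast, neg_mul]

lemma lintegral_holdLaw_sq {l : ℝ} (hl : 0 < l) (u : ℝ) :
    ∫⁻ s, ENNReal.ofReal ((u + s.toReal - l⁻¹) ^ 2) ∂holdLaw l =
      ENNReal.ofReal (u ^ 2 + l⁻¹ ^ 2) := by
  rw [lintegral_holdLaw (g := fun s => ENNReal.ofReal ((u + s - l⁻¹) ^ 2)) hl (by fun_prop)]
  set v := u - l⁻¹ with hv
  -- An explicit antiderivative of the integrand, which tends to zero at infinity.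
  set G : ℝ → ℝ := fun r => -(Real.exp (-(l * r)) * ((v + r) ^ 2 + 2 * (v + r) / l + 2 / l ^ 2))
  have hd : ∀ r ∈ Set.Ici (0 : ℝ),
      HasDerivAt G (l * Real.exp (-(l * r)) * (u + r - l⁻¹) ^ 2) r := by
    intro r _
    have h1 : HasDerivAt (fun r : ℝ => Real.exp (-(l * r))) (Real.exp (-(l * r)) * (-(l * 1))) r :=
      (((hasDerivAt_id r).const_mul l).neg).exp
    have h2 : HasDerivAt (fun r : ℝ => v + r) 1 r := (hasDerivAt_id r).const_add v
    have h3 := (h1.mul (((h2.pow 2).add ((h2.const_mul 2).div_const l)).add_const (2 / l ^ 2))).neg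
    refine HasDerivAt.congr_deriv (f := G) h3 ?_
    rw [show u + r - l⁻¹ = v + r by rw [hv]; ring]
    simp only [Pi.add_apply, Pi.pow_apply]
    field_simp
    ring
  have hpos : ∀ r ∈ Set.Ioi (0 : ℝ), 0 ≤ l * Real.exp (-(l * r)) * (u + r - l⁻¹) ^ 2 :=
    fun r _ => by positivity
  have hlim : Tendsto G atTop (𝓝 0) := by
    have h0 := tendsto_pow_mul_exp_neg_mul hl 0
    have h1 := tendsto_pow_mul_exp_neg_mul hl 1
    have h2 := tendsto_pow_mul_exp_neg_mul hl 2
    have h3 := ((h2.const_mul (-1)).add (h1.const_mul (-(2 * v + 2 / l)))).add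
      (h0.const_mul (-(v ^ 2 + 2 * v / l + 2 / l ^ 2)))
    simp only [mul_zero, add_zero] at h3
    refine h3.congr fun r => ?_
    simp only [G]
    ring
  have e : ∀ r, ENNReal.ofReal (l * Real.exp (-(l * r))) * ENNReal.ofReal ((u + r - l⁻¹) ^ 2) =
      ENNReal.ofReal (l * Real.exp (-(l * r)) * (u + r - l⁻¹) ^ 2) := fun r =>
    (ENNReal.ofReal_mul (by positivity)).symm
  simp_rw [e]
  have hInt := integrableOn_Ioi_deriv_of_nonneg' hd hpos hlim
  rw [← ofReal_integral_eq_lintegral_ofReal hInt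
    ((ae_restrict_iff' measurableSet_Ioi).2 (ae_of_all _ hpos)),
    integral_Ioi_of_hasDerivAt_of_nonneg' hd hpos hlim]
  congr 1
  simp only [G, hv]
  rw [mul_zero, neg_zero, Real.exp_zero]
  field_simp
  ring

/-- Expanding `0 ≤ l / 2 * (s - 2 * l⁻¹) ^ 2` bounds `s` by a constant and the squared deviation
from `l⁻¹`, so the variance formula suffices. The factor two is not sharp and is harmless. -/
lemma lintegral_holdLaw_id_le {l : ℝ} (hl : 0 < l) :
    ∫⁻ s, ENNReal.ofReal s.toReal ∂holdLaw l ≤ ENNReal.ofReal (2 * l⁻¹) := by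
  have hH := isProbabilityMeasure_holdLaw hl.le
  have hli : 0 < l⁻¹ := inv_pos.2 hl
  have h1 : ∀ s : ℝ≥0∞, ENNReal.ofReal s.toReal ≤
      ENNReal.ofReal (3 / 2 * l⁻¹) + ENNReal.ofReal (l / 2) *
        ENNReal.ofReal ((0 + s.toReal - l⁻¹) ^ 2) := by
    intro s
    rw [← ENNReal.ofReal_mul (by positivity), ← ENNReal.ofReal_add (by positivity) (by positivity)]
    refine ENNReal.ofReal_le_ofReal ?_
    have : 0 ≤ l / 2 * (s.toReal - l⁻¹ - l⁻¹) ^ 2 := by positivity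
    have e : l * l⁻¹ = 1 := mul_inv_cancel₀ hl.ne'
    have e2 : l / 2 * (s.toReal - l⁻¹ - l⁻¹) ^ 2 = l / 2 * (0 + s.toReal - l⁻¹) ^ 2
      - (l * l⁻¹) * (s.toReal - l⁻¹) + (l * l⁻¹) * l⁻¹ / 2 := by ring
    rw [e2, e] at this
    linarith
  refine (lintegral_mono h1).trans ?_
  rw [lintegral_add_left measurable_const, lintegral_const, measure_univ, mul_one,
    lintegral_const_mul _ (by fun_prop), lintegral_holdLaw_sq hl,
    ← ENNReal.ofReal_mul (by positivity), ← ENNReal.ofReal_add (by positivity) (by positivity)]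
  refine ENNReal.ofReal_le_ofReal (le_of_eq ?_)
  field_simp
  ring

/-- The backward equation solved by `V * exp (-c r) + k * (1 - exp (-c r))`. -/
lemma lintegral_holdLaw_renewal {l c v k r : ℝ} (hl : 0 < l) (hcl : c < l)
    (hc : 0 < c) (hv : 0 ≤ v) (hk : 0 ≤ k) (hr : 0 ≤ r) :
    ∫⁻ s, (if s.toReal ≤ r then ENNReal.ofReal
        (Real.exp (-(c * (r - s.toReal))) * (v * (l - c) / l + k * c / l) +
          k * (1 - Real.exp (-(c * (r - s.toReal))))) else ENNReal.ofReal v) ∂holdLaw l =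
      ENNReal.ofReal (Real.exp (-(c * r)) * v + k * (1 - Real.exp (-(c * r)))) := by
  -- With `v` the value of a Lyapunov function and `k = K / c`, `W` is the bound that the drift
  -- inequality gives for its mean after one jump.
  set W := v * (l - c) / l + k * c / l with hW
  have hW0 : 0 ≤ W := add_nonneg (div_nonneg (mul_nonneg hv (by linarith)) hl.le)
    (div_nonneg (mul_nonneg hk hc.le) hl.le)
  set H : ℝ → ℝ := fun s => Real.exp (-(c * (r - s))) * W + k * (1 - Real.exp (-(c * (r - s))))
    with hH
  have hHc : Continuous H := by fun_prop
  have hH0 : ∀ s ≤ r, 0 ≤ H s := by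
    intro s hs
    have : Real.exp (-(c * (r - s))) ≤ 1 :=
      Real.exp_le_one_iff.2 (neg_nonpos.2 (mul_nonneg hc.le (by linarith)))
    exact add_nonneg (mul_nonneg (Real.exp_pos _).le hW0) (mul_nonneg hk (by linarith))
  rw [lintegral_holdLaw (g := fun s => if s ≤ r then ENNReal.ofReal (H s) else ENNReal.ofReal v) hl
    (Measurable.ite measurableSet_Iic (by fun_prop) measurable_const),
    ← Set.Ioc_union_Ioi_eq_Ioi hr, lintegral_union measurableSet_Ioi
    (Set.Ioc_disjoint_Ioi le_rfl)]
  -- The part where the jump occurs before the remaining time `r` runs out; `e2` is the part without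
  -- a jump.
  have e1 : ∫⁻ s in Set.Ioc 0 r, ENNReal.ofReal (l * Real.exp (-(l * s))) *
      (if s ≤ r then ENNReal.ofReal (H s) else ENNReal.ofReal v) =
      ENNReal.ofReal (Real.exp (-(c * r)) * (v - k) + k -
        (Real.exp (-(c * r)) * (v - k) * Real.exp (-((l - c) * r)) + k * Real.exp (-(l * r)))) := by
    rw [setLIntegral_congr_fun (g := fun s => ENNReal.ofReal (l * Real.exp (-(l * s)) * H s))
      measurableSet_Ioc (fun s hs => by
        simp only [if_pos hs.2]; rw [← ENNReal.ofReal_mul (by positivity)])]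
    have hcont : Continuous fun s => l * Real.exp (-(l * s)) * H s := by fun_prop
    rw [← ofReal_integral_eq_lintegral_ofReal
      (hcont.integrableOn_Icc.mono_set Set.Ioc_subset_Icc_self)
      ((ae_restrict_iff' measurableSet_Ioc).2 (ae_of_all _ fun s hs =>
        mul_nonneg (by positivity) (hH0 s hs.2))), ← intervalIntegral.integral_of_le hr]
    congr 1
    set G : ℝ → ℝ := fun s => -(Real.exp (-(c * r)) * (v - k) * Real.exp (-((l - c) * s)) +
      k * Real.exp (-(l * s))) with hG
    have hd : ∀ s ∈ Set.uIcc 0 r, HasDerivAt G (l * Real.exp (-(l * s)) * H s) s := by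
      intro s _
      have h1 : ∀ q : ℝ, HasDerivAt (fun s : ℝ => Real.exp (-(q * s)))
          (Real.exp (-(q * s)) * (-(q * 1))) s :=
        fun q => (((hasDerivAt_id s).const_mul q).neg).exp
      have h3 := (((h1 (l - c)).const_mul (Real.exp (-(c * r)) * (v - k))).add
        ((h1 l).const_mul k)).neg
      refine HasDerivAt.congr_deriv (f := G) h3 ?_
      have x1 : Real.exp (-(c * r)) * Real.exp (-((l - c) * s)) =
          Real.exp (-(l * s)) * Real.exp (-(c * (r - s))) := by
        rw [← Real.exp_add, ← Real.exp_add]; ring_nf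
      have x2 : Real.exp (-(c * r)) * (v - k) * (Real.exp (-((l - c) * s)) * (-((l - c) * 1))) =
          -((Real.exp (-(l * s)) * Real.exp (-(c * (r - s)))) * ((v - k) * (l - c))) := by
        rw [← x1]; ring
      rw [x2]
      simp only [hH, hW]
      field_simp
      ring
    rw [intervalIntegral.integral_eq_sub_of_hasDerivAt hd (hcont.intervalIntegrable _ _)]
    simp only [hG, mul_zero, neg_zero, Real.exp_zero]
    ring
  have e2 : ∫⁻ s in Set.Ioi r, ENNReal.ofReal (l * Real.exp (-(l * s))) *
      (if s ≤ r then ENNReal.ofReal (H s) else ENNReal.ofReal v) =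
      ENNReal.ofReal (Real.exp (-(l * r)) * v) := by
    rw [setLIntegral_congr_fun
      (g := fun s => ENNReal.ofReal (l * Real.exp (-(l * s))) * ENNReal.ofReal v)
      measurableSet_Ioi (fun s hs => by simp only [if_neg (not_le.2 (Set.mem_Ioi.1 hs))]),
      lintegral_mul_const _ (by fun_prop)]
    have hd : ∀ s ∈ Set.Ici r, HasDerivAt (fun s => -Real.exp (-(l * s)))
        (l * Real.exp (-(l * s))) s := by
      intro s _
      have h1 : HasDerivAt (fun s : ℝ => Real.exp (-(l * s))) (Real.exp (-(l * s)) * (-(l * 1))) s :=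
        (((hasDerivAt_id s).const_mul l).neg).exp
      exact h1.neg.congr_deriv (by ring)
    have hpos : ∀ s ∈ Set.Ioi r, 0 ≤ l * Real.exp (-(l * s)) := fun s _ => by positivity
    have hlim : Tendsto (fun s => -Real.exp (-(l * s))) atTop (𝓝 0) := by
      have := (tendsto_pow_mul_exp_neg_mul hl 0).neg
      simpa using this
    have hInt := integrableOn_Ioi_deriv_of_nonneg' hd hpos hlim
    rw [← ofReal_integral_eq_lintegral_ofReal hInt
      ((ae_restrict_iff' measurableSet_Ioi).2 (ae_of_all _ hpos)),
      integral_Ioi_of_hasDerivAt_of_nonneg' hd hpos hlim, zero_sub, neg_neg,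
      ENNReal.ofReal_mul (Real.exp_pos _).le]
  have x1 : Real.exp (-(c * r)) * (v - k) * Real.exp (-((l - c) * r)) =
      (v - k) * Real.exp (-(l * r)) := by
    rw [mul_right_comm, ← Real.exp_add, mul_comm]; ring_nf
  have hle : Real.exp (-(l * r)) ≤ Real.exp (-(c * r)) :=
    Real.exp_le_exp.2 (neg_le_neg (mul_le_mul_of_nonneg_right hcl.le hr))
  have hle1 : Real.exp (-(c * r)) ≤ 1 := Real.exp_le_one_iff.2 (neg_nonpos.2 (mul_nonneg hc.le hr))
  rw [e1, e2, x1, ← ENNReal.ofReal_add _ (by positivity)]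
  · congr 1; ring
  · have := mul_nonneg (sub_nonneg.2 hle) hv
    have := mul_nonneg (sub_nonneg.2 hle1) hk
    linarith

end Exponential

/-! ### Almost sure limits from moment bounds. -/

section Limits

/-- The sum of the means is finite, so the series converges almost surely and its terms vanish in
the limit. No independence is needed. -/
lemma ae_tendsto_zero_of_summable {Ω : Type*} [MeasurableSpace Ω] {P : Measure Ω}
    {f : ℕ → Ω → ℝ} (hf : ∀ k, Measurable (f k)) (hf0 : ∀ᵐ ω ∂P, ∀ k, 0 ≤ f k ω) {c : ℕ → ℝ}
    (hc : ∀ k, 0 ≤ c k) (hs : Summable c)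
    (hfc : ∀ k, ∫⁻ ω, ENNReal.ofReal (f k ω) ∂P ≤ ENNReal.ofReal (c k)) :
    ∀ᵐ ω ∂P, Tendsto (fun k => f k ω) atTop (𝓝 0) := by
  have h1 : ∫⁻ ω, ∑' k, ENNReal.ofReal (f k ω) ∂P ≠ ∞ := by
    rw [lintegral_tsum fun k => (hf k).ennreal_ofReal.aemeasurable]
    refine ne_top_of_le_ne_top ?_ (ENNReal.tsum_le_tsum hfc)
    rw [← ENNReal.ofReal_tsum_of_nonneg hc hs]
    exact ENNReal.ofReal_ne_top
  filter_upwards [ae_lt_top' (AEMeasurable.tsum fun k =>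
    (hf k).ennreal_ofReal.aemeasurable) h1, hf0] with ω hω hω0
  have h2 := ENNReal.tendsto_atTop_zero_of_tsum_ne_top hω.ne
  have h3 := (ENNReal.tendsto_toReal ENNReal.zero_ne_top).comp h2
  simpa [Function.comp_def, ENNReal.toReal_ofReal (hω0 _)] using h3

lemma tendsto_two_mul_add_one_div : Tendsto (fun k : ℕ => (2 * (k : ℝ) + 1) / ((k : ℝ) ^ 2 + 1))
    atTop (𝓝 0) := by
  have h := tendsto_one_div_add_atTop_nhds_zero_nat (𝕜 := ℝ)
  have h' := h.const_mul 4
  rw [mul_zero] at h'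
  refine squeeze_zero (fun k => by positivity) (fun k => ?_) h'
  have hk : (0 : ℝ) ≤ k := Nat.cast_nonneg k
  rw [mul_one_div, div_le_div_iff₀ (by positivity) (by positivity)]
  nlinarith [sq_nonneg ((k : ℝ) - 1)]

/-- A sequence whose decrements are bounded is `o(n)` as soon as this holds along squares. -/
lemma tendsto_div_of_tendsto_sq {z : ℕ → ℝ} {B : ℝ} (hB : 0 ≤ B) (hz : ∀ n, z n - B ≤ z (n + 1))
    (h : Tendsto (fun k : ℕ => z (k ^ 2) ^ 2 / ((k : ℝ) + 1) ^ 4) atTop (𝓝 0)) :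
    Tendsto (fun n : ℕ => z n / ((n : ℝ) + 1)) atTop (𝓝 0) := by
  have hz' : ∀ n j, z n - B * j ≤ z (n + j) := by
    intro n j
    induction j with
    | zero => simp
    | succ j ih =>
      have := hz (n + j)
      rw [← add_assoc]
      push_cast
      linarith
  have h1 : Tendsto (fun k : ℕ => |z (k ^ 2)| / ((k : ℝ) + 1) ^ 2) atTop (𝓝 0) := by
    have := (Real.continuous_sqrt.tendsto 0).comp h
    rw [Real.sqrt_zero] at this
    refine this.congr fun k => ?_
    simp only [Function.comp_apply]
    rw [Real.sqrt_div (sq_nonneg _), Real.sqrt_sq_eq_abs,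
      show ((k : ℝ) + 1) ^ 4 = (((k : ℝ) + 1) ^ 2) ^ 2 by ring, Real.sqrt_sq (by positivity)]
  have h2 : Tendsto (fun k : ℕ => 5 * (|z (k ^ 2)| / ((k : ℝ) + 1) ^ 2) +
      5 * (|z ((k + 1) ^ 2)| / (((k + 1 : ℕ) : ℝ) + 1) ^ 2) +
      B * ((2 * (k : ℝ) + 1) / ((k : ℝ) ^ 2 + 1))) atTop (𝓝 0) := by
    have := ((h1.const_mul 5).add ((h1.comp (tendsto_add_atTop_nat 1)).const_mul 5)).add
      (tendsto_two_mul_add_one_div.const_mul B)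
    simpa using this
  have hsqrt : Tendsto Nat.sqrt atTop atTop :=
    tendsto_atTop_atTop.2 fun k => ⟨k ^ 2, fun n hn => Nat.le_sqrt'.2 hn⟩
  -- With `k = √n` rounded down, `n` lies between two consecutive squares. A one-sided bound
  -- suffices: from `k ^ 2` forwards it bounds `z n` below, and from `n` to `(k + 1) ^ 2` it bounds
  -- `z n` above.
  refine squeeze_zero_norm (fun n => ?_) (h2.comp hsqrt)
  simp only [Function.comp_apply]
  set k := Nat.sqrt n with hk
  have hk1 : k ^ 2 ≤ n := Nat.sqrt_le' n
  have hk2 : n < (k + 1) ^ 2 := Nat.lt_succ_sqrt' n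
  obtain ⟨j, hj⟩ := Nat.exists_eq_add_of_le hk1
  obtain ⟨i, hi⟩ := Nat.exists_eq_add_of_le hk2.le
  have l1 := hz' (k ^ 2) j
  have l2 := hz' n i
  rw [← hj] at l1
  rw [← hi] at l2
  have hj' : j ≤ 2 * k + 1 := by
    have : (k + 1) ^ 2 = k ^ 2 + (2 * k + 1) := by ring
    omega
  have hi' : i ≤ 2 * k + 1 := by
    have : (k + 1) ^ 2 = k ^ 2 + (2 * k + 1) := by ring
    omega
  have hj2 : B * j ≤ B * (2 * k + 1) := mul_le_mul_of_nonneg_left (by exact_mod_cast hj') hB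
  have hi2 : B * i ≤ B * (2 * k + 1) := mul_le_mul_of_nonneg_left (by exact_mod_cast hi') hB
  have hk0 : (0 : ℝ) ≤ k := Nat.cast_nonneg k
  have habs : |z n| ≤ |z (k ^ 2)| + |z ((k + 1) ^ 2)| + B * (2 * k + 1) := by
    have a1 := neg_abs_le (z (k ^ 2))
    have a2 := le_abs_self (z ((k + 1) ^ 2))
    have a3 := abs_nonneg (z (k ^ 2))
    have a4 := abs_nonneg (z ((k + 1) ^ 2))
    rw [abs_le]
    constructor <;> linarith
  have hn : (k : ℝ) ^ 2 + 1 ≤ (n : ℝ) + 1 := by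
    have : ((k ^ 2 : ℕ) : ℝ) ≤ n := by exact_mod_cast hk1
    push_cast at this
    linarith
  rw [Real.norm_eq_abs, abs_div, abs_of_pos (show (0 : ℝ) < (n : ℝ) + 1 by positivity)]
  have b1 : |z (k ^ 2)| / ((k : ℝ) ^ 2 + 1) ≤ 5 * (|z (k ^ 2)| / ((k : ℝ) + 1) ^ 2) := by
    rw [← mul_div_assoc, div_le_div_iff₀ (by positivity) (by positivity)]
    nlinarith [abs_nonneg (z (k ^ 2)), sq_nonneg ((k : ℝ) - 1),
      mul_nonneg (abs_nonneg (z (k ^ 2))) (sq_nonneg ((k : ℝ) - 1)),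
      mul_nonneg (abs_nonneg (z (k ^ 2))) (sq_nonneg (k : ℝ))]
  -- The constant `5` works because `(k + 2) ^ 2 ≤ 5 * (k ^ 2 + 1)` amounts to `(2 * k - 1) ^ 2 ≥
  -- 0`.
  have b2 : |z ((k + 1) ^ 2)| / ((k : ℝ) ^ 2 + 1) ≤
      5 * (|z ((k + 1) ^ 2)| / (((k + 1 : ℕ) : ℝ) + 1) ^ 2) := by
    push_cast
    rw [← mul_div_assoc, div_le_div_iff₀ (by positivity) (by positivity)]
    nlinarith [abs_nonneg (z ((k + 1) ^ 2)),
      mul_nonneg (abs_nonneg (z ((k + 1) ^ 2))) (sq_nonneg (2 * (k : ℝ) - 1))]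
  calc |z n| / ((n : ℝ) + 1) ≤ |z n| / ((k : ℝ) ^ 2 + 1) :=
        div_le_div_of_nonneg_left (abs_nonneg _) (by positivity) hn
    _ ≤ (|z (k ^ 2)| + |z ((k + 1) ^ 2)| + B * (2 * k + 1)) / ((k : ℝ) ^ 2 + 1) :=
        div_le_div_of_nonneg_right habs (by positivity)
    _ = |z (k ^ 2)| / ((k : ℝ) ^ 2 + 1) + |z ((k + 1) ^ 2)| / ((k : ℝ) ^ 2 + 1) +
        B * ((2 * (k : ℝ) + 1) / ((k : ℝ) ^ 2 + 1)) := by ring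
    _ ≤ _ := by linarith

lemma summable_one_div_add_one_sq : Summable fun k : ℕ => 1 / ((k : ℝ) + 1) ^ 2 := by
  have := (summable_nat_add_iff 1).2 (Real.summable_one_div_nat_pow.2 (one_lt_two))
  simpa using this

/-- A strong law of large numbers: second moments growing linearly and decrements bounded below
give `z n = o(n)` almost surely. -/
lemma ae_tendsto_div_of_sq_le {Ω : Type*} [MeasurableSpace Ω] {P : Measure Ω}
    {z : ℕ → Ω → ℝ} (hz : ∀ n, Measurable (z n)) {B C : ℝ} (hB : 0 ≤ B) (hC : 0 ≤ C)
    (hdec : ∀ᵐ ω ∂P, ∀ n, z n ω - B ≤ z (n + 1) ω)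
    (hsq : ∀ n : ℕ, ∫⁻ ω, ENNReal.ofReal (z n ω ^ 2) ∂P ≤ ENNReal.ofReal (C * (n + 1))) :
    ∀ᵐ ω ∂P, Tendsto (fun n : ℕ => z n ω / ((n : ℝ) + 1)) atTop (𝓝 0) := by
  -- Along squares the normalised second moments are at most `C / (k + 1) ^ 2`, which is summable.
  have key := ae_tendsto_zero_of_summable (P := P)
    (f := fun k ω => z (k ^ 2) ω ^ 2 / ((k : ℝ) + 1) ^ 4)
    (fun k => ((hz _).pow_const 2).div_const _) (ae_of_all _ fun ω k => by positivity)
    (c := fun k => C * (1 / ((k : ℝ) + 1) ^ 2)) (fun k => by positivity)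
    (summable_one_div_add_one_sq.mul_left C) ?_
  · filter_upwards [key, hdec] with ω h1 h2
    exact tendsto_div_of_tendsto_sq hB h2 h1
  · intro k
    have e : ∀ ω, ENNReal.ofReal (z (k ^ 2) ω ^ 2 / ((k : ℝ) + 1) ^ 4) =
        ENNReal.ofReal (z (k ^ 2) ω ^ 2) * ENNReal.ofReal ((((k : ℝ) + 1) ^ 4)⁻¹) := fun ω => by
      rw [div_eq_mul_inv, ENNReal.ofReal_mul (sq_nonneg _)]
    simp_rw [e]
    rw [lintegral_mul_const _ ((hz _).pow_const 2).ennreal_ofReal]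
    refine (mul_le_mul_left (hsq (k ^ 2)) _).trans ?_
    rw [← ENNReal.ofReal_mul (by positivity)]
    refine ENNReal.ofReal_le_ofReal ?_
    rw [mul_assoc]
    refine mul_le_mul_of_nonneg_left ?_ hC
    push_cast
    rw [← div_eq_mul_inv, div_le_div_iff₀ (by positivity) (by positivity)]
    have hk0 : (0 : ℝ) ≤ k := Nat.cast_nonneg k
    have : (k : ℝ) ^ 2 + 1 ≤ ((k : ℝ) + 1) ^ 2 := by nlinarith
    calc ((k : ℝ) ^ 2 + 1) * ((k : ℝ) + 1) ^ 2 ≤ ((k : ℝ) + 1) ^ 2 * ((k : ℝ) + 1) ^ 2 :=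
          mul_le_mul_of_nonneg_right this (by positivity)
      _ = 1 * ((k : ℝ) + 1) ^ 4 := by ring

/-- Inversion of an increasing sequence of times. -/
lemma exists_index {T : ℕ → ℝ} (h0 : T 0 = 0) (hT : Tendsto T atTop atTop) (hmono : Monotone T) :
    ∃ n : ℝ → ℕ, (∀ t, 0 ≤ t → T (n t) ≤ t ∧ t < T (n t + 1)) ∧ Tendsto n atTop atTop := by
  have h : ∀ t : ℝ, ∃ n, 0 ≤ t → T n ≤ t ∧ t < T (n + 1) := by
    intro t
    by_cases ht : 0 ≤ t
    · obtain ⟨N, hN⟩ := (hT.eventually_gt_atTop t).exists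
      have hex : ∃ n, t < T n := ⟨N, hN⟩
      classical
      have hf := Nat.find_spec hex
      have hpos : Nat.find hex ≠ 0 := by
        intro h
        rw [h, h0] at hf
        linarith
      obtain ⟨k, hk⟩ := Nat.exists_eq_succ_of_ne_zero hpos
      refine ⟨k, fun _ => ⟨?_, ?_⟩⟩
      · have := Nat.find_min hex (m := k) (by omega)
        exact not_lt.1 this
      · rw [hk] at hf; exact hf
    · exact ⟨0, fun h => absurd h ht⟩
  choose n hn using h
  refine ⟨n, hn, tendsto_atTop_atTop.2 fun K => ⟨max 0 (T K), fun t ht => ?_⟩⟩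
  by_contra! hlt
  have h1 := (hn t ((le_max_left _ _).trans ht)).2
  have h2 := hmono (show n t + 1 ≤ K by omega)
  have h3 := (le_max_right 0 (T K)).trans ht
  linarith

end Limits

/-! ### Jump times, the clock, and the passage to continuous time. -/

section Times

open ProbabilityTheory

variable {N : ℕ} {m a b : Fin N → ℝ}

/-- The jump times. -/
def jumpTime {Ω : Type*} (S : ℕ → Ω → ℝ≥0∞) (n : ℕ) (ω : Ω) : ℝ :=
  ∑ k ∈ Finset.range n, (S k ω).toReal

lemma jumpTime_succ {Ω : Type*} (S : ℕ → Ω → ℝ≥0∞) (n : ℕ) (ω : Ω) :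
    jumpTime S (n + 1) ω = jumpTime S n ω + (S n ω).toReal := Finset.sum_range_succ _ _

lemma clock_succ {Ω : Type*} (Y : ℕ → Ω → Fin N → ℤ) (n : ℕ) (ω : Ω) :
    clock m a b Y (n + 1) ω = clock m a b Y n ω + (totalRate m a b (Y n ω))⁻¹ :=
  Finset.sum_range_succ _ _

lemma measurable_jumpTime {Ω : Type*} {mΩ : MeasurableSpace Ω} {S : ℕ → Ω → ℝ≥0∞} {n : ℕ}
    (hS : ∀ k < n, Measurable (S k)) : Measurable (jumpTime S n) :=
  Finset.measurable_fun_sum _ fun k hk => (hS k (Finset.mem_range.1 hk)).ennreal_toReal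

lemma monotone_jumpTime {Ω : Type*} (S : ℕ → Ω → ℝ≥0∞) (ω : Ω) :
    Monotone fun n => jumpTime S n ω :=
  monotone_nat_of_le_succ fun n => by
    rw [jumpTime_succ]; linarith [ENNReal.toReal_nonneg (a := S n ω)]

variable {Ω : Type*} [MeasurableSpace Ω] {P : Measure Ω} {x₀ : Fin N → ℤ}
  {Y : ℕ → Ω → Fin N → ℤ} {S : ℕ → Ω → ℝ≥0∞} [IsProbabilityMeasure P]

/-- The difference of jump time and clock is a martingale: given the history, each step adds exactly
the variance of one holding time, at most `(rateMin m a b)⁻¹ ^ 2`. -/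
lemma IsJumpChain.lintegral_time_sq_le (h : IsJumpChain P m a b x₀ Y S) (hx₀ : Monotone x₀)
    (hrate : 0 < rateMin m a b) (n : ℕ) :
    ∫⁻ ω, ENNReal.ofReal ((jumpTime S n ω - clock m a b Y n ω) ^ 2) ∂P ≤
      ENNReal.ofReal ((rateMin m a b)⁻¹ ^ 2 * n) := by
  induction n with
  | zero => simp [jumpTime, clock]
  | succ n ih =>
    have hri : 0 < (rateMin m a b)⁻¹ := inv_pos.2 hrate
    have hZ : Measurable[jumpHistory Y S n] fun ω => jumpTime S n ω - clock m a b Y n ω :=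
      Measurable.sub (measurable_jumpTime (mΩ := jumpHistory Y S n)
          fun k hk => measurable_jumpHistory_S Y S hk)
        (measurable_clock (mΩ := jumpHistory Y S n)
          fun k hk => measurable_jumpHistory_Y Y S hk.le)
    have hR : Measurable fun x : Fin N → ℤ => (totalRate m a b x)⁻¹ := measurable_of_countable _
    have hg : Measurable fun p : ((Fin N → ℤ) × ℝ) × ((Fin N → ℤ) × ℝ≥0∞) =>
        ENNReal.ofReal ((p.1.2 + p.2.2.toReal - (totalRate m a b p.1.1)⁻¹) ^ 2) := by
      refine Measurable.ennreal_ofReal (Measurable.pow_const ?_ 2)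
      exact Measurable.sub (by fun_prop) (hR.comp (measurable_fst.comp measurable_fst))
    have key := h.lintegral_step n hZ hg
    have e : ∀ ω, jumpTime S (n + 1) ω - clock m a b Y (n + 1) ω =
        jumpTime S n ω - clock m a b Y n ω + (S n ω).toReal - (totalRate m a b (Y n ω))⁻¹ := by
      intro ω
      rw [jumpTime_succ, clock_succ]
      ring
    simp_rw [e]
    refine (le_of_eq key).trans ?_
    calc _ ≤ ∫⁻ ω, (ENNReal.ofReal ((jumpTime S n ω - clock m a b Y n ω) ^ 2) +
          ENNReal.ofReal ((rateMin m a b)⁻¹ ^ 2)) ∂P := by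
            refine lintegral_mono_ae ?_
            filter_upwards [h.ae_monotone hx₀ hrate] with ω hω
            have hlm := rateMin_le h.mass_pos h.left_nonneg h.right_nonneg (hω n)
            have hl := hrate.trans_le hlm
            have i1 := isProbabilityMeasure_jumpLaw h.mass_pos h.left_nonneg h.right_nonneg (Y n ω)
            have i2 := isProbabilityMeasure_holdLaw hl.le
            rw [stepKernel_apply]
            rw [(measurePreserving_snd (μ := jumpLaw m a b (Y n ω))
              (ν := holdLaw (totalRate m a b (Y n ω)))).lintegral_comp
              (f := fun s => ENNReal.ofReal ((jumpTime S n ω - clock m a b Y n ω + s.toReal -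
                (totalRate m a b (Y n ω))⁻¹) ^ 2)) (by fun_prop), lintegral_holdLaw_sq hl,
                ENNReal.ofReal_add (sq_nonneg _) (sq_nonneg _)]
            refine add_le_add le_rfl (ENNReal.ofReal_le_ofReal ?_)
            exact pow_le_pow_left₀ (inv_nonneg.2 hl.le) (inv_anti₀ hrate hlm) 2
      _ ≤ ENNReal.ofReal ((rateMin m a b)⁻¹ ^ 2 * n) + ENNReal.ofReal ((rateMin m a b)⁻¹ ^ 2) := by
            rw [lintegral_add_right _ measurable_const, lintegral_const, measure_univ, mul_one]
            exact add_le_add ih le_rfl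
      _ = _ := by
            rw [← ENNReal.ofReal_add (by positivity) (by positivity)]
            congr 1
            push_cast
            ring

/-- Holding times are unbounded above, but the difference can decrease only by a mean holding time
per step; hence the one-sided hypothesis in `ae_tendsto_div_of_sq_le`. -/
lemma IsJumpChain.ae_tendsto_time (h : IsJumpChain P m a b x₀ Y S) (hx₀ : Monotone x₀)
    (hrate : 0 < rateMin m a b) :
    ∀ᵐ ω ∂P, Tendsto (fun n : ℕ => (jumpTime S n ω - clock m a b Y n ω) / ((n : ℝ) + 1))
      atTop (𝓝 0) := by
  have hri : 0 < (rateMin m a b)⁻¹ := inv_pos.2 hrate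
  refine ae_tendsto_div_of_sq_le (B := (rateMin m a b)⁻¹) (C := (rateMin m a b)⁻¹ ^ 2)
    (fun n => (measurable_jumpTime fun k _ => h.meas_S k).sub
      (measurable_clock fun k _ => h.meas_Y k)) hri.le (by positivity) ?_ ?_
  · filter_upwards [h.ae_monotone hx₀ hrate] with ω hω n
    have := inv_anti₀ hrate (rateMin_le h.mass_pos h.left_nonneg h.right_nonneg (hω n))
    have := ENNReal.toReal_nonneg (a := S n ω)
    rw [jumpTime_succ, clock_succ]
    linarith
  · intro n
    refine (h.lintegral_time_sq_le hx₀ hrate n).trans (ENNReal.ofReal_le_ofReal ?_)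
    exact mul_le_mul_of_nonneg_left (by linarith) (by positivity)

lemma rateMax_pos (hm : ∀ i, 0 < m i) (ha : ∀ i, 0 ≤ a i) (hb : ∀ i, 0 ≤ b i)
    (hrate : 0 < rateMin m a b) : 0 < rateMax m a b := by
  have hx0 : Monotone (fun _ : Fin N => (0 : ℤ)) := monotone_const
  exact hrate.trans_le ((rateMin_le hm ha hb hx0).trans (le_rateMax hm ha hb hx0))

/-- The jump times grow at least linearly. -/
lemma IsJumpChain.ae_eventually_le_jumpTime (h : IsJumpChain P m a b x₀ Y S) (hx₀ : Monotone x₀)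
    (hrate : 0 < rateMin m a b) :
    ∀ᵐ ω ∂P, ∀ᶠ n : ℕ in atTop, ((n : ℝ) + 1) / (4 * rateMax m a b) ≤ jumpTime S n ω := by
  have hΛ := rateMax_pos h.mass_pos h.left_nonneg h.right_nonneg hrate
  filter_upwards [h.ae_monotone hx₀ hrate, h.ae_tendsto_time hx₀ hrate] with ω hω h1
  have hclock : ∀ n : ℕ, (n : ℝ) / rateMax m a b ≤ clock m a b Y n ω := by
    intro n
    induction n with
    | zero => simp [clock]
    | succ n ih =>
      have hl := hrate.trans_le (rateMin_le h.mass_pos h.left_nonneg h.right_nonneg (hω n))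
      have := inv_anti₀ hl (le_rateMax h.mass_pos h.left_nonneg h.right_nonneg (hω n))
      rw [clock_succ]
      push_cast
      rw [add_div, one_div]
      linarith
  -- The clock is at least `n / rateMax`. For `n ≥ 1`, subtracting an error of `(n + 1) / (4 *
  -- rateMax)` still leaves that same quantity.
  have hε : -(1 / (4 * rateMax m a b)) < 0 := neg_lt_zero.2 (by positivity)
  filter_upwards [h1.eventually (lt_mem_nhds hε), eventually_ge_atTop 1] with n hn hn1
  have hn1' : (1 : ℝ) ≤ n := by exact_mod_cast hn1
  rw [lt_div_iff₀ (by positivity)] at hn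
  have h2 := hclock n
  have h3 : ((n : ℝ) + 1) / (4 * rateMax m a b) ≤ n / rateMax m a b -
      1 / (4 * rateMax m a b) * (n + 1) := by
    rw [div_le_iff₀ (by positivity)]
    field_simp
    linarith
  linarith

lemma IsJumpChain.ae_tendsto_jumpTime_atTop (h : IsJumpChain P m a b x₀ Y S) (hx₀ : Monotone x₀)
    (hrate : 0 < rateMin m a b) : ∀ᵐ ω ∂P, Tendsto (fun n => jumpTime S n ω) atTop atTop := by
  have hΛ := rateMax_pos h.mass_pos h.left_nonneg h.right_nonneg hrate
  filter_upwards [h.ae_eventually_le_jumpTime hx₀ hrate] with ω hω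
  refine tendsto_atTop_mono' _ hω ?_
  exact (tendsto_atTop_add_const_right _ 1 tendsto_natCast_atTop_atTop).atTop_div_const
    (by positivity)

/-- `X` follows the jump chain `Y` with holding times `S`. -/
def Follows {Ω : Type*} [MeasurableSpace Ω] (P : Measure Ω) (Y : ℕ → Ω → Fin N → ℤ)
    (S : ℕ → Ω → ℝ≥0∞) (X : ℝ → Ω → Fin N → ℤ) : Prop :=
  ∀ᵐ ω ∂P, ∀ (t : ℝ) (n : ℕ), 0 ≤ t →
      ∑ k ∈ Finset.range n, S k ω ≤ ENNReal.ofReal t →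
      ENNReal.ofReal t < ∑ k ∈ Finset.range (n + 1), S k ω → X t ω = Y n ω

lemma IsJumpChain.ae_follows (h : IsJumpChain P m a b x₀ Y S) (hx₀ : Monotone x₀)
    (hrate : 0 < rateMin m a b) {X : ℝ → Ω → Fin N → ℤ} (hX : Follows P Y S X) :
    ∀ᵐ ω ∂P, ∀ (t : ℝ) (n : ℕ), jumpTime S n ω ≤ t → t < jumpTime S (n + 1) ω →
      X t ω = Y n ω := by
  filter_upwards [hX, h.ae_jump hx₀ hrate] with ω h1 h2 t n h3 h4
  have e : ∀ n, ∑ k ∈ Finset.range n, S k ω = ENNReal.ofReal (jumpTime S n ω) := by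
    intro n
    rw [jumpTime, ENNReal.ofReal_sum_of_nonneg fun k _ => ENNReal.toReal_nonneg]
    exact Finset.sum_congr rfl fun k _ => (ENNReal.ofReal_toReal (h2 k).1.ne).symm
  have h0 : 0 ≤ jumpTime S n ω := Finset.sum_nonneg fun k _ => ENNReal.toReal_nonneg
  have ht : 0 ≤ t := h0.trans h3
  refine h1 t n ht ?_ ?_
  · rw [e]; exact ENNReal.ofReal_le_ofReal h3
  · rw [e]; exact (ENNReal.ofReal_lt_ofReal_iff (by linarith)).2 h4

lemma IsJumpChain.ae_exists_index (h : IsJumpChain P m a b x₀ Y S) (hx₀ : Monotone x₀)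
    (hrate : 0 < rateMin m a b) {X : ℝ → Ω → Fin N → ℤ} (hX : Follows P Y S X) :
    ∀ᵐ ω ∂P, ∃ n : ℝ → ℕ, (∀ t, 0 ≤ t → jumpTime S (n t) ω ≤ t ∧ t < jumpTime S (n t + 1) ω ∧
      X t ω = Y (n t) ω) ∧ Tendsto n atTop atTop := by
  filter_upwards [h.ae_follows hx₀ hrate hX, h.ae_tendsto_jumpTime_atTop hx₀ hrate] with ω h1 h2
  obtain ⟨n, hn, hn'⟩ := exists_index (T := fun n => jumpTime S n ω) (by simp [jumpTime]) h2
    (monotone_jumpTime S ω)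
  exact ⟨n, fun t ht => ⟨(hn t ht).1, (hn t ht).2, h1 t _ (hn t ht).1 (hn t ht).2⟩, hn'⟩

end Times

/-! ### Spread and gap in ordered configurations. -/

section Shape

variable {N : ℕ} {lo hi : ℕ}

lemma isGreatest_block (hlt : lo < hi) (hle : hi ≤ N) {x : Fin N → ℤ} (hx : Monotone x) :
    IsGreatest (x '' (block N lo hi : Set (Fin N))) (x ⟨hi - 1, by omega⟩) := by
  refine ⟨⟨_, ?_, rfl⟩, ?_⟩
  · rw [Finset.mem_coe, mem_block]; simp only; omega
  · rintro _ ⟨i, h, rfl⟩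
    rw [Finset.mem_coe, mem_block] at h
    exact hx (by rw [Fin.le_def]; simp only; omega)

lemma isLeast_block (hlt : lo < hi) (hle : hi ≤ N) {x : Fin N → ℤ} (hx : Monotone x) :
    IsLeast (x '' (block N lo hi : Set (Fin N))) (x ⟨lo, by omega⟩) := by
  refine ⟨⟨_, ?_, rfl⟩, ?_⟩
  · rw [Finset.mem_coe, mem_block]; simp only; omega
  · rintro _ ⟨i, h, rfl⟩
    rw [Finset.mem_coe, mem_block] at h
    exact hx (by rw [Fin.le_def]; simp only; omega)

lemma spread_block (hlt : lo < hi) (hle : hi ≤ N) {x : Fin N → ℤ} (hx : Monotone x) :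
    (spread (block N lo hi) x : ℝ) = span hlt hle x := by
  rw [spread, (isGreatest_block hlt hle hx).csSup_eq, (isLeast_block hlt hle hx).csInf_eq, span]
  push_cast
  rfl

lemma gap_block {k₀ k₁ k₂ : ℕ} (h₁ : k₀ < k₁) (h₂ : k₁ < k₂) (hN : k₂ ≤ N) {x : Fin N → ℤ}
    (hx : Monotone x) :
    gap (block N k₀ k₁) (block N k₁ k₂) x = x ⟨k₁, by omega⟩ - x ⟨k₁ - 1, by omega⟩ := by
  rw [gap, (isGreatest_block h₁ (by omega) hx).csSup_eq, (isLeast_block h₂ hN hx).csInf_eq]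

end Shape

/-! ### Uniform-in-time bounds from a Lyapunov function. -/

section Lyapunov

open ProbabilityTheory

variable {N : ℕ} {m a b : Fin N → ℝ}

lemma integrable_jumpLaw {x : Fin N → ℤ} (f : (Fin N → ℤ) → ℝ) :
    Integrable f (jumpLaw m a b x) := by
  have hi : ∀ (c : ℝ) (y : Fin N → ℤ), Integrable f (ENNReal.ofReal c • Measure.dirac y) :=
    fun c y => (integrable_dirac (by simp)).smul_measure ENNReal.ofReal_ne_top
  rw [jumpLaw]
  split_ifs
  · exact integrable_dirac (by simp)
  · exact integrable_finsetSum_measure.2 fun i _ => (hi _ _).add_measure (hi _ _)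

variable {Ω : Type*} [MeasurableSpace Ω] {P : Measure Ω} {x₀ : Fin N → ℤ}
  {Y : ℕ → Ω → Fin N → ℤ} {S : ℕ → Ω → ℝ≥0∞} [IsProbabilityMeasure P]

/-- A function with exponential drift towards a compact set is bounded in mean, uniformly in
time. -/
lemma IsJumpChain.lintegral_lyapunov_le (h : IsJumpChain P m a b x₀ Y S) (hx₀ : Monotone x₀)
    {X : ℝ → Ω → Fin N → ℤ} (hX : Follows P Y S X) {V : (Fin N → ℤ) → ℝ} {c K : ℝ} (hc : 0 < c)
    (hcr : c < rateMin m a b) (hK : 0 ≤ K) (hV0 : ∀ x, 0 < V x)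
    (hV : ∀ x, Monotone x → gen m a b V x ≤ -(c * V x) + K) {t : ℝ} (ht : 0 ≤ t) :
    ∫⁻ ω, ENNReal.ofReal (V (X t ω)) ∂P ≤ ENNReal.ofReal (V x₀ + K / c) := by
  have hrate : 0 < rateMin m a b := hc.trans hcr
  set k := K / c with hk
  have hk0 : 0 ≤ k := div_nonneg hK hc.le
  -- `Φ x r` solves the comparison equation `Φ' = -c Φ + K` with initial value `V x`; it bounds the
  -- mean of `V` after a time `r`.
  set Φ : (Fin N → ℤ) → ℝ → ℝ := fun x r =>
    Real.exp (-(c * r)) * V x + k * (1 - Real.exp (-(c * r))) with hΦ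
  have hΦm : Measurable fun p : (Fin N → ℤ) × ℝ => Φ p.1 p.2 :=
    measurable_uncurry_of_continuous fun x => by simp only [hΦ]; fun_prop
  have hexp : ∀ r, 0 ≤ r → Real.exp (-(c * r)) ≤ 1 := fun r hr =>
    Real.exp_le_one_iff.2 (neg_nonpos.2 (mul_nonneg hc.le hr))
  have hVm : Measurable V := measurable_of_countable V
  -- `v n` collects the paths that are in their `n`-th holding period at time `t`, and `u n` bounds
  -- what paths with `n` jumps before `t` can still contribute. The inequality `v n + u (n + 1) ≤ u
  -- n` telescopes, so no moment bound on the number of jumps is needed.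
  set u : ℕ → ℝ≥0∞ := fun n => ∫⁻ ω, (if jumpTime S n ω ≤ t then
    ENNReal.ofReal (Φ (Y n ω) (t - jumpTime S n ω)) else 0) ∂P with hu
  set v : ℕ → ℝ≥0∞ := fun n => ∫⁻ ω, (if jumpTime S n ω ≤ t ∧ t < jumpTime S (n + 1) ω then
    ENNReal.ofReal (V (Y n ω)) else 0) ∂P with hv
  have hT : ∀ n, Measurable (jumpTime S n) := fun n => measurable_jumpTime fun k _ => h.meas_S k
  have hvm : ∀ n, Measurable fun ω => (if jumpTime S n ω ≤ t ∧ t < jumpTime S (n + 1) ω then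
      ENNReal.ofReal (V (Y n ω)) else 0) := fun n =>
    Measurable.ite ((measurableSet_le (hT n) measurable_const).inter
      (measurableSet_lt measurable_const (hT (n + 1))))
      (hVm.comp (h.meas_Y n)).ennreal_ofReal measurable_const
  have step : ∀ n, v n + u (n + 1) ≤ u n := by
    intro n
    set g : ((Fin N → ℤ) × ℝ) × ((Fin N → ℤ) × ℝ≥0∞) → ℝ≥0∞ := fun p =>
      (if p.1.2 ≤ t ∧ t < p.1.2 + p.2.2.toReal then ENNReal.ofReal (V p.1.1) else 0) +
      (if p.1.2 + p.2.2.toReal ≤ t then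
        ENNReal.ofReal (Φ p.2.1 (t - (p.1.2 + p.2.2.toReal))) else 0) with hg
    have m1 : Measurable fun p : ((Fin N → ℤ) × ℝ) × ((Fin N → ℤ) × ℝ≥0∞) => p.1.2 := by fun_prop
    have m2 : Measurable fun p : ((Fin N → ℤ) × ℝ) × ((Fin N → ℤ) × ℝ≥0∞) =>
      p.1.2 + p.2.2.toReal := by fun_prop
    have hgm : Measurable g := by
      refine Measurable.add ?_ ?_
      · exact Measurable.ite ((measurableSet_le m1 measurable_const).inter
          (measurableSet_lt measurable_const m2))
          (hVm.comp (measurable_fst.comp measurable_fst)).ennreal_ofReal measurable_const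
      · refine Measurable.ite (measurableSet_le m2 measurable_const)
          (Measurable.ennreal_ofReal ?_) measurable_const
        exact hΦm.comp (g := fun p : (Fin N → ℤ) × ℝ => Φ p.1 p.2)
          (f := fun p : ((Fin N → ℤ) × ℝ) × ((Fin N → ℤ) × ℝ≥0∞) =>
            (p.2.1, t - (p.1.2 + p.2.2.toReal))) (by fun_prop)
    have key := h.lintegral_step n (Z := jumpTime S n) (measurable_jumpTime
      (mΩ := jumpHistory Y S n) fun k hk => measurable_jumpHistory_S Y S hk) hgm
    have e : v n + u (n + 1) = ∫⁻ ω, g ((Y n ω, jumpTime S n ω), (Y (n + 1) ω, S n ω)) ∂P := by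
      rw [hv, hu, ← lintegral_add_left (hvm n)]
      simp only [hg, jumpTime_succ]
    rw [e, key]
    refine lintegral_mono_ae ?_
    filter_upwards [h.ae_monotone hx₀ hrate] with ω hω
    have hlm := rateMin_le h.mass_pos h.left_nonneg h.right_nonneg (hω n)
    have hl := hrate.trans_le hlm
    have i1 := isProbabilityMeasure_jumpLaw h.mass_pos h.left_nonneg h.right_nonneg (Y n ω)
    have i2 := isProbabilityMeasure_holdLaw hl.le
    split_ifs with hle
    · set τ := jumpTime S n ω
      set x := Y n ω
      set l := totalRate m a b x
      rw [stepKernel_apply, lintegral_prod_symm' (fun z => g ((x, τ), z)) (hgm.comp measurable_prodMk_left),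
        ← lintegral_holdLaw_renewal hl (hcr.trans_le hlm) hc (hV0 x).le hk0 (sub_nonneg.2 hle)]
      refine lintegral_mono fun s => ?_
      have hW : V x + gen m a b V x / l ≤ V x * (l - c) / l + k * c / l := by
        rw [hk, div_mul_cancel₀ _ hc.ne', ← add_div, ← sub_nonneg]
        have := hV x (hω n)
        have e2 : (V x * (l - c) + K) / l - (V x + gen m a b V x / l) =
            (-(c * V x) + K - gen m a b V x) / l := by
          field_simp
          ring
        rw [e2]
        exact div_nonneg (by linarith) hl.le
      by_cases hs : s.toReal ≤ t - τ
      · have hs' : τ + s.toReal ≤ t := by linarith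
        have hs2 : ¬ (t < τ + s.toReal) := not_lt.2 hs'
        simp only [hg, hs, hs', hs2, and_false, if_true, if_false, zero_add]
        rw [← ofReal_integral_eq_lintegral_ofReal (integrable_jumpLaw _)]
        · refine ENNReal.ofReal_le_ofReal ?_
          simp only [hΦ]
          rw [integral_add (integrable_jumpLaw _) (integrable_const _), integral_const_mul,
            integral_jumpLaw h.mass_pos h.left_nonneg h.right_nonneg hl.ne', integral_const,
            probReal_univ, one_smul, show t - (τ + s.toReal) = t - τ - s.toReal by ring]
          have := mul_le_mul_of_nonneg_left hW (Real.exp_pos (-(c * (t - τ - s.toReal)))).le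
          linarith
        · refine ae_of_all _ fun y => ?_
          have := hexp (t - (τ + s.toReal)) (by linarith)
          have := Real.exp_pos (-(c * (t - (τ + s.toReal))))
          exact add_nonneg (mul_nonneg this.le (hV0 y).le) (mul_nonneg hk0 (by linarith))
      · have hs' : ¬ (τ + s.toReal ≤ t) := by intro h'; apply hs; linarith
        have hs2 : t < τ + s.toReal := not_le.1 hs'
        simp [hg, hs, hs', hs2, hle]
    · rw [nonpos_iff_eq_zero, lintegral_eq_zero_iff
        (f := fun z => g ((Y n ω, jumpTime S n ω), z)) (hgm.comp measurable_prodMk_left)]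
      refine ae_of_all _ fun z => ?_
      have h1 : ¬ (jumpTime S n ω + z.2.toReal ≤ t) := by
        have := ENNReal.toReal_nonneg (a := z.2)
        intro h'; apply hle; linarith
      simp [hg, hle, h1]
  have hsum : ∀ n, ∑ i ∈ Finset.range n, v i + u n ≤ u 0 := by
    intro n
    induction n with
    | zero => simp
    | succ n ih =>
      rw [Finset.sum_range_succ, add_assoc]
      exact (add_le_add le_rfl (step n)).trans ih
  have hu0 : u 0 ≤ ENNReal.ofReal (V x₀ + k) := by
    have : u 0 ≤ ∫⁻ ω, ENNReal.ofReal (V x₀ + k) ∂P := by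
      refine lintegral_mono_ae ?_
      filter_upwards [h.init] with ω hω
      simp only [jumpTime, Finset.range_zero, Finset.sum_empty, ht, if_true, hω, sub_zero]
      refine ENNReal.ofReal_le_ofReal ?_
      have h1 := mul_le_mul_of_nonneg_right (hexp t ht) (hV0 x₀).le
      have h2 := mul_nonneg hk0 (Real.exp_pos (-(c * t))).le
      simp only [hΦ]
      linarith
    simpa using this
  calc ∫⁻ ω, ENNReal.ofReal (V (X t ω)) ∂P ≤ ∫⁻ ω, ∑' n,
        (if jumpTime S n ω ≤ t ∧ t < jumpTime S (n + 1) ω then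
          ENNReal.ofReal (V (Y n ω)) else 0) ∂P := by
        refine lintegral_mono_ae ?_
        filter_upwards [h.ae_exists_index hx₀ hrate hX] with ω hω
        obtain ⟨n, hn, -⟩ := hω
        obtain ⟨h1, h2, h3⟩ := hn t ht
        refine le_trans ?_ (ENNReal.le_tsum (n t))
        rw [if_pos ⟨h1, h2⟩, h3]
    _ = ∑' n, v n := lintegral_tsum fun n => (hvm n).aemeasurable
    _ ≤ ENNReal.ofReal (V x₀ + k) := by
        refine ENNReal.tsum_le_of_sum_range_le fun n => ?_
        exact (le_self_add.trans (hsum n)).trans hu0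

/-- Markov's inequality for `V` at a fixed time, using the uniform mean bound. -/
lemma IsJumpChain.measureReal_le_span_le (h : IsJumpChain P m a b x₀ Y S) (hx₀ : Monotone x₀)
    {X : ℝ → Ω → Fin N → ℤ} (hX : Follows P Y S X) {t : ℝ} (hXm : Measurable (X t))
    {V f : (Fin N → ℤ) → ℝ} {c K δ : ℝ} (hc : 0 < c)
    (hcr : c < rateMin m a b) (hK : 0 ≤ K) (hV0 : ∀ x, 0 < V x)
    (hV : ∀ x, Monotone x → gen m a b V x ≤ -(c * V x) + K) (hδ : 0 ≤ δ)
    (hf : ∀ x, Monotone x → Real.exp (δ * f x) ≤ V x) (ht : 0 ≤ t) (s : ℝ) :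
    P.real {ω | s ≤ f (X t ω)} ≤ (V x₀ + K / c) * Real.exp (-(δ * s)) := by
  have hrate : 0 < rateMin m a b := hc.trans hcr
  have h1 := h.lintegral_lyapunov_le hx₀ hX hc hcr hK hV0 hV ht
  have hVm : Measurable V := measurable_of_countable V
  have h2 := mul_meas_ge_le_lintegral (μ := P) (hVm.comp hXm).ennreal_ofReal
    (ENNReal.ofReal (Real.exp (δ * s)))
  have h3 : P {ω | s ≤ f (X t ω)} ≤
      P {ω | ENNReal.ofReal (Real.exp (δ * s)) ≤ ENNReal.ofReal ((V ∘ X t) ω)} := by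
    refine measure_mono_ae ?_
    filter_upwards [h.ae_exists_index hx₀ hrate hX, h.ae_monotone hx₀ hrate] with ω hω hω' hs
    obtain ⟨n, hn, -⟩ := hω
    have hmono : Monotone (X t ω) := by rw [(hn t ht).2.2]; exact hω' _
    refine ENNReal.ofReal_le_ofReal (le_trans (Real.exp_le_exp.2 ?_) (hf _ hmono))
    exact mul_le_mul_of_nonneg_left hs hδ
  have h4 : ENNReal.ofReal (Real.exp (δ * s)) * P {ω | s ≤ f (X t ω)} ≤
      ENNReal.ofReal (V x₀ + K / c) := ((mul_le_mul_right h3 _).trans h2).trans h1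
  have hpos : 0 ≤ V x₀ + K / c := add_nonneg (hV0 x₀).le (div_nonneg hK hc.le)
  have h5 := ENNReal.toReal_mono ENNReal.ofReal_ne_top h4
  rw [ENNReal.toReal_mul, ENNReal.toReal_ofReal hpos, ENNReal.toReal_ofReal (Real.exp_pos _).le]
    at h5
  rw [measureReal_def, Real.exp_neg, ← div_eq_mul_inv, le_div_iff₀ (Real.exp_pos _), mul_comm]
  exact h5

end Lyapunov

/-! ### Logarithmic growth along paths. -/

section Growth

variable {N : ℕ} {m a b : Fin N → ℝ} {Ω : Type*} [MeasurableSpace Ω] {P : Measure Ω}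
  {x₀ : Fin N → ℤ} {Y : ℕ → Ω → Fin N → ℤ} {S : ℕ → Ω → ℝ≥0∞} [IsProbabilityMeasure P]

lemma IsJumpChain.ae_exists_index_le (h : IsJumpChain P m a b x₀ Y S) (hx₀ : Monotone x₀)
    (hrate : 0 < rateMin m a b) {X : ℝ → Ω → Fin N → ℤ} (hX : Follows P Y S X) :
    ∀ᵐ ω ∂P, ∃ n : ℝ → ℕ, (∀ t, 0 ≤ t → jumpTime S (n t) ω ≤ t ∧ t < jumpTime S (n t + 1) ω ∧
      X t ω = Y (n t) ω) ∧ Tendsto n atTop atTop ∧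
      ∀ᶠ t in atTop, (n t : ℝ) + 1 ≤ 4 * rateMax m a b * t := by
  have hΛ := rateMax_pos h.mass_pos h.left_nonneg h.right_nonneg hrate
  filter_upwards [h.ae_exists_index hx₀ hrate hX, h.ae_eventually_le_jumpTime hx₀ hrate]
    with ω ⟨n, hn, hn'⟩ hT
  refine ⟨n, hn, hn', ?_⟩
  filter_upwards [hn'.eventually hT, eventually_ge_atTop 0] with t h1 ht
  have := h1.trans (hn t ht).1
  rw [div_le_iff₀ (by positivity)] at this
  linarith

/-- A function with an exponential Lyapunov majorant grows at most logarithmically along the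
jump chain. -/
lemma IsJumpChain.ae_eventually_le_log (h : IsJumpChain P m a b x₀ Y S) (hx₀ : Monotone x₀)
    (hrate : 0 < rateMin m a b) {V f : (Fin N → ℤ) → ℝ} {c K δ : ℝ} (hc : 0 < c)
    (hK : 0 ≤ K) (hV0 : ∀ x, 0 < V x)
    (hV : ∀ x, Monotone x → gen m a b V x ≤ -(c * V x) + K) (hδ : 0 < δ)
    (hf : ∀ x, Monotone x → Real.exp (δ * f x) ≤ V x) :
    ∀ᵐ ω ∂P, ∀ᶠ n : ℕ in atTop, f (Y n ω) ≤ 3 / δ * Real.log ((n : ℝ) + 1) := by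
  set D := V x₀ + K / rateMin m a b with hD
  have hKr : 0 ≤ K / rateMin m a b := div_nonneg hK hrate.le
  have hD0 : 0 ≤ D := add_nonneg (hV0 x₀).le hKr
  -- A linear bound is enough here, so only `gen V ≤ K` is used and the negative part of the drift
  -- is dropped.
  have hmean : ∀ n : ℕ, ∫ ω, V (Y n ω) ∂P ≤ D * (n + 1) := by
    intro n
    have := h.integral_le_add_sum hx₀ hrate (f := fun x _ => V x)
      (g := fun _ _ => K / rateMin m a b) (fun x => continuous_const) (fun x => continuous_const)
      (fun x hx t _ => by
        have hl := rateMin_le h.mass_pos h.left_nonneg h.right_nonneg hx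
        have h1 : gen m a b V x / totalRate m a b x ≤ K / totalRate m a b x :=
          div_le_div_of_nonneg_right (by linarith [hV x hx, mul_pos hc (hV0 x)])
            (hrate.le.trans hl)
        have h2 : K / totalRate m a b x ≤ K / rateMin m a b :=
          div_le_div_of_nonneg_left hK hrate hl
        linarith) n
    simp only [integral_const, probReal_univ, one_smul, Finset.sum_const, Finset.card_range,
      nsmul_eq_mul] at this
    have h3 : 0 ≤ V x₀ * n := mul_nonneg (hV0 x₀).le (Nat.cast_nonneg n)
    rw [hD]
    linarith
  have hVm : Measurable V := measurable_of_countable V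
  -- Dividing by `(n + 1) ^ 3` makes the means summable; `V (Y n) ≤ (n + 1) ^ 3` eventually, whence
  -- the factor `3 / δ`.
  have key := ae_tendsto_zero_of_summable (P := P)
    (f := fun n ω => V (Y n ω) * (((n : ℝ) + 1) ^ 3)⁻¹)
    (fun n => (hVm.comp (h.meas_Y n)).mul_const _)
    (ae_of_all _ fun ω n => mul_nonneg (hV0 _).le (by positivity))
    (c := fun k => D * (1 / ((k : ℝ) + 1) ^ 2)) (fun k => by positivity)
    (summable_one_div_add_one_sq.mul_left D) ?_
  · filter_upwards [key, h.ae_monotone hx₀ hrate] with ω h1 h2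
    filter_upwards [h1.eventually (gt_mem_nhds one_pos)] with n hn
    rw [← div_eq_mul_inv, div_lt_one (by positivity)] at hn
    have h3 := (hf _ (h2 n)).trans hn.le
    have h4 := Real.log_le_log (Real.exp_pos _) h3
    rw [Real.log_exp, Real.log_pow] at h4
    rw [div_mul_eq_mul_div, le_div_iff₀ hδ]
    push_cast at h4
    linarith
  · intro n
    have hI := h.integrable_comp hx₀ hrate (f := fun x _ => V x) (fun _ => continuous_const) n n
    rw [← ofReal_integral_eq_lintegral_ofReal (hI.mul_const _)
      (ae_of_all _ fun ω => mul_nonneg (hV0 _).le (by positivity)), integral_mul_const]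
    refine ENNReal.ofReal_le_ofReal ?_
    refine (mul_le_mul_of_nonneg_right (hmean n) (by positivity)).trans (le_of_eq ?_)
    field_simp

lemma IsJumpChain.ae_limsup_div_log_lt_top (h : IsJumpChain P m a b x₀ Y S) (hx₀ : Monotone x₀)
    (hrate : 0 < rateMin m a b) {X : ℝ → Ω → Fin N → ℤ} (hX : Follows P Y S X)
    {f : (Fin N → ℤ) → ℝ} {C : ℝ} (hC : 0 ≤ C)
    (hf : ∀ᵐ ω ∂P, ∀ᶠ n : ℕ in atTop, f (Y n ω) ≤ C * Real.log ((n : ℝ) + 1)) :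
    ∀ᵐ ω ∂P, limsup (fun t : ℝ => ((f (X t ω) / Real.log t : ℝ) : EReal)) atTop < ⊤ := by
  have hΛ := rateMax_pos h.mass_pos h.left_nonneg h.right_nonneg hrate
  filter_upwards [hf, h.ae_exists_index_le hx₀ hrate hX] with ω h1 ⟨n, hn, hn', hn2⟩
  refine lt_of_le_of_lt (limsup_le_of_le (a := ((C * 2 : ℝ) : EReal)) (by isBoundedDefault) ?_)
    (EReal.coe_lt_top _)
  filter_upwards [hn'.eventually h1, hn2, eventually_gt_atTop 1,
    eventually_ge_atTop (4 * rateMax m a b)] with t h3 h4 h5 h6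
  rw [EReal.coe_le_coe_iff, (hn t (by linarith)).2.2]
  have hlog : 0 < Real.log t := Real.log_pos h5
  rw [div_le_iff₀ hlog]
  -- The number of jumps is at most linear in `t`, thus eventually below `t ^ 2`, so passing from
  -- jumps to time costs a factor two.
  have h7 : Real.log ((n t : ℝ) + 1) ≤ 2 * Real.log t := by
    have : (n t : ℝ) + 1 ≤ t ^ 2 := by
      rw [sq]
      exact h4.trans (mul_le_mul_of_nonneg_right h6 (by linarith))
    refine (Real.log_le_log (by positivity) this).trans (le_of_eq ?_)
    rw [Real.log_pow]
    push_cast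
    ring
  have := mul_le_mul_of_nonneg_left h7 hC
  linarith

end Growth

/-! ### Asymptotic velocities. -/

section Speed

variable {N : ℕ} {m a b : Fin N → ℝ} {Ω : Type*} [MeasurableSpace Ω] {P : Measure Ω}
  {x₀ : Fin N → ℤ} {Y : ℕ → Ω → Fin N → ℤ} {S : ℕ → Ω → ℝ≥0∞} [IsProbabilityMeasure P]

/-- `w` is a family of asymptotic velocities of the elastic system. -/
structure IsVelocity (m a b w : Fin N → ℝ) : Prop where
  mono : Monotone w
  sum_eq : ∑ j, m j * (b j - a j - w j) * w j = 0
  sum_le : ∀ x : Fin N → ℤ, Monotone x → ∑ j, m j * (b j - a j - w j) * (x j : ℝ) ≤ 0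

variable {w : Fin N → ℝ}

lemma continuous_sqMoment (x : Fin N → ℤ) : Continuous (sqMoment m w x) := by
  unfold sqMoment
  fun_prop

lemma IsJumpChain.exists_integral_sqMoment_le (h : IsJumpChain P m a b x₀ Y S)
    (hx₀ : Monotone x₀) (hrate : 0 < rateMin m a b) (hw : IsVelocity m a b w) :
    ∃ C, 0 ≤ C ∧ ∀ n : ℕ, ∫ ω, sqMoment m w (Y n ω) (clock m a b Y n ω) ∂P ≤ C * (n + 1) := by
  set c := ∑ j, m j * (a j + b j) with hc
  have hc0 : 0 ≤ c := Finset.sum_nonneg fun j _ => mul_nonneg (h.mass_pos j).le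
    (add_nonneg (h.left_nonneg j) (h.right_nonneg j))
  have hF : 0 ≤ sqMoment m w x₀ 0 := sqMoment_nonneg h.mass_pos x₀ 0
  have hcr : 0 ≤ c / rateMin m a b := div_nonneg hc0 hrate.le
  refine ⟨sqMoment m w x₀ 0 + c / rateMin m a b, add_nonneg hF hcr, fun n => ?_⟩
  have := h.integral_le_add_sum hx₀ hrate (f := fun x t => sqMoment m w x t)
      (g := fun _ _ => c / rateMin m a b) (fun x => continuous_sqMoment x)
      (fun x => continuous_const) (fun x hx t ht => by
        have hl := rateMin_le h.mass_pos h.left_nonneg h.right_nonneg hx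
        refine (sqMoment_step_le h.mass_pos h.left_nonneg h.right_nonneg hw.mono hw.sum_eq hx
          (hw.sum_le x hx) ht (hrate.trans_le hl)).trans ?_
        have : c / totalRate m a b x ≤ c / rateMin m a b :=
          div_le_div_of_nonneg_left hc0 hrate hl
        linarith) n
  simp only [integral_const, probReal_univ, one_smul, Finset.sum_const, Finset.card_range,
      nsmul_eq_mul] at this
  have h3 : 0 ≤ sqMoment m w x₀ 0 * n := mul_nonneg hF (Nat.cast_nonneg n)
  linarith

/-- The second moment of this deviation is at most that of the whole system divided by `m i`, hence
linear in `n`. Its decrements are bounded because jumps have size one and mean holding times are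
bounded. -/
lemma IsJumpChain.ae_tendsto_sub_clock (h : IsJumpChain P m a b x₀ Y S)
    (hx₀ : Monotone x₀) (hrate : 0 < rateMin m a b) (hw : IsVelocity m a b w) (i : Fin N) :
    ∀ᵐ ω ∂P, Tendsto (fun n : ℕ => ((Y n ω i : ℝ) - w i * clock m a b Y n ω) / ((n : ℝ) + 1))
      atTop (𝓝 0) := by
  obtain ⟨C, hC, hsq⟩ := h.exists_integral_sqMoment_le hx₀ hrate hw
  have hri : 0 < (rateMin m a b)⁻¹ := inv_pos.2 hrate
  refine ae_tendsto_div_of_sq_le (B := 1 + |w i| * (rateMin m a b)⁻¹) (C := C / m i)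
    (fun n => h.measurable_comp (f := fun x t => (x i : ℝ) - w i * t) (fun x => by fun_prop) n n)
    (by positivity) (div_nonneg hC (h.mass_pos i).le) ?_ ?_
  · filter_upwards [h.ae_monotone hx₀ hrate, h.ae_jump hx₀ hrate] with ω hω hj n
    have hl := rateMin_le h.mass_pos h.left_nonneg h.right_nonneg (hω n)
    have h1 := inv_anti₀ hrate hl
    have h2 : w i * (totalRate m a b (Y n ω))⁻¹ ≤ |w i| * (rateMin m a b)⁻¹ :=
      mul_le_mul (le_abs_self _) h1 (inv_nonneg.2 (hrate.le.trans hl)) (abs_nonneg _)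
    have h3 : (Y n ω i : ℝ) - 1 ≤ Y (n + 1) ω i := by
      obtain ⟨-, k, hk | hk⟩ := hj n <;> rw [hk]
      · simp only [Pi.sub_apply, Pi.single_apply]
        push_cast
        split_ifs <;> linarith
      · simp only [Pi.add_apply, Pi.single_apply]
        push_cast
        split_ifs <;> linarith
    rw [clock_succ, mul_add]
    linarith
  · intro n
    have hI := h.integrable_comp hx₀ hrate (f := fun x t => ((x i : ℝ) - w i * t) ^ 2)
      (fun x => by fun_prop) n n
    have hI2 := h.integrable_comp hx₀ hrate (f := fun x t => sqMoment m w x t)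
      (fun x => continuous_sqMoment x) n n
    rw [← ofReal_integral_eq_lintegral_ofReal hI (ae_of_all _ fun ω => sq_nonneg _)]
    refine ENNReal.ofReal_le_ofReal ?_
    rw [div_mul_eq_mul_div, le_div_iff₀ (h.mass_pos i), mul_comm, ← integral_const_mul]
    refine (integral_mono (hI.const_mul _) hI2 fun ω => ?_).trans (hsq n)
    exact Finset.single_le_sum (f := fun i => m i * ((Y n ω i : ℝ) - w i * clock m a b Y n ω) ^ 2)
      (fun j _ => mul_nonneg (h.mass_pos j).le (sq_nonneg _)) (Finset.mem_univ i)

lemma IsJumpChain.ae_tendsto_div (h : IsJumpChain P m a b x₀ Y S)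
    (hx₀ : Monotone x₀) (hrate : 0 < rateMin m a b) (hw : IsVelocity m a b w)
    {X : ℝ → Ω → Fin N → ℤ} (hX : Follows P Y S X) (i : Fin N) :
    ∀ᵐ ω ∂P, Tendsto (fun t : ℝ => (X t ω i : ℝ) / t) atTop (𝓝 (w i)) := by
  have hΛ := rateMax_pos h.mass_pos h.left_nonneg h.right_nonneg hrate
  filter_upwards [h.ae_tendsto_sub_clock hx₀ hrate hw i, h.ae_tendsto_time hx₀ hrate,
    h.ae_exists_index_le hx₀ hrate hX, h.ae_jump hx₀ hrate] with ω h1 h2 ⟨n, hn, hn', hn2⟩ hj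
  set q : ℕ → ℝ := fun n => (Y n ω i : ℝ) - w i * jumpTime S n ω with hq
  have h3 : Tendsto (fun n : ℕ => |q n / ((n : ℝ) + 1)|) atTop (𝓝 0) := by
    have := (h1.sub (h2.const_mul (w i))).abs
    simp only [mul_zero, sub_zero, abs_zero] at this
    refine this.congr fun n => ?_
    congr 1
    simp only [hq]
    ring
  have h4 : Tendsto (fun n : ℕ => 4 * rateMax m a b * (|q n / ((n : ℝ) + 1)| +
      2 * |q (n + 1) / (((n + 1 : ℕ) : ℝ) + 1)| + 1 / ((n : ℝ) + 1))) atTop (𝓝 0) := by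
    have := ((h3.add ((h3.comp (tendsto_add_atTop_nat 1)).const_mul 2)).add
      (tendsto_one_div_add_atTop_nhds_zero_nat (𝕜 := ℝ))).const_mul (4 * rateMax m a b)
    simpa using this
  rw [tendsto_iff_norm_sub_tendsto_zero]
  refine squeeze_zero' (Eventually.of_forall fun t => norm_nonneg _) ?_ (h4.comp hn')
  filter_upwards [hn2, eventually_gt_atTop 0] with t h5 h6
  obtain ⟨e1, e2, e3⟩ := hn t h6.le
  simp only [Function.comp_apply, Real.norm_eq_abs, e3]
  set k := n t
  have hk : (0 : ℝ) < (k : ℝ) + 1 := by positivity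
  have h7 : |(Y k ω i : ℝ) - Y (k + 1) ω i| ≤ 1 := by
    obtain ⟨-, l, hl | hl⟩ := hj k <;> rw [hl]
    · simp only [Pi.sub_apply, Pi.single_apply]
      push_cast
      split_ifs <;> norm_num
    · simp only [Pi.add_apply, Pi.single_apply]
      push_cast
      split_ifs <;> norm_num
  -- Between two jumps the deviation is affine in `t`, so its values at the two adjacent jump times
  -- control it, up to the size of one jump.
  have h8 : |(Y k ω i : ℝ) - w i * t| ≤ |q k| + |q (k + 1)| + 1 := by
    have b1 := abs_le.1 h7
    have c1 := neg_abs_le (q k)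
    have c2 := le_abs_self (q k)
    have c3 := neg_abs_le (q (k + 1))
    have c4 := le_abs_self (q (k + 1))
    have c5 := abs_nonneg (q k)
    have c6 := abs_nonneg (q (k + 1))
    simp only [hq] at c1 c2 c3 c4 c5 c6 ⊢
    rcases le_total 0 (w i) with hwi | hwi
    · have d1 := mul_le_mul_of_nonneg_left e1 hwi
      have d2 := mul_le_mul_of_nonneg_left e2.le hwi
      rw [abs_le]
      constructor <;> linarith [b1.1, b1.2]
    · have d1 := mul_le_mul_of_nonpos_left e1 hwi
      have d2 := mul_le_mul_of_nonpos_left e2.le hwi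
      rw [abs_le]
      constructor <;> linarith [b1.1, b1.2]
  have h9 : |(Y k ω i : ℝ) / t - w i| = |(Y k ω i : ℝ) - w i * t| / t := by
    rw [← abs_of_pos h6, ← abs_div, abs_of_pos h6]
    congr 1
    field_simp
  have h10 : |q (k + 1)| ≤ 2 * |q (k + 1) / (((k + 1 : ℕ) : ℝ) + 1)| * ((k : ℝ) + 1) := by
    rw [abs_div, abs_of_pos (show (0 : ℝ) < ((k + 1 : ℕ) : ℝ) + 1 by positivity), ← mul_div_assoc,
      div_mul_eq_mul_div, le_div_iff₀ (by positivity)]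
    push_cast
    nlinarith [abs_nonneg (q (k + 1)), Nat.cast_nonneg (α := ℝ) k,
      mul_nonneg (abs_nonneg (q (k + 1))) (Nat.cast_nonneg (α := ℝ) k)]
  have h11 : |q k| = |q k / ((k : ℝ) + 1)| * ((k : ℝ) + 1) := by
    rw [abs_div, abs_of_pos hk, div_mul_cancel₀ _ hk.ne']
  have h12 : 1 / ((k : ℝ) + 1) * ((k : ℝ) + 1) = 1 := by field_simp
  rw [h9, div_le_iff₀ h6]
  set A := |q k / ((k : ℝ) + 1)| + 2 * |q (k + 1) / (((k + 1 : ℕ) : ℝ) + 1)| + 1 / ((k : ℝ) + 1)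
    with hA
  have hA0 : 0 ≤ A := by positivity
  calc _ ≤ |q k| + |q (k + 1)| + 1 := h8
    _ ≤ A * ((k : ℝ) + 1) := by rw [hA, add_mul, add_mul, ← h11, h12]; linarith
    _ ≤ A * (4 * rateMax m a b * t) := mul_le_mul_of_nonneg_left h5 hA0
    _ = _ := by ring

/-- The velocity of the cloud of each particle. -/
lemma exists_isVelocity (hm : ∀ i, 0 < m i) {ν : ℕ} {κ : Fin (ν + 1) → ℕ} (hκ : StrictMono κ)
    (hV : Set.range κ = boundaryIndices m a b) :
    ∃ w, IsVelocity m a b w ∧ (∀ j, ∀ i ∈ cloud N κ j, w i = -slope m a b κ j) ∧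
      ∀ l, ∑ i : Fin N, (if κ l ≤ (i : ℕ) then m i * (b i - a i - w i) else 0) = 0 := by
  choose J hJ using exists_mem_cloud (N := N) hm hκ hV
  have hJe : ∀ j i, i ∈ cloud N κ j ↔ J i = j := by
    intro j i
    refine ⟨fun hi => ?_, fun hi => hi ▸ hJ i⟩
    rcases lt_trichotomy (J i) j with hlt | heq | hlt
    · exact absurd (cloud_lt_of_lt hκ hlt (hJ i) hi) (lt_irrefl _)
    · exact heq
    · exact absurd (cloud_lt_of_lt hκ hlt hi (hJ i)) (lt_irrefl _)
  have hsum : ∀ F : Fin N → ℝ, ∑ i, F i = ∑ j, ∑ i ∈ cloud N κ j, F i := by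
    intro F
    rw [← Finset.sum_fiberwise Finset.univ J F]
    refine Finset.sum_congr rfl fun j _ => Finset.sum_congr ?_ fun _ _ => rfl
    ext i
    simp [hJe]
  have hwj : ∀ j, ∀ i ∈ cloud N κ j, -slope m a b κ (J i) = -slope m a b κ j := by
    intro j i hi
    rw [(hJe j i).1 hi]
  refine ⟨fun i => -slope m a b κ (J i), ⟨?_, ?_, ?_⟩, hwj, ?_⟩
  · intro i i' hi
    refine neg_le_neg (slope_anti hm hκ hV ?_)
    by_contra! hlt
    exact absurd (cloud_lt_of_lt hκ hlt (hJ i') (hJ i)) (not_lt.2 hi)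
  · rw [hsum]
    refine Finset.sum_eq_zero fun j _ => ?_
    obtain ⟨ρ, hρ⟩ := exists_isStableBlock hm hκ hV j
    rw [Finset.sum_congr rfl fun i hi => by rw [hwj j i hi], ← Finset.sum_mul, cloud_eq_block,
      hρ.sum_eq, zero_mul]
  · intro x hx
    rw [hsum]
    refine Finset.sum_nonpos fun j _ => ?_
    obtain ⟨ρ, hρ⟩ := exists_isStableBlock hm hκ hV j
    rw [Finset.sum_congr rfl fun i hi => by rw [hwj j i hi], cloud_eq_block]
    refine (hρ.sum_mul_le hx).trans ?_
    have := mul_nonneg hρ.rho_pos.le (span_nonneg hρ.lt hρ.le hx)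
    simp only [span] at this
    linarith
  · intro l
    rw [hsum]
    refine Finset.sum_eq_zero fun j _ => ?_
    -- A boundary index never cuts a cloud: each cloud is counted entirely, with vanishing excess of
    -- momentum, or not at all.
    rcases le_or_gt l j.castSucc with hl | hl
    · obtain ⟨ρ, hρ⟩ := exists_isStableBlock hm hκ hV j
      have hρ' := hρ.sum_eq
      rw [← cloud_eq_block] at hρ'
      refine Eq.trans (Finset.sum_congr rfl fun i hi => ?_) hρ'
      rw [if_pos ((hκ.monotone hl).trans (mem_cloud.1 hi).1)]
      simp only [hwj j i hi]
    · refine Finset.sum_eq_zero fun i hi => if_neg (not_le.2 ?_)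
      exact (mem_cloud.1 hi).2.trans_le (hκ.monotone (Fin.castSucc_lt_iff_succ_le.1 hl))

end Speed

/-! ### Adjacent clouds of equal speed touch infinitely often. -/

section Recurrence

variable {N : ℕ} {m a b : Fin N → ℝ} {Ω : Type*}

/-- The event that the jump chain stays in `Q` from step `n₀` to step `n₀ + n`. -/
def stays (Y : ℕ → Ω → Fin N → ℤ) (Q : Set (Fin N → ℤ)) (n₀ n : ℕ) : Set Ω :=
  {ω | ∀ l ≤ n, Y (n₀ + l) ω ∈ Q}

lemma measurableSet_stays (Y : ℕ → Ω → Fin N → ℤ) (S : ℕ → Ω → ℝ≥0∞) (Q : Set (Fin N → ℤ))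
    (n₀ n : ℕ) : MeasurableSet[jumpHistory Y S (n₀ + n)] (stays Y Q n₀ n) := by
  have : stays Y Q n₀ n = ⋂ l ∈ Set.Iic n, Y (n₀ + l) ⁻¹' Q := by
    ext ω; simp [stays]
  rw [this]
  refine MeasurableSet.biInter (Set.to_countable _) fun l hl => ?_
  exact measurable_jumpHistory_Y Y S (Nat.add_le_add_left hl n₀) (MeasurableSet.of_discrete)

variable [MeasurableSpace Ω] {P : Measure Ω} {x₀ : Fin N → ℤ}
  {Y : ℕ → Ω → Fin N → ℤ} {S : ℕ → Ω → ℝ≥0∞} [IsProbabilityMeasure P]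

/-- A drift inequality valid only in `Q` still holds in mean on the event of not having left `Q`:
that event belongs to the history, and shrinking it at the next step only discards non-negative
values of `f`. -/
lemma IsJumpChain.setIntegral_stays_succ_le (h : IsJumpChain P m a b x₀ Y S) (hx₀ : Monotone x₀)
    (hrate : 0 < rateMin m a b) {Q : Set (Fin N → ℤ)} {f e : (Fin N → ℤ) → ℝ}
    (hf : ∀ x, Monotone x → 0 ≤ f x)
    (hfe : ∀ x, Monotone x → x ∈ Q → gen m a b f x / totalRate m a b x ≤ -e x) (n₀ n : ℕ) :
    ∫ ω in stays Y Q n₀ (n + 1), f (Y (n₀ + (n + 1)) ω) ∂P +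
      ∫ ω in stays Y Q n₀ n, e (Y (n₀ + n) ω) ∂P ≤ ∫ ω in stays Y Q n₀ n, f (Y (n₀ + n) ω) ∂P := by
  have hInt : ∀ (g : (Fin N → ℤ) → ℝ) (k : ℕ), Integrable (fun ω => g (Y k ω)) P := fun g k =>
    h.integrable_comp hx₀ hrate (f := fun x _ => g x) (fun _ => continuous_const) k k
  have hA := measurableSet_stays Y S Q n₀ n
  have hA' := h.jumpHistory_le _ _ hA
  have h1 : ∫ ω in stays Y Q n₀ (n + 1), f (Y (n₀ + (n + 1)) ω) ∂P ≤
      ∫ ω in stays Y Q n₀ n, f (Y (n₀ + n + 1) ω) ∂P := by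
    refine setIntegral_mono_set (hInt f _).integrableOn ?_ ?_
    · refine ae_restrict_of_ae ?_
      filter_upwards [h.ae_monotone hx₀ hrate] with ω hω
      exact hf _ (hω _)
    · exact LE.le.eventuallyLE fun ω hω l hl => hω l (by omega)
  have h2 := h.setIntegral_step hx₀ hrate (f := fun x _ => f x) (fun _ => continuous_const)
    (n₀ + n) hA
  have h3 : ∫ ω in stays Y Q n₀ n, (f (Y (n₀ + n) ω) +
      gen m a b f (Y (n₀ + n) ω) / totalRate m a b (Y (n₀ + n) ω)) ∂P ≤
      ∫ ω in stays Y Q n₀ n, (f (Y (n₀ + n) ω) - e (Y (n₀ + n) ω)) ∂P := by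
    refine setIntegral_mono_on_ae ?_ ?_ hA' ?_
    · exact (hInt (fun x => f x + gen m a b f x / totalRate m a b x) _).integrableOn
    · exact (hInt (fun x => f x - e x) _).integrableOn
    · filter_upwards [h.ae_monotone hx₀ hrate] with ω hω hq
      have := hfe _ (hω (n₀ + n)) (hq n le_rfl)
      linarith
  rw [integral_sub (hInt f _).integrableOn (hInt e _).integrableOn] at h3
  linarith

/-- A region in which `D` is a supermartingale, and in which the chain cannot stay at bounded
`D`, is left again and again. -/
lemma IsJumpChain.ae_frequently_notMem (h : IsJumpChain P m a b x₀ Y S) (hx₀ : Monotone x₀)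
    (hrate : 0 < rateMin m a b) {Q : Set (Fin N → ℤ)} {D : (Fin N → ℤ) → ℝ}
    {G : ℝ → (Fin N → ℤ) → ℝ} {c : ℝ} (hc : 0 < c) (hD0 : ∀ x, Monotone x → 0 ≤ D x)
    (hG0 : ∀ R, 0 ≤ R → ∀ x, Monotone x → 0 ≤ G R x)
    (hD : ∀ x, Monotone x → x ∈ Q → gen m a b D x ≤ 0)
    (hG : ∀ x, Monotone x → x ∈ Q → ∀ R, 0 ≤ R → gen m a b (G R) x ≤ -if D x ≤ R then c else 0) :
    ∀ᵐ ω ∂P, ∃ᶠ n in atTop, Y n ω ∉ Q := by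
  have hΛ := rateMax_pos h.mass_pos h.left_nonneg h.right_nonneg hrate
  have hInt : ∀ (g : (Fin N → ℤ) → ℝ) (k : ℕ), Integrable (fun ω => g (Y k ω)) P := fun g k =>
    h.integrable_comp hx₀ hrate (f := fun x _ => g x) (fun _ => continuous_const) k k
  have hnull : ∀ n₀, P {ω | ∀ l, Y (n₀ + l) ω ∈ Q} = 0 := by
    intro n₀
    set B := {ω | ∀ l, Y (n₀ + l) ω ∈ Q} with hB
    have hBA : ∀ n, B ⊆ stays Y Q n₀ n := fun n ω hω l _ => hω l
    set d := ∫ ω in stays Y Q n₀ 0, D (Y (n₀ + 0) ω) ∂P with hd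
    have hdn : ∀ n, ∫ ω in stays Y Q n₀ n, D (Y (n₀ + n) ω) ∂P ≤ d := by
      intro n
      induction n with
      | zero => exact le_rfl
      | succ n ih =>
        have := h.setIntegral_stays_succ_le hx₀ hrate (Q := Q) (f := D) (e := fun _ => 0) hD0
          (fun x hx hq => by
            rw [neg_zero]
            exact div_nonpos_of_nonpos_of_nonneg (hD x hx hq)
              (totalRate_nonneg h.mass_pos h.left_nonneg h.right_nonneg x)) n₀ n
        rw [integral_zero, add_zero] at this
        exact this.trans ih
    have hd0 : 0 ≤ d := by
      refine integral_nonneg_of_ae (ae_restrict_of_ae ?_)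
      filter_upwards [h.ae_monotone hx₀ hrate] with ω hω
      exact hD0 _ (hω _)
    -- On `stays`, `D` keeps mean at most `d`, so `D > R` has mass at most about `d / R`. If staying
    -- forever had larger probability, `D ≤ R` would keep mass at least `η` at every step, and the
    -- mean of `G R` would decrease linearly below zero.
    have hR : ∀ R : ℝ, 0 < R → P.real B ≤ d / R := by
      intro R hR
      by_contra! hlt
      set η := P.real B - d / R with hη
      have hη0 : 0 < η := sub_pos.2 hlt
      set e : (Fin N → ℤ) → ℝ := fun x => c / rateMax m a b * if D x ≤ R then 1 else 0 with he
      have hstep : ∀ n, c / rateMax m a b * η ≤ ∫ ω in stays Y Q n₀ n, e (Y (n₀ + n) ω) ∂P := by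
        intro n
        have hA' := h.jumpHistory_le _ _ (measurableSet_stays Y S Q n₀ n)
        simp only [he]
        rw [integral_const_mul]
        refine mul_le_mul_of_nonneg_left ?_ (by positivity)
        have h1 : ∫ ω in stays Y Q n₀ n, (1 - D (Y (n₀ + n) ω) / R) ∂P ≤
            ∫ ω in stays Y Q n₀ n, (if D (Y (n₀ + n) ω) ≤ R then (1 : ℝ) else 0) ∂P := by
          refine setIntegral_mono_on_ae (hInt (fun x => 1 - D x / R) _).integrableOn
            (hInt (fun x => if D x ≤ R then (1 : ℝ) else 0) _).integrableOn hA' ?_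
          filter_upwards [h.ae_monotone hx₀ hrate] with ω hω _
          have := hD0 _ (hω (n₀ + n))
          split_ifs with hq
          · linarith [div_nonneg this hR.le]
          · rw [sub_nonpos, le_div_iff₀ hR]
            linarith
        rw [integral_sub (integrable_const _) ((hInt D _).integrableOn.div_const R),
          integral_div, setIntegral_const, smul_eq_mul, mul_one] at h1
        have h2 : P.real B ≤ P.real (stays Y Q n₀ n) := measureReal_mono (hBA n)
        have h3 := div_le_div_of_nonneg_right (hdn n) hR.le
        linarith
      have hG' : ∀ n : ℕ, ∫ ω in stays Y Q n₀ n, G R (Y (n₀ + n) ω) ∂P +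
          n * (c / rateMax m a b * η) ≤ ∫ ω in stays Y Q n₀ 0, G R (Y (n₀ + 0) ω) ∂P := by
        intro n
        induction n with
        | zero => simp
        | succ n ih =>
          have := h.setIntegral_stays_succ_le hx₀ hrate (Q := Q) (f := G R) (e := e) (hG0 R hR.le)
            (fun x hx hq => by
              have hl := hrate.trans_le (rateMin_le h.mass_pos h.left_nonneg h.right_nonneg hx)
              rw [div_le_iff₀ hl]
              refine (hG x hx hq R hR.le).trans ?_
              simp only [he]
              split_ifs
              · rw [neg_mul, neg_le_neg_iff, mul_one, div_mul_eq_mul_div, div_le_iff₀ hΛ]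
                exact mul_le_mul_of_nonneg_left
                  (le_rateMax h.mass_pos h.left_nonneg h.right_nonneg hx) hc.le
              · simp) n₀ n
          have h2 := hstep n
          push_cast
          linarith
      have hpos : 0 < c / rateMax m a b * η := by positivity
      obtain ⟨n, hn⟩ := exists_nat_gt
        ((∫ ω in stays Y Q n₀ 0, G R (Y (n₀ + 0) ω) ∂P) / (c / rateMax m a b * η))
      rw [div_lt_iff₀ hpos] at hn
      have h1 := hG' n
      have h2 : 0 ≤ ∫ ω in stays Y Q n₀ n, G R (Y (n₀ + n) ω) ∂P := by
        refine integral_nonneg_of_ae (ae_restrict_of_ae ?_)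
        filter_upwards [h.ae_monotone hx₀ hrate] with ω hω
        exact hG0 R hR.le _ (hω _)
      linarith
    have hz : P.real B = 0 := by
      refine le_antisymm ?_ measureReal_nonneg
      have hlim : Tendsto (fun R : ℝ => d / R) atTop (𝓝 0) := tendsto_const_nhds.div_atTop tendsto_id
      refine ge_of_tendsto hlim ?_
      filter_upwards [eventually_gt_atTop 0] with R hR' using hR R hR'
    exact (measureReal_eq_zero_iff).1 hz
  have hall : ∀ᵐ ω ∂P, ∀ n₀, ¬ ∀ l, Y (n₀ + l) ω ∈ Q := by
    rw [ae_all_iff]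
    intro n₀
    rw [ae_iff]
    simpa using hnull n₀
  filter_upwards [hall] with ω hω
  rw [frequently_atTop]
  intro n₀
  have := hω n₀
  push Not at this
  obtain ⟨l, hl⟩ := this
  exact ⟨n₀ + l, by omega, hl⟩

/-- Positive finite holding times make each chain state visible at its own jump time, and these
times tend to infinity. -/
lemma IsJumpChain.ae_frequently_of_chain (h : IsJumpChain P m a b x₀ Y S) (hx₀ : Monotone x₀)
    (hrate : 0 < rateMin m a b) {X : ℝ → Ω → Fin N → ℤ} (hX : Follows P Y S X)
    {Q : Set (Fin N → ℤ)} (hQ : ∀ᵐ ω ∂P, ∃ᶠ n in atTop, Y n ω ∉ Q) :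
    ∀ᵐ ω ∂P, ∃ᶠ t in atTop, X t ω ∉ Q := by
  have hpos : ∀ᵐ ω ∂P, ∀ n, 0 < S n ω := ae_all_iff.2 h.hold_pos
  filter_upwards [hQ, h.ae_follows hx₀ hrate hX, hpos, h.ae_jump hx₀ hrate,
    h.ae_tendsto_jumpTime_atTop hx₀ hrate] with ω h1 h2 h3 h4 h5
  rw [frequently_atTop]
  intro B
  obtain ⟨n, hn, hnB⟩ := (h1.and_eventually (h5.eventually_ge_atTop B)).exists
  refine ⟨jumpTime S n ω, hnB, ?_⟩
  rw [h2 (jumpTime S n ω) n le_rfl]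
  · exact hn
  · rw [jumpTime_succ]
    linarith [ENNReal.toReal_pos (h3 n).ne' (h4 n).1.ne]

/-- Adjacent blocks of equal velocity touch again and again. -/
lemma IsJumpChain.ae_liminf_gap_eq_zero (h : IsJumpChain P m a b x₀ Y S) (hx₀ : Monotone x₀)
    (hrate : 0 < rateMin m a b) {X : ℝ → Ω → Fin N → ℤ} (hX : Follows P Y S X)
    {k₀ k₁ k₂ : ℕ} {w ρ₁ ρ₂ : ℝ} (h₁ : IsStableBlock m a b k₀ k₁ w ρ₁)
    (h₂ : IsStableBlock m a b k₁ k₂ w ρ₂)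
    (hn₁ : 0 < ∑ i ∈ block N k₀ k₁, (a i + b i)) (hn₂ : 0 < ∑ i ∈ block N k₁ k₂, (a i + b i)) :
    ∀ᵐ ω ∂P, liminf (fun t : ℝ =>
      ((gap (block N k₀ k₁) (block N k₁ k₂) (X t ω) : ℝ) : EReal)) atTop = 0 := by
  obtain ⟨c, hc, hgen⟩ := exists_gen_huber_gap_le h.mass_pos h.left_nonneg h.right_nonneg h₁ h₂
    hn₁ hn₂
  have hlt₁ := h₁.lt
  have hlt₂ := h₂.lt
  have hle := h₂.le
  -- In `Q` the blocks do not touch, so no momentum crosses `k₁`. Leaving `Q` means that the gap is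
  -- exactly zero.
  set Q : Set (Fin N → ℤ) := {x | 0 < x ⟨k₁, by omega⟩ - x ⟨k₁ - 1, by omega⟩} with hQ
  have hpush : ∀ x, Monotone x → x ∈ Q → push m a b k₁ x = 0 := by
    intro x hx hq
    refine push_eq_zero fun p q hp hq' => ?_
    have e1 : x p ≤ x ⟨k₁ - 1, by omega⟩ := hx (by rw [Fin.le_def]; simp only; omega)
    have e2 : x ⟨k₁, by omega⟩ ≤ x q := hx (by rw [Fin.le_def]; simp only; omega)
    simp only [hQ, Set.mem_ofPred_eq] at hq
    linarith
  have hfreq := h.ae_frequently_of_chain hx₀ hrate hX (h.ae_frequently_notMem hx₀ hrate (Q := Q) hc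
    (fun x hx => meanGap_nonneg h.mass_pos hlt₁ hlt₂ hle hx)
    (fun R hR x hx => sub_nonneg.2 (huber_le (R := R)
      (meanGap_nonneg h.mass_pos hlt₁ hlt₂ hle hx)))
    (fun x hx hq => (hgen x hx (hpush x hx hq)).1)
    (fun x hx hq R hR => (hgen x hx (hpush x hx hq)).2 R hR))
  filter_upwards [hfreq, h.ae_exists_index hx₀ hrate hX, h.ae_monotone hx₀ hrate]
    with ω h3 ⟨n, hn, _⟩ h4
  have hmono : ∀ t, 0 ≤ t → Monotone (X t ω) := fun t ht => by
    rw [(hn t ht).2.2]; exact h4 _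
  refine le_antisymm (liminf_le_of_frequently_le' ?_) (le_liminf_of_le (by isBoundedDefault) ?_)
  · refine (h3.and_eventually (eventually_ge_atTop 0)).mono fun t ht => ?_
    rw [gap_block hlt₁ hlt₂ hle (hmono t ht.2)]
    have := ht.1
    simp only [hQ, Set.mem_ofPred_eq, not_lt] at this
    exact_mod_cast this
  · filter_upwards [eventually_ge_atTop 0] with t ht
    rw [gap_block hlt₁ hlt₂ hle (hmono t ht)]
    have : X t ω ⟨k₁ - 1, by omega⟩ ≤ X t ω ⟨k₁, by omega⟩ :=
      hmono t ht (by rw [Fin.le_def]; simp only; omega)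
    have h5 : (0 : ℝ) ≤ ((X t ω ⟨k₁, by omega⟩ - X t ω ⟨k₁ - 1, by omega⟩ : ℤ) : ℝ) := by
      exact_mod_cast sub_nonneg.2 this
    exact_mod_cast h5

end Recurrence

/-! ### The mean time for which two clouds are close. -/

section Occupation

variable {N : ℕ} {m a b : Fin N → ℝ} {Ω : Type*}

/-- The time spent, during the first `n` holding periods, in states where two blocks have mean
distance at most `R`. -/
def closeTime (m : Fin N → ℝ) (Y : ℕ → Ω → Fin N → ℤ) (S : ℕ → Ω → ℝ≥0∞) (k₀ k₁ k₂ : ℕ) (R : ℝ)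
    (n : ℕ) (ω : Ω) : ℝ :=
  ∑ l ∈ Finset.range n, (if meanGap m k₀ k₁ k₂ (Y l ω) ≤ R then 1 else 0) * (S l ω).toReal

lemma closeTime_nonneg (m : Fin N → ℝ) (Y : ℕ → Ω → Fin N → ℤ) (S : ℕ → Ω → ℝ≥0∞) (k₀ k₁ k₂ : ℕ)
    (R : ℝ) (n : ℕ) (ω : Ω) : 0 ≤ closeTime m Y S k₀ k₁ k₂ R n ω :=
  Finset.sum_nonneg fun l _ => mul_nonneg (by split_ifs <;> simp) ENNReal.toReal_nonneg

variable [MeasurableSpace Ω] {P : Measure Ω}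
  {x₀ : Fin N → ℤ} {Y : ℕ → Ω → Fin N → ℤ} {S : ℕ → Ω → ℝ≥0∞} {w : Fin N → ℝ}

lemma IsJumpChain.measurable_close (h : IsJumpChain P m a b x₀ Y S) (k₀ k₁ k₂ : ℕ) (R : ℝ)
    (l : ℕ) : Measurable fun ω =>
      (if meanGap m k₀ k₁ k₂ (Y l ω) ≤ R then (1 : ℝ) else 0) * (S l ω).toReal :=
  ((measurable_of_countable fun x => if meanGap m k₀ k₁ k₂ x ≤ R then (1 : ℝ) else 0).comp
    (h.meas_Y l)).mul (h.meas_S l).ennreal_toReal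

lemma IsJumpChain.measurable_closeTime (h : IsJumpChain P m a b x₀ Y S) (k₀ k₁ k₂ : ℕ) (R : ℝ)
    (n : ℕ) : Measurable (closeTime m Y S k₀ k₁ k₂ R n) :=
  Finset.measurable_fun_sum _ fun l _ => h.measurable_close k₀ k₁ k₂ R l

variable [IsProbabilityMeasure P]

/-- The first absolute moment of the deviations from the velocities `w`. -/
def absMoment (m w : Fin N → ℝ) (x : Fin N → ℤ) (t : ℝ) : ℝ := ∑ i, m i * |(x i : ℝ) - w i * t|

lemma continuous_absMoment (x : Fin N → ℤ) : Continuous (absMoment m w x) := by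
  unfold absMoment
  fun_prop

lemma sum_mul_abs_le_absMoment (hm : ∀ i, 0 < m i) (s : Finset (Fin N)) (x : Fin N → ℤ) (t : ℝ) :
    ∑ i ∈ s, m i * |(x i : ℝ) - w i * t| ≤ absMoment m w x t :=
  Finset.sum_le_sum_of_subset_of_nonneg (Finset.subset_univ s)
    fun i _ _ => mul_nonneg (hm i).le (abs_nonneg _)

/-- Young's inequality `|z| ≤ z ^ 2 / (2 r) + r / 2` with `r = √(n + 1)` converts the linear second
moment into a square-root first moment. -/
lemma IsJumpChain.exists_integral_absMoment_le (h : IsJumpChain P m a b x₀ Y S)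
    (hx₀ : Monotone x₀) (hrate : 0 < rateMin m a b) (hw : IsVelocity m a b w) :
    ∃ C, 0 ≤ C ∧ ∀ n : ℕ, ∫ ω, absMoment m w (Y n ω) (clock m a b Y n ω) ∂P ≤ C * √(n + 1) := by
  obtain ⟨C, hC, hsq⟩ := h.exists_integral_sqMoment_le hx₀ hrate hw
  have hM : 0 ≤ ∑ i, m i := Finset.sum_nonneg fun i _ => (h.mass_pos i).le
  refine ⟨(C + ∑ i, m i) / 2, by positivity, fun n => ?_⟩
  set r := √((n : ℝ) + 1) with hr
  have hr0 : 0 < r := Real.sqrt_pos.2 (by positivity)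
  have hr2 : r ^ 2 = n + 1 := Real.sq_sqrt (by positivity)
  have hpt : ∀ x t, absMoment m w x t ≤ (r⁻¹ / 2) * sqMoment m w x t + (∑ i, m i) * r / 2 := by
    intro x t
    unfold absMoment sqMoment
    rw [Finset.mul_sum, Finset.sum_mul, Finset.sum_div, ← Finset.sum_add_distrib]
    refine Finset.sum_le_sum fun i _ => ?_
    have hmi := h.mass_pos i
    set z := (x i : ℝ) - w i * t
    have : 0 ≤ m i * (r⁻¹ / 2) * (|z| - r) ^ 2 := by positivity
    have e : m i * (r⁻¹ / 2) * (|z| - r) ^ 2 =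
        r⁻¹ / 2 * (m i * |z| ^ 2) + m i * r / 2 - m i * |z| := by
      field_simp
      ring
    rw [e, sq_abs] at this
    linarith
  have hI := h.integrable_comp hx₀ hrate (f := absMoment m w) (fun x => continuous_absMoment x) n n
  have hI2 := h.integrable_comp hx₀ hrate (f := sqMoment m w) (fun x => continuous_sqMoment x) n n
  have h1 := integral_mono hI ((hI2.const_mul (r⁻¹ / 2)).add
    (integrable_const ((∑ i, m i) * r / 2))) fun ω => hpt (Y n ω) (clock m a b Y n ω)
  simp only [Pi.add_apply] at h1
  rw [integral_add (hI2.const_mul _) (integrable_const _), integral_const_mul, integral_const,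
    probReal_univ, one_smul] at h1
  have h2 := mul_le_mul_of_nonneg_left (hsq n) (show 0 ≤ r⁻¹ / 2 by positivity)
  rw [← hr2] at h2
  have e : r⁻¹ / 2 * (C * r ^ 2) = C * r / 2 := by field_simp
  rw [e] at h2
  linarith

/-- The mean number of collisions across a boundary grows at most like a square root. -/
lemma IsJumpChain.exists_sum_integral_push_le (h : IsJumpChain P m a b x₀ Y S)
    (hx₀ : Monotone x₀) (hrate : 0 < rateMin m a b) (hw : IsVelocity m a b w) {k : ℕ}
    (hk : ∑ i : Fin N, (if k ≤ (i : ℕ) then m i * (b i - a i - w i) else 0) = 0) :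
    ∃ C, 0 ≤ C ∧ ∀ n : ℕ, ∑ l ∈ Finset.range n,
      ∫ ω, push m a b k (Y l ω) / totalRate m a b (Y l ω) ∂P ≤ C * √(n + 1) := by
  obtain ⟨C, hC, habs⟩ := h.exists_integral_absMoment_le hx₀ hrate hw
  refine ⟨C + |upperMoment m k x₀|, by positivity, fun n => ?_⟩
  set W := ∑ i : Fin N, if k ≤ (i : ℕ) then m i * w i else 0 with hW
  have hpot : potSum m a b k - potSum m a b N = W := by
    rw [potSum_sub_potSum, ← sub_eq_zero, hW, ← Finset.sum_sub_distrib, ← hk]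
    refine Finset.sum_congr rfl fun i _ => ?_
    split_ifs <;> ring
  -- The drift of `W * t` minus the upper moment is exactly minus the exchange at `k`. Its final
  -- mean is at least minus the mean absolute moment, so the accumulated exchange is `O(√n)`.
  have key := h.integral_le_add_sum hx₀ hrate
    (f := fun x t => (-1) * upperMoment m k x + W * t)
    (g := fun x _ => -(push m a b k x / totalRate m a b x))
    (fun x => by fun_prop) (fun x => continuous_const) (fun x hx t _ => by
      have hl := hrate.trans_le (rateMin_le h.mass_pos h.left_nonneg h.right_nonneg hx)
      have e : gen m a b (fun y => (-1) * upperMoment m k y +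
          W * (t + (totalRate m a b x)⁻¹)) x = -(W + push m a b k x) := by
        rw [gen_add, gen_const_mul, gen_upperMoment h.mass_pos k hx, hpot]
        simp [gen]
      rw [e]
      refine le_of_eq ?_
      field_simp
      ring) n
  simp only [integral_neg, Finset.sum_neg_distrib] at key
  have hup : ∀ x t, -(absMoment m w x t) ≤ (-1) * upperMoment m k x + W * t := by
    intro x t
    have e : (-1) * upperMoment m k x + W * t =
        -∑ i ∈ Finset.univ.filter (fun i : Fin N => k ≤ (i : ℕ)), m i * ((x i : ℝ) - w i * t) := by
      rw [upperMoment, hW, Finset.sum_filter, Finset.mul_sum, Finset.sum_mul,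
        ← Finset.sum_add_distrib, ← Finset.sum_neg_distrib]
      refine Finset.sum_congr rfl fun i _ => ?_
      split_ifs <;> ring
    rw [e, neg_le_neg_iff]
    refine le_trans (Finset.sum_le_sum fun i _ => ?_) (sum_mul_abs_le_absMoment h.mass_pos _ x t)
    exact mul_le_mul_of_nonneg_left (le_abs_self _) (h.mass_pos i).le
  have hI := h.integrable_comp hx₀ hrate (f := absMoment m w) (fun x => continuous_absMoment x) n n
  have hI2 := h.integrable_comp hx₀ hrate (f := fun x t => (-1) * upperMoment m k x + W * t)
    (fun x => by fun_prop) n n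
  have h1 := integral_mono hI.neg hI2 fun ω => hup (Y n ω) (clock m a b Y n ω)
  simp only [Pi.neg_apply] at h1
  rw [integral_neg] at h1
  have h2 := habs n
  have h3 : 1 ≤ √((n : ℝ) + 1) := Real.one_le_sqrt.2 (by linarith [Nat.cast_nonneg (α := ℝ) n])
  have h4 := le_mul_of_one_le_right (abs_nonneg (upperMoment m k x₀)) h3
  have h5 := neg_abs_le (upperMoment m k x₀)
  rw [mul_zero, add_zero] at key
  rw [add_mul]
  linarith

lemma abs_blockMean_sub_le (hm : ∀ i, 0 < m i) {lo hi : ℕ} (hlt : lo < hi) (hle : hi ≤ N) {v : ℝ}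
    (hv : ∀ i ∈ block N lo hi, w i = v) (x : Fin N → ℤ) (t : ℝ) :
    |blockMean m lo hi x - v * t| ≤ (blockMass m lo hi)⁻¹ * absMoment m w x t := by
  have hM := blockMass_pos hm hlt hle
  have e : blockMean m lo hi x - v * t =
      (blockMass m lo hi)⁻¹ * ∑ i ∈ block N lo hi, m i * ((x i : ℝ) - w i * t) := by
    have e1 : ∑ i ∈ block N lo hi, m i * ((x i : ℝ) - w i * t) =
        ∑ i ∈ block N lo hi, m i * (x i : ℝ) - blockMass m lo hi * (v * t) := by
      rw [blockMass, Finset.sum_mul, ← Finset.sum_sub_distrib]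
      exact Finset.sum_congr rfl fun i hi => by rw [hv i hi]; ring
    rw [e1, blockMean]
    field_simp
  rw [e, abs_mul, abs_of_pos (inv_pos.2 hM)]
  refine mul_le_mul_of_nonneg_left ?_ (inv_nonneg.2 hM.le)
  refine (Finset.abs_sum_le_sum_abs _ _).trans (le_trans (le_of_eq ?_)
    (sum_mul_abs_le_absMoment hm (block N lo hi) x t))
  exact Finset.sum_congr rfl fun i _ => by rw [abs_mul, abs_of_pos (hm i)]

/-- The mean time for which two adjacent blocks of equal velocity are close, in terms of the
mean holding times. -/
lemma IsJumpChain.exists_sum_integral_meanGap_le (h : IsJumpChain P m a b x₀ Y S)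
    (hx₀ : Monotone x₀) (hrate : 0 < rateMin m a b) (hw : IsVelocity m a b w) {k₀ k₁ k₂ : ℕ}
    {v ρ₁ ρ₂ : ℝ} (h₁ : IsStableBlock m a b k₀ k₁ v ρ₁) (h₂ : IsStableBlock m a b k₁ k₂ v ρ₂)
    (hn₁ : 0 < ∑ i ∈ block N k₀ k₁, (a i + b i)) (hn₂ : 0 < ∑ i ∈ block N k₁ k₂, (a i + b i))
    (hv₁ : ∀ i ∈ block N k₀ k₁, w i = v) (hv₂ : ∀ i ∈ block N k₁ k₂, w i = v)
    (hk : ∀ k, k = k₀ ∨ k = k₁ ∨ k = k₂ →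
      ∑ i : Fin N, (if k ≤ (i : ℕ) then m i * (b i - a i - w i) else 0) = 0) :
    ∃ C, 0 ≤ C ∧ ∀ R : ℝ, 0 ≤ R → ∀ n : ℕ, ∑ l ∈ Finset.range n,
      ∫ ω, (if meanGap m k₀ k₁ k₂ (Y l ω) ≤ R then 1 else 0) / totalRate m a b (Y l ω) ∂P ≤
        C * (R + 1) * √(n + 1) := by
  obtain ⟨A, A', hA, hA', hind⟩ := exists_indicator_meanGap_le h.mass_pos h.left_nonneg
    h.right_nonneg h₁ h₂ hn₁ hn₂
  obtain ⟨B₀, hB₀, hp₀⟩ := h.exists_sum_integral_push_le hx₀ hrate hw (hk k₀ (by tauto))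
  obtain ⟨B₁, hB₁, hp₁⟩ := h.exists_sum_integral_push_le hx₀ hrate hw (hk k₁ (by tauto))
  obtain ⟨B₂, hB₂, hp₂⟩ := h.exists_sum_integral_push_le hx₀ hrate hw (hk k₂ (by tauto))
  obtain ⟨E, hE, habs⟩ := h.exists_integral_absMoment_le hx₀ hrate hw
  have M1 := blockMass_pos h.mass_pos h₁.lt h₁.le
  have M2 := blockMass_pos h.mass_pos h₂.lt h₂.le
  set I := (blockMass m k₁ k₂)⁻¹ + (blockMass m k₀ k₁)⁻¹ with hI
  have hI0 : 0 < I := by positivity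
  refine ⟨A * (2 * I * E + A' * (B₀ + B₁ + B₂)), by positivity, fun R hR n => ?_⟩
  have hInt : ∀ (g : (Fin N → ℤ) → ℝ) (k : ℕ), Integrable (fun ω => g (Y k ω)) P := fun g k =>
    h.integrable_comp hx₀ hrate (f := fun x _ => g x) (fun _ => continuous_const) k k
  set H : (Fin N → ℤ) → ℝ := fun x => huber R (meanGap m k₀ k₁ k₂ x) with hH
  -- Linear growth of `huber` beyond `R + 1` matters here: `H` is at most `2 * (R + 1)` times
  -- `meanGap`, whose mean is `O(√n)` because both centres move with the same velocity `v`. A pure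
  -- square would be of order `n`.
  have hHn : ∫ ω, H (Y n ω) ∂P ≤ 2 * (R + 1) * (I * (E * √(n + 1))) := by
    have hpt : ∀ x, Monotone x → ∀ t, H x ≤ 2 * (R + 1) * (I * absMoment m w x t) := by
      intro x hx t
      have h0 := meanGap_nonneg h.mass_pos h₁.lt h₂.lt h₂.le hx
      refine (huber_le h0).trans (mul_le_mul_of_nonneg_left ?_ (by positivity))
      have e1 := abs_le.1 (abs_blockMean_sub_le h.mass_pos h₁.lt h₁.le hv₁ x t)
      have e2 := abs_le.1 (abs_blockMean_sub_le h.mass_pos h₂.lt h₂.le hv₂ x t)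
      rw [hI, add_mul, meanGap]
      linarith [e1.1, e2.2]
    have hIa := h.integrable_comp hx₀ hrate (f := absMoment m w)
      (fun x => continuous_absMoment x) n n
    calc ∫ ω, H (Y n ω) ∂P ≤
        ∫ ω, 2 * (R + 1) * (I * absMoment m w (Y n ω) (clock m a b Y n ω)) ∂P := by
          refine integral_mono_ae (hInt H n) ((hIa.const_mul _).const_mul _) ?_
          filter_upwards [h.ae_monotone hx₀ hrate] with ω hω
          exact hpt _ (hω n) _
      _ ≤ _ := by
          rw [integral_const_mul, integral_const_mul]
          exact mul_le_mul_of_nonneg_left (mul_le_mul_of_nonneg_left (habs n) hI0.le)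
            (by positivity)
  have hgenH : ∑ l ∈ Finset.range n, ∫ ω, gen m a b H (Y l ω) / totalRate m a b (Y l ω) ∂P ≤
      ∫ ω, H (Y n ω) ∂P := by
    have key := h.integral_le_add_sum hx₀ hrate (f := fun x _ => (-1) * H x)
      (g := fun x _ => -(gen m a b H x / totalRate m a b x)) (fun x => continuous_const)
      (fun x => continuous_const) (fun x hx t _ => by
        rw [gen_const_mul]
        refine le_of_eq ?_
        ring) n
    simp only [integral_neg, Finset.sum_neg_distrib, integral_const_mul] at key
    have : 0 ≤ H x₀ := huber_nonneg hR
    linarith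
  have hpt : ∀ l, ∫ ω, (if meanGap m k₀ k₁ k₂ (Y l ω) ≤ R then 1 else 0) /
        totalRate m a b (Y l ω) ∂P ≤
      A * (∫ ω, gen m a b H (Y l ω) / totalRate m a b (Y l ω) ∂P + A' * (R + 1) *
        (∫ ω, push m a b k₀ (Y l ω) / totalRate m a b (Y l ω) ∂P +
        ∫ ω, push m a b k₁ (Y l ω) / totalRate m a b (Y l ω) ∂P +
        ∫ ω, push m a b k₂ (Y l ω) / totalRate m a b (Y l ω) ∂P)) := by
    intro l
    have i0 := hInt (fun x => gen m a b H x / totalRate m a b x) l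
    have ip := fun k => hInt (fun x => push m a b k x / totalRate m a b x) l
    have ip2 := hInt (fun x => push m a b k₀ x / totalRate m a b x +
      push m a b k₁ x / totalRate m a b x) l
    have ip3 := hInt (fun x => push m a b k₀ x / totalRate m a b x +
      push m a b k₁ x / totalRate m a b x + push m a b k₂ x / totalRate m a b x) l
    rw [← integral_add (ip k₀) (ip k₁), ← integral_add ip2 (ip k₂),
      ← integral_const_mul, ← integral_add i0 (ip3.const_mul _), ← integral_const_mul]
    refine integral_mono_ae
      (hInt (fun x => (if meanGap m k₀ k₁ k₂ x ≤ R then 1 else 0) / totalRate m a b x) l)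
      ((i0.add (ip3.const_mul _)).const_mul _) ?_
    filter_upwards [h.ae_monotone hx₀ hrate] with ω hω
    have hl := hrate.trans_le (rateMin_le h.mass_pos h.left_nonneg h.right_nonneg (hω l))
    have := div_le_div_of_nonneg_right (hind R hR _ (hω l)) hl.le
    refine this.trans (le_of_eq ?_)
    simp only [hH]
    ring
  refine (Finset.sum_le_sum fun l _ => hpt l).trans ?_
  rw [← Finset.mul_sum, Finset.sum_add_distrib, ← Finset.mul_sum, Finset.sum_add_distrib,
    Finset.sum_add_distrib, show ∀ z y : ℝ, A * z * (R + 1) * y = A * (z * (R + 1) * y) from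
      fun z y => by ring]
  refine mul_le_mul_of_nonneg_left ?_ hA.le
  have q : 0 ≤ A' * (R + 1) := by positivity
  have := mul_le_mul_of_nonneg_left (add_le_add (add_le_add (hp₀ n) (hp₁ n)) (hp₂ n)) q
  have := hgenH.trans hHn
  linarith

/-- Given the current state, the holding time has mean at most twice the inverse rate. -/
lemma IsJumpChain.lintegral_close_le (h : IsJumpChain P m a b x₀ Y S)
    (hx₀ : Monotone x₀) (hrate : 0 < rateMin m a b) (k₀ k₁ k₂ : ℕ) (R : ℝ) (l : ℕ) :
    ∫⁻ ω, ENNReal.ofReal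
      ((if meanGap m k₀ k₁ k₂ (Y l ω) ≤ R then 1 else 0) * (S l ω).toReal) ∂P ≤
    ENNReal.ofReal (2 * ∫ ω, (if meanGap m k₀ k₁ k₂ (Y l ω) ≤ R then 1 else 0) /
      totalRate m a b (Y l ω) ∂P) := by
  set q : (Fin N → ℤ) → ℝ := fun x => if meanGap m k₀ k₁ k₂ x ≤ R then 1 else 0 with hq
  have hq0 : ∀ x, 0 ≤ q x := fun x => by simp only [hq]; split_ifs <;> simp
  have hqm : Measurable q := measurable_of_countable q
  have key := h.lintegral_step l (Z := fun _ : Ω => ()) measurable_const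
    (g := fun p => ENNReal.ofReal (q p.1.1 * p.2.2.toReal))
    (Measurable.ennreal_ofReal ((hqm.comp (measurable_fst.comp measurable_fst)).mul (by fun_prop)))
  have hInt := h.integrable_comp hx₀ hrate (f := fun x _ => q x / totalRate m a b x)
    (fun _ => continuous_const) l l
  refine (le_of_eq key).trans ?_
  rw [← integral_const_mul, ofReal_integral_eq_lintegral_ofReal (hInt.const_mul 2)]
  · refine lintegral_mono_ae ?_
    filter_upwards [h.ae_monotone hx₀ hrate] with ω hω
    have hl := hrate.trans_le (rateMin_le h.mass_pos h.left_nonneg h.right_nonneg (hω l))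
    have i1 := isProbabilityMeasure_jumpLaw h.mass_pos h.left_nonneg h.right_nonneg (Y l ω)
    have i2 := isProbabilityMeasure_holdLaw hl.le
    rw [stepKernel_apply, (measurePreserving_snd (μ := jumpLaw m a b (Y l ω))
      (ν := holdLaw (totalRate m a b (Y l ω)))).lintegral_comp
      (f := fun s => ENNReal.ofReal (q (Y l ω) * s.toReal)) (by fun_prop)]
    simp_rw [ENNReal.ofReal_mul (hq0 (Y l ω))]
    rw [lintegral_const_mul _ (by fun_prop)]
    refine (mul_le_mul_right (lintegral_holdLaw_id_le hl) _).trans ?_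
    rw [← ENNReal.ofReal_mul (hq0 _)]
    refine ENNReal.ofReal_le_ofReal (le_of_eq ?_)
    ring
  · filter_upwards [h.ae_monotone hx₀ hrate] with ω hω
    have hl := hrate.trans_le (rateMin_le h.mass_pos h.left_nonneg h.right_nonneg (hω l))
    exact mul_nonneg zero_le_two (div_nonneg (hq0 _) hl.le)

lemma IsJumpChain.lintegral_closeTime_le (h : IsJumpChain P m a b x₀ Y S)
    (hx₀ : Monotone x₀) (hrate : 0 < rateMin m a b) (k₀ k₁ k₂ : ℕ) (R : ℝ) (n : ℕ) :
    ∫⁻ ω, ENNReal.ofReal (closeTime m Y S k₀ k₁ k₂ R n ω) ∂P ≤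
      ENNReal.ofReal (2 * ∑ l ∈ Finset.range n,
        ∫ ω, (if meanGap m k₀ k₁ k₂ (Y l ω) ≤ R then 1 else 0) / totalRate m a b (Y l ω) ∂P) := by
  have h0 : ∀ l ω, 0 ≤ (if meanGap m k₀ k₁ k₂ (Y l ω) ≤ R then (1 : ℝ) else 0) * (S l ω).toReal :=
    fun l ω => mul_nonneg (by split_ifs <;> simp) ENNReal.toReal_nonneg
  simp only [closeTime]
  simp_rw [ENNReal.ofReal_sum_of_nonneg fun l _ => h0 l _]
  rw [lintegral_finsetSum _ fun l _ => (h.measurable_close k₀ k₁ k₂ R l).ennreal_ofReal,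
    Finset.mul_sum, ENNReal.ofReal_sum_of_nonneg]
  · exact Finset.sum_le_sum fun l _ => h.lintegral_close_le hx₀ hrate k₀ k₁ k₂ R l
  · intro l _
    refine mul_nonneg zero_le_two (integral_nonneg fun ω => div_nonneg ?_
      (totalRate_nonneg h.mass_pos h.left_nonneg h.right_nonneg _))
    split_ifs <;> simp

end Occupation

/-! ### From mean occupation times to almost sure closeness estimates. -/

section Closeness

/-- No measurability of `f` is assumed: a non-negative function below an integrable one satisfies
the bound in any case, a non-integrable integral being zero by convention. This avoids any path
regularity of `X`. -/
lemma integral_le_sum_of_le_on_pieces {T : ℕ → ℝ} (hT : Monotone T) {f : ℝ → ℝ}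
    (hf : ∀ s, 0 ≤ f s) {c : ℕ → ℝ} (hc : ∀ n, 0 ≤ c n) {t : ℝ} (ht : 0 ≤ t) {K : ℕ}
    (h : ∀ s, 0 < s → s ≤ t → ∃ n < K, T n ≤ s ∧ s < T (n + 1) ∧ f s ≤ c n) :
    ∫ s in (0 : ℝ)..t, f s ≤ ∑ n ∈ Finset.range K, c n * (T (n + 1) - T n) := by
  set g : ℕ → ℝ → ℝ := fun n => (Set.Ico (T n) (T (n + 1))).indicator fun _ => c n with hg
  have hg0 : ∀ n s, 0 ≤ g n s := fun n s => Set.indicator_nonneg (fun _ _ => hc n) s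
  have hgi : ∀ n, Integrable (g n) := fun n =>
    (integrable_indicator_iff measurableSet_Ico).2
      (integrableOn_const (by rw [Real.volume_Ico]; exact ENNReal.ofReal_ne_top))
  have hInt : Integrable fun s => ∑ n ∈ Finset.range K, g n s :=
    integrable_finsetSum _ fun n _ => hgi n
  have h0 : ∀ s, 0 ≤ ∑ n ∈ Finset.range K, g n s := fun s => Finset.sum_nonneg fun n _ => hg0 n s
  rw [intervalIntegral.integral_of_le ht]
  calc ∫ s in Set.Ioc 0 t, f s ≤ ∫ s in Set.Ioc 0 t, ∑ n ∈ Finset.range K, g n s := by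
        refine integral_mono_of_nonneg (ae_of_all _ hf) hInt.integrableOn ?_
        refine (ae_restrict_iff' measurableSet_Ioc).2 (ae_of_all _ fun s hs => ?_)
        obtain ⟨n, hn, h1, h2, h3⟩ := h s hs.1 hs.2
        refine h3.trans (le_trans (le_of_eq ?_) (Finset.single_le_sum (f := fun n => g n s)
          (fun n _ => hg0 n s) (Finset.mem_range.2 hn)))
        exact (Set.indicator_of_mem (show s ∈ Set.Ico (T n) (T (n + 1)) from ⟨h1, h2⟩)
          fun _ => c n).symm
    _ ≤ ∫ s, ∑ n ∈ Finset.range K, g n s := setIntegral_le_integral hInt (ae_of_all _ h0)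
    _ = _ := by
        rw [integral_finsetSum _ fun n _ => hgi n]
        refine Finset.sum_congr rfl fun n _ => ?_
        simp only [hg]
        rw [integral_indicator measurableSet_Ico, setIntegral_const, smul_eq_mul, mul_comm,
          Real.volume_real_Ico_of_le (hT n.le_succ)]

/-- The eighth power of the scale bounds the number of jumps, whence `8 * log x`; the right side is
`x / 2` because two spans are to fit into `x`. -/
lemma eventually_log_le (C q : ℝ) :
    ∀ᶠ x : ℝ in atTop, C * (Real.log q + 8 * Real.log x) ≤ x / 2 := by
  have h : (fun x : ℝ => C * (Real.log q + 8 * Real.log x)) =o[atTop] (id : ℝ → ℝ) :=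
    ((Asymptotics.isLittleO_const_id_atTop _).add
      (Real.isLittleO_log_id_atTop.const_mul_left 8)).const_mul_left C
  filter_upwards [h.bound (show (0 : ℝ) < 1 / 2 by norm_num), eventually_ge_atTop 0] with x hx hx0
  rw [id, Real.norm_eq_abs, Real.norm_eq_abs, abs_of_nonneg hx0] at hx
  linarith [le_abs_self (C * (Real.log q + 8 * Real.log x))]

variable {N : ℕ} {m a b : Fin N → ℝ} {Ω : Type*} [MeasurableSpace Ω] {P : Measure Ω}
  {x₀ : Fin N → ℤ} {Y : ℕ → Ω → Fin N → ℤ} {S : ℕ → Ω → ℝ≥0∞} [IsProbabilityMeasure P]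
  {w : Fin N → ℝ}

/-- At time scale `(k + 1) ^ 8` and distance scale `k + 1`, the mean close time is of order `(k + 1)
* (k + 1) ^ 4`. Divided by `(k + 1) ^ 7` it is of order `(k + 1) ^ (-2)`, hence summable; this fixes
the exponent `1 / 8`. -/
lemma IsJumpChain.ae_tendsto_closeTime (h : IsJumpChain P m a b x₀ Y S)
    (hx₀ : Monotone x₀) (hrate : 0 < rateMin m a b) {k₀ k₁ k₂ : ℕ} {C : ℝ} (hC : 0 ≤ C)
    (hmean : ∀ R : ℝ, 0 ≤ R → ∀ n : ℕ, ∑ l ∈ Finset.range n,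
      ∫ ω, (if meanGap m k₀ k₁ k₂ (Y l ω) ≤ R then 1 else 0) / totalRate m a b (Y l ω) ∂P ≤
        C * (R + 1) * √(n + 1)) (q : ℕ) :
    ∀ᵐ ω ∂P, Tendsto (fun k : ℕ =>
      closeTime m Y S k₀ k₁ k₂ (2 * ((k : ℝ) + 1)) (q * (k + 1) ^ 8) ω * (((k : ℝ) + 1) ^ 7)⁻¹)
      atTop (𝓝 0) := by
  have hB : 0 ≤ 6 * C * √((q : ℝ) + 1) := by positivity
  refine ae_tendsto_zero_of_summable (c := fun k => 6 * C * √((q : ℝ) + 1) * (1 / ((k : ℝ) + 1) ^ 2))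
    (fun k => (h.measurable_closeTime k₀ k₁ k₂ _ _).mul_const _)
    (ae_of_all _ fun ω k => mul_nonneg (closeTime_nonneg m Y S k₀ k₁ k₂ _ _ ω) (by positivity))
    (fun k => by positivity) (summable_one_div_add_one_sq.mul_left _) fun k => ?_
  have e : ∀ ω, ENNReal.ofReal (closeTime m Y S k₀ k₁ k₂ (2 * ((k : ℝ) + 1)) (q * (k + 1) ^ 8) ω *
      (((k : ℝ) + 1) ^ 7)⁻¹) = ENNReal.ofReal (closeTime m Y S k₀ k₁ k₂ (2 * ((k : ℝ) + 1))
        (q * (k + 1) ^ 8) ω) * ENNReal.ofReal ((((k : ℝ) + 1) ^ 7)⁻¹) := fun ω =>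
    ENNReal.ofReal_mul (closeTime_nonneg m Y S k₀ k₁ k₂ _ _ ω)
  simp_rw [e]
  rw [lintegral_mul_const _ (h.measurable_closeTime k₀ k₁ k₂ _ _).ennreal_ofReal]
  refine (mul_le_mul_left (h.lintegral_closeTime_le hx₀ hrate k₀ k₁ k₂ _ _) _).trans ?_
  rw [← ENNReal.ofReal_mul' (by positivity)]
  refine ENNReal.ofReal_le_ofReal ?_
  have h1 := hmean (2 * ((k : ℝ) + 1)) (by positivity) (q * (k + 1) ^ 8)
  have hk1 : (1 : ℝ) ≤ (k : ℝ) + 1 := by linarith [Nat.cast_nonneg (α := ℝ) k]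
  have h2 : √(((q * (k + 1) ^ 8 : ℕ) : ℝ) + 1) ≤ √((q : ℝ) + 1) * ((k : ℝ) + 1) ^ 4 := by
    rw [show √((q : ℝ) + 1) * ((k : ℝ) + 1) ^ 4 = √(((q : ℝ) + 1) * ((k : ℝ) + 1) ^ 8) by
      rw [Real.sqrt_mul (by positivity), show ((k : ℝ) + 1) ^ 8 = (((k : ℝ) + 1) ^ 4) ^ 2 by ring,
        Real.sqrt_sq (by positivity)]]
    refine Real.sqrt_le_sqrt ?_
    push_cast
    rw [add_mul, one_mul]
    linarith [one_le_pow₀ hk1 (n := 8)]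
  have h3 : C * (2 * ((k : ℝ) + 1) + 1) ≤ C * (3 * ((k : ℝ) + 1)) :=
    mul_le_mul_of_nonneg_left (by linarith) hC
  have h4 := h1.trans (mul_le_mul h3 h2 (Real.sqrt_nonneg _) (by positivity))
  rw [← div_eq_mul_inv, div_le_iff₀ (by positivity)]
  have e2 : 6 * C * √((q : ℝ) + 1) * (1 / ((k : ℝ) + 1) ^ 2) * ((k : ℝ) + 1) ^ 7 =
      2 * (C * (3 * ((k : ℝ) + 1)) * (√((q : ℝ) + 1) * ((k : ℝ) + 1) ^ 4)) := by
    field_simp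
    ring
  rw [e2]
  linarith

/-- Adjacent blocks of equal velocity spend little time close to each other. -/
lemma IsJumpChain.ae_tendsto_closeness (h : IsJumpChain P m a b x₀ Y S)
    (hx₀ : Monotone x₀) (hrate : 0 < rateMin m a b) {X : ℝ → Ω → Fin N → ℤ} (hX : Follows P Y S X)
    {k₀ k₁ k₂ : ℕ} (h₁ : k₀ < k₁) (h₂ : k₁ < k₂) (hN : k₂ ≤ N) {C C₁ C₂ : ℝ} (hC : 0 ≤ C)
    (hC₁ : 0 ≤ C₁) (hC₂ : 0 ≤ C₂)
    (hmean : ∀ R : ℝ, 0 ≤ R → ∀ n : ℕ, ∑ l ∈ Finset.range n,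
      ∫ ω, (if meanGap m k₀ k₁ k₂ (Y l ω) ≤ R then 1 else 0) / totalRate m a b (Y l ω) ∂P ≤
        C * (R + 1) * √(n + 1))
    (hs₁ : ∀ᵐ ω ∂P, ∀ᶠ n : ℕ in atTop,
      span h₁ (h₂.le.trans hN) (Y n ω) ≤ C₁ * Real.log ((n : ℝ) + 1))
    (hs₂ : ∀ᵐ ω ∂P, ∀ᶠ n : ℕ in atTop, span h₂ hN (Y n ω) ≤ C₂ * Real.log ((n : ℝ) + 1)) :
    ∀ᵐ ω ∂P, Tendsto (fun t : ℝ => 1 / t ^ (1 - 1 / 8 : ℝ) * ∫ s in (0 : ℝ)..t,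
      Set.indicator {r : ℝ | (gap (block N k₀ k₁) (block N k₁ k₂) (X r ω) : ℝ) ≤ t ^ (1 / 8 : ℝ)}
        (fun _ => (1 : ℝ)) s) atTop (𝓝 0) := by
  have hΛ := rateMax_pos h.mass_pos h.left_nonneg h.right_nonneg hrate
  set q := ⌈4 * rateMax m a b⌉₊ with hq
  have hqΛ : 4 * rateMax m a b ≤ q := Nat.le_ceil _
  have hq0 : (0 : ℝ) < q := by linarith
  filter_upwards [h.ae_tendsto_closeTime hx₀ hrate hC hmean q, h.ae_exists_index_le hx₀ hrate hX,
    hs₁, hs₂, h.ae_monotone hx₀ hrate] with ω hZ ⟨n, hn, _, hn2⟩ hs1 hs2 hmono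
  obtain ⟨n₀, hn₀⟩ := eventually_atTop.1 (hs1.and hs2)
  -- Rounding `t ^ (1 / 8)` down reduces all times to the countable family of scales; `k t + 1` is
  -- at most twice `t ^ (1 / 8)` once `k t ≥ 1`.
  set k : ℝ → ℕ := fun t => ⌊t ^ (1 / 8 : ℝ)⌋₊ with hk
  have hk' : Tendsto k atTop atTop :=
    tendsto_nat_floor_atTop.comp (tendsto_rpow_atTop (by norm_num))
  have hkr : Tendsto (fun t => (k t : ℝ) + 1) atTop atTop :=
    tendsto_atTop_add_const_right _ 1 (tendsto_natCast_atTop_atTop.comp hk')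
  have hinv : Tendsto (fun k : ℕ => jumpTime S n₀ ω * (((k : ℝ) + 1) ^ 7)⁻¹) atTop (𝓝 0) := by
    have h1 : Tendsto (fun k : ℕ => ((k : ℝ) + 1) ^ 7) atTop atTop :=
      (tendsto_pow_atTop (by norm_num)).comp
        (tendsto_atTop_add_const_right _ 1 tendsto_natCast_atTop_atTop)
    simpa using h1.inv_tendsto_atTop.const_mul (jumpTime S n₀ ω)
  have hlim := ((hinv.add hZ).const_mul (2 ^ 7)).comp hk'
  rw [add_zero, mul_zero] at hlim
  refine squeeze_zero' ?_ ?_ hlim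
  · filter_upwards [eventually_ge_atTop 0] with t ht
    refine mul_nonneg (by positivity) (intervalIntegral.integral_nonneg ht fun s _ => ?_)
    exact Set.indicator_nonneg (fun _ _ => zero_le_one) s
  filter_upwards [hn2, hkr.eventually (eventually_log_le C₁ q),
    hkr.eventually (eventually_log_le C₂ q), hk'.eventually_ge_atTop 1, eventually_gt_atTop 0]
    with t ht1 hl1 hl2 hkt ht0
  set y := t ^ (1 / 8 : ℝ) with hy
  have hy0 : 0 < y := Real.rpow_pos_of_pos ht0 _
  have hyt : y ^ 8 = t := by
    rw [hy, ← Real.rpow_natCast, ← Real.rpow_mul ht0.le]; norm_num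
  have hy7 : t ^ (1 - 1 / 8 : ℝ) = y ^ 7 := by
    rw [hy, ← Real.rpow_natCast, ← Real.rpow_mul ht0.le]; norm_num
  have hky : (k t : ℝ) ≤ y := Nat.floor_le hy0.le
  have hyk : y < (k t : ℝ) + 1 := Nat.lt_floor_add_one y
  set κ := k t with hκ
  have hκ1 : (1 : ℝ) ≤ κ := by exact_mod_cast hkt
  set K := q * (κ + 1) ^ 8 with hK
  have htK : 4 * rateMax m a b * t ≤ K := by
    rw [hK, ← hyt]
    push_cast
    exact mul_le_mul hqΛ (pow_le_pow_left₀ hy0.le hyk.le 8) (by positivity) (by positivity)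
  have hbound := integral_le_sum_of_le_on_pieces (T := fun l => jumpTime S l ω)
    (monotone_jumpTime S ω)
    (f := Set.indicator {r : ℝ | (gap (block N k₀ k₁) (block N k₁ k₂) (X r ω) : ℝ) ≤ y}
        (fun _ => (1 : ℝ))) (fun s => Set.indicator_nonneg (fun _ _ => zero_le_one) s)
    -- The first summand pays for the finitely many periods before `n₀`, in which the logarithmic
    -- bounds on the spans may fail.
    (c := fun l => (if l < n₀ then 1 else 0) +
      if meanGap m k₀ k₁ k₂ (Y l ω) ≤ 2 * ((κ : ℝ) + 1) then 1 else 0)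
    (fun l => add_nonneg (by split_ifs <;> simp) (by split_ifs <;> simp)) ht0.le (K := K) ?_
  · have hsum : ∑ l ∈ Finset.range K, ((if l < n₀ then (1 : ℝ) else 0) +
        if meanGap m k₀ k₁ k₂ (Y l ω) ≤ 2 * ((κ : ℝ) + 1) then 1 else 0) *
        (jumpTime S (l + 1) ω - jumpTime S l ω) ≤
        jumpTime S n₀ ω + closeTime m Y S k₀ k₁ k₂ (2 * ((κ : ℝ) + 1)) K ω := by
      simp_rw [jumpTime_succ, add_sub_cancel_left, add_mul]
      rw [Finset.sum_add_distrib]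
      refine add_le_add ?_ le_rfl
      simp_rw [ite_mul, one_mul, zero_mul]
      rw [← Finset.sum_filter]
      refine Finset.sum_le_sum_of_subset_of_nonneg (fun l hl => ?_)
        fun _ _ _ => ENNReal.toReal_nonneg
      exact Finset.mem_range.2 (Finset.mem_filter.1 hl).2
    have h3 := hbound.trans hsum
    have hy7' : (((κ : ℝ) + 1) / 2) ^ 7 ≤ y ^ 7 :=
      pow_le_pow_left₀ (by positivity) (by linarith) 7
    simp only [Function.comp_apply]
    rw [hy7, one_div, mul_comm, ← add_mul, ← mul_assoc]
    have h4 : (y ^ 7)⁻¹ ≤ 2 ^ 7 * (((κ : ℝ) + 1) ^ 7)⁻¹ := by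
      refine (inv_anti₀ (by positivity) hy7').trans (le_of_eq ?_)
      rw [div_pow, inv_div, div_eq_mul_inv]
    calc _ ≤ (jumpTime S n₀ ω + closeTime m Y S k₀ k₁ k₂ (2 * ((κ : ℝ) + 1)) K ω) *
          (2 ^ 7 * (((κ : ℝ) + 1) ^ 7)⁻¹) := by
          refine mul_le_mul h3 h4 (by positivity) (add_nonneg ?_ (closeTime_nonneg m Y S _ _ _ _ _ _))
          exact Finset.sum_nonneg fun l _ => ENNReal.toReal_nonneg
      _ = _ := by ring
  · intro s hs0 hst
    obtain ⟨e1, e2, e3⟩ := hn s hs0.le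
    obtain ⟨_, e5, _⟩ := hn t ht0.le
    have hlt : n s ≤ n t := by
      by_contra! hlt
      have := monotone_jumpTime S ω (show n t + 1 ≤ n s from hlt)
      simp only at this
      linarith
    have hltr : ((n s : ℕ) : ℝ) ≤ n t := by exact_mod_cast hlt
    have hsK : ((n s : ℕ) : ℝ) + 1 ≤ K := by linarith
    have hsK' : n s < K := by exact_mod_cast hsK
    refine ⟨n s, hsK', e1, e2, ?_⟩
    by_cases hgap : (gap (block N k₀ k₁) (block N k₁ k₂) (X s ω) : ℝ) ≤ y
    · rw [Set.indicator_of_mem (by exact hgap)]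
      by_cases hns : n s < n₀
      · rw [if_pos hns]
        split_ifs <;> norm_num
      -- The gap is at most `κ + 1` and each of the two spans at most `(κ + 1) / 2`, so `meanGap ≤ 2
      -- * (κ + 1)`.
      · rw [if_neg hns, if_pos, zero_add]
        obtain ⟨s1, s2⟩ := hn₀ (n s) (not_lt.1 hns)
        have hlog : Real.log ((n s : ℝ) + 1) ≤ Real.log q + 8 * Real.log ((κ : ℝ) + 1) := by
          refine (Real.log_le_log (by positivity) hsK).trans (le_of_eq ?_)
          rw [hK]
          push_cast
          rw [Real.log_mul hq0.ne' (by positivity), Real.log_pow]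
          push_cast
          rfl
        have s3 := s1.trans ((mul_le_mul_of_nonneg_left hlog hC₁).trans hl1)
        have s4 := s2.trans ((mul_le_mul_of_nonneg_left hlog hC₂).trans hl2)
        have s5 := meanGap_le h.mass_pos h₁ h₂ hN (hmono (n s))
        rw [e3, gap_block h₁ h₂ hN (hmono (n s))] at hgap
        push_cast at hgap
        linarith
    · rw [Set.indicator_of_notMem (by exact hgap)]
      exact add_nonneg (by split_ifs <;> simp) (by split_ifs <;> simp)

end Closeness

/-! ### Linear separation from the velocities. -/

section Separation

variable {N : ℕ} {m a b : Fin N → ℝ} {Ω : Type*} [MeasurableSpace Ω] {P : Measure Ω}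
  {x₀ : Fin N → ℤ} {Y : ℕ → Ω → Fin N → ℤ} {S : ℕ → Ω → ℝ≥0∞} [IsProbabilityMeasure P]
  {w : Fin N → ℝ}

lemma IsJumpChain.ae_tendsto_gap_div (h : IsJumpChain P m a b x₀ Y S)
    (hx₀ : Monotone x₀) (hrate : 0 < rateMin m a b) (hw : IsVelocity m a b w)
    {X : ℝ → Ω → Fin N → ℤ} (hX : Follows P Y S X)
    {k₀ k₁ k₂ : ℕ} (h₁ : k₀ < k₁) (h₂ : k₁ < k₂) (hN : k₂ ≤ N) :
    ∀ᵐ ω ∂P, Tendsto (fun t : ℝ => (gap (block N k₀ k₁) (block N k₁ k₂) (X t ω) : ℝ) / t) atTop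
      (𝓝 (w ⟨k₁, by omega⟩ - w ⟨k₁ - 1, by omega⟩)) := by
  filter_upwards [h.ae_tendsto_div hx₀ hrate hw hX ⟨k₁, by omega⟩,
    h.ae_tendsto_div hx₀ hrate hw hX ⟨k₁ - 1, by omega⟩, h.ae_monotone hx₀ hrate,
    h.ae_exists_index hx₀ hrate hX] with ω h3 h4 h5 ⟨n, hn, _⟩
  refine (h3.sub h4).congr' ?_
  filter_upwards [eventually_ge_atTop 0] with t ht
  rw [gap_block h₁ h₂ hN (by rw [(hn t ht).2.2]; exact h5 _)]
  push_cast
  ring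

end Separation

/-! ### Constants uniform in the initial state. -/

section Tails

variable {N : ℕ} {m a b : Fin N → ℝ}

lemma tail_bound_mono {C D δ δ' σ s : ℝ} (hC : 0 ≤ C) (hCD : C ≤ D) (hδ : δ' ≤ δ) (hσ : 0 ≤ σ)
    (hs : 0 ≤ s) :
    C * (1 + Real.exp (C * σ)) * Real.exp (-(δ * s)) ≤
      D * (1 + Real.exp (D * σ)) * Real.exp (-(δ' * s)) := by
  have hD : 0 ≤ D := hC.trans hCD
  gcongr

/-- The spread of a stable block has exponential tails and grows at most logarithmically. -/
lemma IsStableBlock.exists_spread_bounds {lo hi : ℕ} {w ρ : ℝ} (hm : ∀ i, 0 < m i)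
    (ha : ∀ i, 0 ≤ a i) (hb : ∀ i, 0 ≤ b i) (h : IsStableBlock m a b lo hi w ρ)
    (hrate : 0 < rateMin m a b) :
    ∃ C δ B : ℝ, 0 ≤ C ∧ 0 < δ ∧ 0 ≤ B ∧
      ∀ {Ω : Type*} [MeasurableSpace Ω] (P : Measure Ω) [IsProbabilityMeasure P] (x₀ : Fin N → ℤ)
        (Y : ℕ → Ω → Fin N → ℤ) (S : ℕ → Ω → ℝ≥0∞) (X : ℝ → Ω → Fin N → ℤ),
        IsJumpChain P m a b x₀ Y S → Follows P Y S X → Monotone x₀ →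
        (∀ t, 0 ≤ t → Measurable (X t)) →
        (∀ t : ℝ, 0 ≤ t → ∀ s : ℝ, 0 ≤ s →
          P.real {ω | s ≤ (spread (block N lo hi) (X t ω) : ℝ)} ≤
            C * (1 + Real.exp (C * (spread (block N lo hi) x₀ : ℝ))) * Real.exp (-(δ * s))) ∧
        ∀ᵐ ω ∂P, ∀ᶠ n : ℕ in atTop,
          (spread (block N lo hi) (Y n ω) : ℝ) ≤ B * Real.log ((n : ℝ) + 1) := by
  obtain ⟨V, c, K, δ, C, hc, hcr, hK, hδ, hC, hV0, hVgen, hVge, hVle⟩ :=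
    h.exists_lyapunov hm ha hb hrate
  have hexp : ∀ x, Monotone x → Real.exp (δ * (spread (block N lo hi) x : ℝ)) ≤ V x := by
    intro x hx
    rw [spread_block h.lt h.le hx]
    exact hVge x
  have h1 := Real.exp_pos C
  have h2 := div_nonneg hK hc.le
  -- The prefactor from Markov's inequality is `V x₀ + K / c`, and `V x₀ ≤ exp C * exp (C * σ)`. The
  -- sum dominates both coefficients and the exponent `C`.
  refine ⟨Real.exp C + K / c + C, δ, 3 / δ, by positivity, hδ, by positivity, ?_⟩
  intro Ω _ P _ x₀ Y S X hYS hX hx₀ hXm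
  refine ⟨fun t ht s hs => ?_, hYS.ae_eventually_le_log hx₀ hrate
    (f := fun x => (spread (block N lo hi) x : ℝ)) hc hK hV0 hVgen hδ hexp⟩
  refine (hYS.measureReal_le_span_le hx₀ hX (f := fun x => (spread (block N lo hi) x : ℝ))
    (hXm t ht) hc hcr hK hV0 hVgen hδ.le hexp ht s).trans ?_
  have hVx := hVle x₀ hx₀
  have hsp := span_nonneg h.lt h.le hx₀
  rw [← spread_block h.lt h.le hx₀] at hVx hsp
  set σ := (spread (block N lo hi) x₀ : ℝ)
  set D := Real.exp C + K / c + C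
  rw [mul_add, mul_one, Real.exp_add] at hVx
  have hσ : Real.exp (C * σ) ≤ Real.exp (D * σ) :=
    Real.exp_le_exp.2 (mul_le_mul_of_nonneg_right (by linarith) hsp)
  refine mul_le_mul_of_nonneg_right ?_ (Real.exp_pos _).le
  have h3 : Real.exp C * Real.exp (C * σ) ≤ D * Real.exp (D * σ) :=
    mul_le_mul (by linarith) hσ (Real.exp_pos _).le (by linarith)
  rw [mul_add, mul_one]
  linarith

end Tails

end Elastic

end
-- Assembly of the theorem.
theorem theorem2 (N : ℕ) (hN : 1 ≤ N) (m a b : Fin N → ℝ)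
    (hm : ∀ i, 0 < m i) (ha : ∀ i, 0 ≤ a i) (hb : ∀ i, 0 ≤ b i)
    (ν : ℕ) (κ : Fin (ν + 1) → ℕ) (hκ : StrictMono κ)
    (hV : Set.range κ = Elastic.boundaryIndices m a b)
    (hnd : ∀ j : Fin ν, 0 < ∑ i ∈ Elastic.cloud N κ j, (a i + b i)) :
    Elastic.IsCloudDecomposition (Elastic.cloud N κ) ∧
    ∃ C δ ε : ℝ, 0 ≤ C ∧ 0 < δ ∧ 0 < ε ∧ ε < 1 / 2 ∧
      ∀ (Ω : Type*) [MeasurableSpace Ω] (P : Measure Ω) [IsProbabilityMeasure P]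
        (x₀ : Fin N → ℤ) (X : ℝ → Ω → Fin N → ℤ),
        x₀ ∈ Elastic.configSpace N → Elastic.IsElasticSystem P m a b x₀ X →
        -- (a) cloud speeds
        (∀ j : Fin ν, ∀ i ∈ Elastic.cloud N κ j, ∀ᵐ ω ∂P,
          Tendsto (fun t : ℝ => (X t ω i : ℝ) / t) atTop (𝓝 (-Elastic.slope m a b κ j))) ∧
        -- (b) clouds are stable
        (∀ j : Fin ν,
          (∀ t : ℝ, 0 ≤ t → ∀ s : ℝ, 0 ≤ s →
            P.real {ω | s ≤ (Elastic.spread (Elastic.cloud N κ j) (X t ω) : ℝ)} ≤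
              C * (1 + Real.exp (C * (Elastic.spread (Elastic.cloud N κ j) x₀ : ℝ))) *
                Real.exp (-(δ * s))) ∧
          ∀ᵐ ω ∂P, limsup (fun t : ℝ =>
            (((Elastic.spread (Elastic.cloud N κ j) (X t ω) : ℝ) / Real.log t : ℝ) : EReal))
              atTop < ⊤) ∧
        -- (c) cloud separations
        (∀ j j' : Fin ν, (j' : ℕ) = j + 1 →
          Elastic.slope m a b κ j' ≤ Elastic.slope m a b κ j ∧
          (Elastic.slope m a b κ j' < Elastic.slope m a b κ j →
            0 < |Elastic.slope m a b κ j' - Elastic.slope m a b κ j| ∧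
            ∀ᵐ ω ∂P, Tendsto (fun t : ℝ =>
              (Elastic.gap (Elastic.cloud N κ j) (Elastic.cloud N κ j') (X t ω) : ℝ) / t)
              atTop (𝓝 |Elastic.slope m a b κ j' - Elastic.slope m a b κ j|)) ∧
          (Elastic.slope m a b κ j = Elastic.slope m a b κ j' →
            (∀ᵐ ω ∂P, Tendsto (fun t : ℝ =>
              1 / t ^ (1 - ε) * ∫ s in (0 : ℝ)..t,
                Set.indicator {r : ℝ |
                  (Elastic.gap (Elastic.cloud N κ j) (Elastic.cloud N κ j') (X r ω) : ℝ) ≤ t ^ ε}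
                  (fun _ => (1 : ℝ)) s)
              atTop (𝓝 0)) ∧
            ∀ᵐ ω ∂P, liminf (fun t : ℝ =>
              ((Elastic.gap (Elastic.cloud N κ j) (Elastic.cloud N κ j') (X t ω) : ℝ) : EReal))
              atTop = 0)) := by
  have hrate : 0 < Elastic.rateMin m a b := by
    -- Since `1 ≤ N`, some cloud exists, and its non-degeneracy gives a positive total rate.
    obtain ⟨j, -⟩ := Elastic.exists_mem_cloud hm hκ hV ⟨0, hN⟩
    exact Elastic.rateMin_pos hm ha hb (hnd j)
  obtain ⟨w, hw, hwj, hwk⟩ := Elastic.exists_isVelocity hm hκ hV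
  choose ρ hρ using Elastic.exists_isStableBlock hm hκ hV
  choose C δ B hC hδ hB hbound using fun j => (hρ j).exists_spread_bounds hm ha hb hrate
  have hδsum : 0 ≤ ∑ j, (δ j)⁻¹ := Finset.sum_nonneg fun j _ => (inv_pos.2 (hδ j)).le
  -- One choice for all clouds: `∑ j, C j` exceeds each `C j`, `(1 + ∑ j, (δ j)⁻¹)⁻¹` is below each
  -- `δ j` and positive even for an empty sum, and `ε = 1 / 8` comes from `ae_tendsto_closeTime`.
  -- None involves the initial state.
  refine ⟨Elastic.isCloudDecomposition_cloud hm hκ hV, ∑ j, C j, (1 + ∑ j, (δ j)⁻¹)⁻¹, 1 / 8,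
    Finset.sum_nonneg fun j _ => hC j, by positivity, by norm_num, by norm_num, ?_⟩
  rintro Ω _ P _ x₀ X hx₀ ⟨hXm, Y, S, hY, hS, hinit, hlaw, hX⟩
  have h : Elastic.IsJumpChain P m a b x₀ Y S := ⟨hm, ha, hb, hY, hS, hinit, hlaw⟩
  have hX' : Elastic.Follows P Y S X := hX
  refine ⟨fun j i hi => ?_, fun j => ?_, fun j j' hj => ?_⟩
  · rw [← hwj j i hi]
    exact h.ae_tendsto_div hx₀ hrate hw hX' i
  · rw [Elastic.cloud_eq_block]
    obtain ⟨h1, h2⟩ := hbound j P x₀ Y S X h hX' hx₀ hXm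
    refine ⟨fun t ht s hs => (h1 t ht s hs).trans ?_,
      h.ae_limsup_div_log_lt_top hx₀ hrate hX' (hB j)
        (f := fun x => (Elastic.spread (Elastic.block N (κ j.castSucc) (κ j.succ)) x : ℝ)) h2⟩
    refine Elastic.tail_bound_mono (hC j)
      (Finset.single_le_sum (fun j _ => hC j) (Finset.mem_univ j)) ?_ ?_ hs
    · refine inv_le_of_inv_le₀ (hδ j) ?_
      have := Finset.single_le_sum (fun j _ => (inv_pos.2 (hδ j)).le) (Finset.mem_univ j)
      linarith
    · rw [Elastic.spread_block (hρ j).lt (hρ j).le hx₀]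
      exact Elastic.span_nonneg (hρ j).lt (hρ j).le hx₀
  have hadj : κ j'.castSucc = κ j.succ := by
    congr 1
    ext
    simp [hj]
  have e : Elastic.cloud N κ j' = Elastic.block N (κ j.succ) (κ j'.succ) := by
    rw [Elastic.cloud_eq_block, hadj]
  have e' := Elastic.cloud_eq_block (N := N) κ j
  have hlt := (hρ j).lt
  have hlt' : κ j.succ < κ j'.succ := hadj ▸ (hρ j').lt
  have hle := (hρ j').le
  refine ⟨Elastic.slope_anti hm hκ hV (by rw [Fin.le_def]; omega), fun hslope => ⟨?_, ?_⟩,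
    fun hslope => ?_⟩
  · exact abs_pos.2 (sub_ne_zero.2 hslope.ne)
  · have := h.ae_tendsto_gap_div hx₀ hrate hw hX' hlt hlt' hle
    rw [hwj j' ⟨κ j.succ, by omega⟩ (by rw [e, Elastic.mem_block]; simp only; omega),
      hwj j ⟨κ j.succ - 1, by omega⟩ (by rw [e', Elastic.mem_block]; simp only; omega)] at this
    rw [e, e', abs_of_neg (sub_neg.2 hslope)]
    convert this using 4
    ring
  -- Equality of slopes makes both clouds stable blocks with the same velocity, as the comparison of
  -- their centres of mass requires.
  · have h₂ : Elastic.IsStableBlock m a b (κ j.succ) (κ j'.succ) (-Elastic.slope m a b κ j)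
        (ρ j') := by
      have := hρ j'
      rwa [hadj, ← hslope] at this
    have hn₁ := hnd j
    have hn₂ := hnd j'
    rw [e'] at hn₁
    rw [e] at hn₂
    obtain ⟨B', hB', hmean⟩ := h.exists_sum_integral_meanGap_le hx₀ hrate hw (hρ j) h₂ hn₁ hn₂
      (fun i hi => hwj j i (by rwa [e'])) (fun i hi => by rw [hwj j' i (by rwa [e]), hslope])
      (by rintro k (rfl | rfl | rfl) <;> exact hwk _)
    rw [e, e']
    refine ⟨?_, h.ae_liminf_gap_eq_zero hx₀ hrate hX' (hρ j) h₂ hn₁ hn₂⟩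
    refine h.ae_tendsto_closeness hx₀ hrate hX' hlt hlt' hle hB' (hB j) (hB j') hmean ?_ ?_
    · filter_upwards [(hbound j P x₀ Y S X h hX' hx₀ hXm).2, h.ae_monotone hx₀ hrate] with ω h1 h2
      filter_upwards [h1] with n hn
      rwa [Elastic.spread_block hlt (hρ j).le (h2 n)] at hn
    · filter_upwards [(hbound j' P x₀ Y S X h hX' hx₀ hXm).2, h.ae_monotone hx₀ hrate] with ω h1 h2
      filter_upwards [h1] with n hn
      rwa [hadj, Elastic.spread_block hlt' hle (h2 n)] at hn
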